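/- All manifolds are complex, Hausdorff, second countable and connected. A \emph{symplectic form} on a complex manifold $N$ is a closed holomorphic $2$-form $\omega$ that is nondegenerate on every tangent space; a subspace $W\subset T_xN$ is \emph{Lagrangian} if $W=W^{\perp}$ with respect to $\omega_x$, and a submanifold is Lagrangian if all its tangent spaces are. A \emph{smooth Lagrangian fibration} from a nonempty open set $O\subset N$ to a complex manifold $Q$ is a surjective holomorphic submersion $O\to Q$ with connected fibers whose general fibers are Lagrangian (those over a dense open subset of $Q$). A \emph{subtorus} of a complex torus $\mathbb{C}^m/\Lambda$ is a translate of the image of a complex subspace $W\subset\mathbb{C}^m$ such that $\Lambda\cap W$ spans $W$ over $\mathbb{R}$. \textbf{Proposition.} Let $(N,\omega)$ be a symplectic complex manifold and let $f:N\to B$ be a proper smooth Lagrangian fibration onto a complex manifold $B$ such that every fiber is biholomorphic to a complex torus and such that $f$ has a holomorphic section $\sigma:B\to N$ whose image is a Lagrangian submanifold. Let $O\subset N$ be a connected nonempty open subset and let $\psi:O\to Q$ be a smooth Lagrangian fibration onto a complex manifold $Q$. For $x\in O$ put $$\mathcal{D}_x:=T_x\bigl(f^{-1}(f(x))\bigr)+T_x\bigl(\psi^{-1}(\psi(x))\bigr)\subset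 T_xN .$$ \begin{enumerate} \item[(a)] Every nonempty open subset of $O$ contains a nonempty connected open subset $O'$ over which $\mathcal{D}$ is a holomorphic vector subbundle of the tangent bundle. \item[(b)] Let $O'\subset O$ be an open subset over which $\mathcal{D}$ is a holomorphic vector subbundle, and suppose that for each $x\in O'$ the set $O'\cap f^{-1}(f(x))\cap\psi^{-1}(\psi(x))$ is an open subset of a subtorus of $f^{-1}(f(x))$. Then $\mathcal{D}$ is integrable on $O'$: every point of $O'$ has an open neighborhood $W\subset O'$ with a holomorphic submersion $g:W\to\mathbb{C}^k$, for some $k$, such that $\mathcal{D}_y=\ker dg_y$ for all $y\in W$. \end{enumerate} -/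

import Mathlib

open Set Topology
open scoped Manifold ContDiff

noncomputable section

namespace LagrangianTori

/-! Complex manifolds are modelled on finite-dimensional complex vector spaces `E` through the
model `𝓘(ℂ, E)`, and "holomorphic" is `C^ω` over `ℂ`. -/

section Forms

variable {E : Type*} [NormedAddCommGroup E] [NormedSpace ℂ E]
  {N : Type*} [TopologicalSpace N] [ChartedSpace E N]

variable (E N) in
/-- A field of alternating complex bilinear forms on the tangent spaces of `N`. -/
abbrev TwoForm : Type _ := (x : N) → (TangentSpace 𝓘(ℂ, E) x) [⋀^Fin 2]→L[ℂ] ℂ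

/-- The expression of a 2-form in the preferred holomorphic chart at `p`: its pullback under the
inverse of this chart, a 2-form on the open set `(extChartAt 𝓘(ℂ, E) p).target` of `E`. -/
def TwoForm.inChart (Ω : TwoForm E N) (p : N) (y : E) : E [⋀^Fin 2]→L[ℂ] ℂ :=
  (Ω ((extChartAt 𝓘(ℂ, E) p).symm y)).compContinuousLinearMap
    (mfderiv 𝓘(ℂ, E) 𝓘(ℂ, E) (extChartAt 𝓘(ℂ, E) p).symm y)

/-- A holomorphic symplectic form: a closed holomorphic 2-form that is nondegenerate on every
tangent space. -/
structure IsSymplecticForm (Ω : TwoForm E N) : Prop where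
  holomorphic : ∀ p : N, ContDiffOn ℂ ω (Ω.inChart p)
    (extChartAt 𝓘(ℂ, E) p).target
  closed : ∀ p : N, ∀ y ∈ (extChartAt 𝓘(ℂ, E) p).target, extDeriv (Ω.inChart p) y = 0
  nondegenerate : ∀ (x : N) (v : TangentSpace 𝓘(ℂ, E) x),
    (∀ w : TangentSpace 𝓘(ℂ, E) x, Ω x ![v, w] = 0) → v = 0

/-- A subspace `W` of `T_x N` is Lagrangian if it equals its orthogonal `W^⊥`
with respect to the form. -/
def IsLagrangianSubspace (Ω : TwoForm E N) (x : N)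
    (W : Submodule ℂ (TangentSpace 𝓘(ℂ, E) x)) : Prop :=
  ∀ v : TangentSpace 𝓘(ℂ, E) x, v ∈ W ↔ ∀ w ∈ W, Ω x ![v, w] = 0

variable {E' : Type*} [NormedAddCommGroup E'] [NormedSpace ℂ E']
  {B : Type*} [TopologicalSpace B] [ChartedSpace E' B]

/-- The kernel of `df_x`. If `f` is a submersion at `x`, this is the tangent space `T_x(f⁻¹(f(x)))`
of the fiber of `f` through `x`. -/
def fiberTangent (f : N → B) (x : N) : Submodule ℂ (TangentSpace 𝓘(ℂ, E) x) :=
  LinearMap.ker (mfderiv 𝓘(ℂ, E) 𝓘(ℂ, E') f x : TangentSpace 𝓘(ℂ, E) x →ₗ[ℂ]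
    TangentSpace 𝓘(ℂ, E') (f x))

/-- `f` restricts to a smooth Lagrangian fibration `O → B` of the open set `O`: it is a holomorphic
submersion of `O` onto `B`, its fibers are connected, and the general fiber is Lagrangian. -/
structure IsSmoothLagrangianFibrationOn (Ω : TwoForm E N) (O : Set N) (f : N → B) : Prop where
  holomorphic : ContMDiffOn 𝓘(ℂ, E) 𝓘(ℂ, E') ω f O
  surjective : f '' O = univ
  submersion : ∀ x ∈ O, Function.Surjective (mfderiv 𝓘(ℂ, E) 𝓘(ℂ, E') f x)
  connected : ∀ b : B, IsConnected (O ∩ f ⁻¹' {b})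
  lagrangian : ∃ V : Set B, IsOpen V ∧ Dense V ∧
    ∀ x ∈ O, f x ∈ V → IsLagrangianSubspace Ω x (fiberTangent (E' := E') f x)

/-- `σ` is a holomorphic section of `f` whose image is a Lagrangian submanifold; the tangent space
of the image at `σ b` is the range of `dσ_b`. -/
structure IsLagrangianSection (Ω : TwoForm E N) (f : N → B) (σ : B → N) : Prop where
  holomorphic : ContMDiff 𝓘(ℂ, E') 𝓘(ℂ, E) ω σ
  isSection : ∀ b, f (σ b) = b
  lagrangian : ∀ b, IsLagrangianSubspace Ω (σ b)
    (LinearMap.range (mfderiv 𝓘(ℂ, E') 𝓘(ℂ, E) σ b : TangentSpace 𝓘(ℂ, E') b →ₗ[ℂ]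
      TangentSpace 𝓘(ℂ, E) (σ b)))

end Forms

section Tori

variable {E : Type*} [NormedAddCommGroup E] [NormedSpace ℂ E]
  {N : Type*} [TopologicalSpace N] [ChartedSpace E N]

variable (E) in
/-- The map `u : ℂᵐ → N` induces a biholomorphism of the complex torus `ℂᵐ / Λ` (`Λ` a lattice of
full rank) with the complex submanifold `S` of `N`: it is a holomorphic immersion, it has the
same value at two points exactly when they differ by an element of `Λ`, and its image is `S`. -/
structure IsTorusUniformization {m : ℕ} (Λ : Submodule ℤ (Fin m → ℂ)) (u : (Fin m → ℂ) → N)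
    (S : Set N) : Prop where
  discrete : DiscreteTopology Λ
  span_top : Submodule.span ℝ (Λ : Set (Fin m → ℂ)) = ⊤
  holomorphic : ContMDiff 𝓘(ℂ, Fin m → ℂ) 𝓘(ℂ, E) ω u
  immersion : ∀ v, Function.Injective (mfderiv 𝓘(ℂ, Fin m → ℂ) 𝓘(ℂ, E) u v)
  eq_iff : ∀ v w, u v = u w ↔ v - w ∈ Λ
  range_eq : range u = S

variable (E) in
/-- The subset `S` of `N` is a complex submanifold biholomorphic to a complex torus. -/
def IsComplexTorus (S : Set N) : Prop :=
  ∃ (m : ℕ) (Λ : Submodule ℤ (Fin m → ℂ)) (u : (Fin m → ℂ) → N), IsTorusUniformization E Λ u S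

variable (E) in
/-- `T` is a subtorus of the complex torus `S ≅ ℂᵐ / Λ` (no base point is chosen on `S`): a
translate of the image of a complex subspace `W` of `ℂᵐ` in which `Λ ∩ W` has full rank. -/
def IsSubtorus (T S : Set N) : Prop :=
  ∃ (m : ℕ) (Λ : Submodule ℤ (Fin m → ℂ)) (u : (Fin m → ℂ) → N), IsTorusUniformization E Λ u S ∧
    ∃ (W : Submodule ℂ (Fin m → ℂ)) (v₀ : Fin m → ℂ),
      Submodule.span ℝ ((Λ : Set (Fin m → ℂ)) ∩ W) = W.restrictScalars ℝ ∧
      T = u '' {v | v - v₀ ∈ W}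

variable (E) in
/-- `A` is an open subset, in the subspace topology, of some subtorus of `S`. -/
def IsOpenInSubtorus (A S : Set N) : Prop :=
  ∃ T : Set N, IsSubtorus E T S ∧ ∃ G : Set N, IsOpen G ∧ A = T ∩ G

end Tori

section Distributions

variable {E : Type*} [NormedAddCommGroup E] [NormedSpace ℂ E]
  {N : Type*} [TopologicalSpace N] [ChartedSpace E N]

/-- The family `D` of subspaces of the tangent spaces is a holomorphic vector subbundle of the
tangent bundle over the open set `U`: near every point of `U` it has a holomorphic frame. -/
def IsHolomorphicSubbundleOn [IsManifold 𝓘(ℂ, E) 1 N]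
    (D : (x : N) → Submodule ℂ (TangentSpace 𝓘(ℂ, E) x)) (U : Set N) : Prop :=
  ∀ x ∈ U, ∃ W : Set N, IsOpen W ∧ x ∈ W ∧ W ⊆ U ∧
    ∃ (k : ℕ) (X : Fin k → (y : N) → TangentSpace 𝓘(ℂ, E) y),
      (∀ i, ContMDiffOn 𝓘(ℂ, E) 𝓘(ℂ, E).tangent ω
        (fun y ↦ (⟨y, X i y⟩ : TangentBundle 𝓘(ℂ, E) N)) W) ∧
      ∀ y ∈ W, LinearIndependent ℂ (fun i ↦ X i y) ∧
        Submodule.span ℂ (range fun i ↦ X i y) = D y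

/-- The distribution `D` is (completely) integrable on the open set `U`: near every point of `U`
it is the field of tangent spaces of a holomorphic foliation, i.e. it consists of the tangent
spaces to the level sets of a holomorphic submersion to some `ℂᵏ`. -/
def IsIntegrableOn (D : (x : N) → Submodule ℂ (TangentSpace 𝓘(ℂ, E) x)) (U : Set N) : Prop :=
  ∀ x ∈ U, ∃ W : Set N, IsOpen W ∧ x ∈ W ∧ W ⊆ U ∧
    ∃ (k : ℕ) (g : N → (Fin k → ℂ)),
      ContMDiffOn 𝓘(ℂ, E) 𝓘(ℂ, Fin k → ℂ) ω g W ∧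
      ∀ y ∈ W, Function.Surjective (mfderiv 𝓘(ℂ, E) 𝓘(ℂ, Fin k → ℂ) g y) ∧
        D y = fiberTangent (E' := Fin k → ℂ) g y

variable {E₁ : Type*} [NormedAddCommGroup E₁] [NormedSpace ℂ E₁]
  {B : Type*} [TopologicalSpace B] [ChartedSpace E₁ B]
  {E₂ : Type*} [NormedAddCommGroup E₂] [NormedSpace ℂ E₂]
  {Q : Type*} [TopologicalSpace Q] [ChartedSpace E₂ Q]

variable (E E₁ E₂) in
/-- The sum `T_x(f⁻¹(f(x))) + T_x(ψ⁻¹(ψ(x)))` of the tangent spaces of the two fibers. -/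
def sumDistribution (f : N → B) (ψ : N → Q) (x : N) : Submodule ℂ (TangentSpace 𝓘(ℂ, E) x) :=
  fiberTangent (E' := E₁) f x ⊔ fiberTangent (E' := E₂) ψ x

end Distributions

end LagrangianTori

end

/-!
Write `V` and `T` for the tangent spaces of the fibers of `f` and `ψ`, so that `D = V + T`.

*The subbundle.* The rank of `D` is bounded, so it attains a maximum on any nonempty open set. Near
a point of maximal rank, projections onto the kernels of the differentials, depending
holomorphically on the point, produce holomorphic sections of `D` extending a basis; by maximality
they remain a frame (`exists_frame_of_finrank_le`, `exists_isHolomorphicSubbundleOn`).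

*Integrability.* Both `V` and `T` are Lagrangian at every point, being so on a dense set, whence
`D = (V ∩ T)^⊥`: contraction with the symplectic form `Ω` carries `V ∩ T` onto the annihilator of
`D`, and forms annihilating `D` are pulled back from covectors on the base of `f`.

- *Periods.* Let `u : ℂ^m → f⁻¹(y)` uniformize a fiber. By Liouville's theorem, contracting `Ω`
  with the constant vector field `a` on the torus gives one and the same covector `L a` on the base
  along the whole fiber (`IsTorusUniformization.exists_isPeriodMap`). For a lattice vector `l`, the
  covector `L l` extends to a closed holomorphic 1-form on the base whose values at nearby points
  are again given by lattice vectors of the fibers there (`exists_period_form`). This form is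
  obtained by integrating `Ω` over families of arcs in the fibers that join two local sections: its
  exterior derivative is the difference of the pullbacks of `Ω` along the sections
  (`IsArcFamilyAt.arcForm_spec`), and its value is the difference of the end points of a lifted arc
  (`IsArcFamilyAt.exists_lift`). Arcs within a chart suffice, since points of `ℂ^m` are joined by
  chains of such arcs (`periodRel`) and the 1-forms add up. For a lattice vector one takes the same
  section at both ends, so the exterior derivative vanishes.
- *Rationality.* If the intersection of the two fibers through a point is open in the subtorus
  defined by `W ⊆ ℂ^m`, then `V ∩ T = du(W)` there (`IsTorusUniformization.tker_inf_eq_map`). As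
  `W` is spanned by lattice vectors, the annihilator of `D` is spanned by combinations of the period
  forms with integral coefficients (`IsTorusUniformization.exists_int_coefficients`). Nearby period
  forms span only a sublattice of finite index, which is harmless.
- *Constancy.* The coefficients depend on the point, but there are only countably many choices. The
  conditions they satisfy are holomorphic, so Baire's theorem and the identity theorem provide one
  choice that works on a neighborhood (`exists_forall_eq_zero_of_countable`). The annihilator of `D`
  is then spanned by closed forms; by the Poincaré lemma these are differentials of functions, which
  are the components of the submersion with kernel `D` (`exists_submersion_ker_eq`).

The 2-form and the differentials are given on a manifold, whereas the analysis takes place in vector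
spaces; `tderiv` and `pullback` translate between the two.
-/

noncomputable section

namespace LagrangianTori

/-! ### Complex `C¹` functions of several variables are analytic -/

section Osgood

variable {E' F : Type*} [NormedAddCommGroup E'] [NormedSpace ℂ E']
  [NormedAddCommGroup F] [NormedSpace ℂ F] {K : Type*} [TopologicalSpace K] [CompactSpace K]

/-- A continuous family of operators `E' → F`, parametrized by a compact space `K`, is an operator
from `E'` to the space of continuous functions `K → F`. -/
def flipOperator : C(K, E' →L[ℂ] F) →ₗ[ℂ] E' →L[ℂ] C(K, F) where
  toFun φ := LinearMap.mkContinuous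
    { toFun := fun v ↦ ⟨fun ζ ↦ φ ζ v, by fun_prop⟩
      map_add' := fun v w ↦ by ext ζ; simp
      map_smul' := fun c v ↦ by ext ζ; simp } ‖φ‖ (fun v ↦ by
        refine (ContinuousMap.norm_le _ (by positivity)).2 fun ζ ↦ ?_
        exact (φ ζ).le_of_opNorm_le (φ.norm_coe_le_norm ζ) v)
  map_add' φ χ := by ext v ζ; simp
  map_smul' c φ := by ext v ζ; simp

@[simp] lemma flipOperator_apply (φ : C(K, E' →L[ℂ] F)) (v : E') (ζ : K) :
    flipOperator φ v ζ = φ ζ v := rfl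

lemma norm_flipOperator_le (φ : C(K, E' →L[ℂ] F)) : ‖flipOperator φ‖ ≤ ‖φ‖ :=
  ContinuousLinearMap.opNorm_le_bound _ (norm_nonneg φ) fun v ↦
    (ContinuousMap.norm_le _ (by positivity)).2 fun ζ ↦
      (φ ζ).le_of_opNorm_le (φ.norm_coe_le_norm ζ) v

lemma continuous_flipOperator :
    Continuous (flipOperator : C(K, E' →L[ℂ] F) → E' →L[ℂ] C(K, F)) :=
  AddMonoidHomClass.continuous_of_bound (flipOperator (K := K) (E' := E') (F := F)) 1 fun φ ↦ by
    simpa using norm_flipOperator_le φ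

/-- If `f ζ` is `C¹` with derivative continuous in both variables, uniformly in the parameter `ζ` of
a compact space, then `y ↦ f(·, y)` is `C¹` as a map to the space of continuous functions. -/
lemma contDiffAt_one_family {f : K → E' → F} {f' : K → E' → E' →L[ℂ] F} {y₀ : E'} {r : ℝ}
    (hr : 0 < r)
    (hd : ∀ ζ, ∀ y ∈ Metric.ball y₀ r, HasFDerivAt (f ζ) (f' ζ y) y)
    (hf : ContinuousOn (fun p : K × E' ↦ f p.1 p.2) (univ ×ˢ Metric.ball y₀ r))
    (hf' : ContinuousOn (fun p : K × E' ↦ f' p.1 p.2) (univ ×ˢ Metric.ball y₀ r)) :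
    ContDiffAt ℂ 1 (fun y ↦ ContinuousMap.mkD (fun ζ ↦ f ζ y) 0) y₀ := by
  set G : E' → C(K, F) := fun y ↦ ContinuousMap.mkD (fun ζ ↦ f ζ y) 0
  set H : E' → C(K, E' →L[ℂ] F) := fun y ↦ ContinuousMap.mkD (fun ζ ↦ f' ζ y) 0
  have hG : ∀ y ∈ Metric.ball y₀ r, ∀ ζ, G y ζ = f ζ y := fun y hy ζ ↦ by
    have : Continuous (fun ζ ↦ f ζ y) :=
      hf.comp_continuous (f := fun ζ : K ↦ (ζ, y)) (by fun_prop) (fun ζ ↦ ⟨mem_univ _, hy⟩)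
    simp only [G]; rw [ContinuousMap.mkD_apply_of_continuous this]
  have hHy : ∀ y ∈ Metric.ball y₀ r, Continuous (fun ζ ↦ f' ζ y) := fun y hy ↦
      hf'.comp_continuous (f := fun ζ : K ↦ (ζ, y)) (by fun_prop) (fun ζ ↦ ⟨mem_univ _, hy⟩)
  have hH : ∀ y ∈ Metric.ball y₀ r, ∀ ζ, H y ζ = f' ζ y := fun y hy ζ ↦ by
    simp only [H]; rw [ContinuousMap.mkD_apply_of_continuous (hHy y hy)]
  have hHc : ContinuousOn H (Metric.ball y₀ r) := by
    rw [continuousOn_iff_continuous_domRestrict]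
    let T : C(Metric.ball y₀ r × K, E' →L[ℂ] F) := ⟨fun q ↦ f' q.2 q.1,
      hf'.comp_continuous (f := fun q : Metric.ball y₀ r × K ↦ (q.2, (q.1 : E'))) (by fun_prop)
        (fun q ↦ ⟨mem_univ _, q.1.2⟩)⟩
    have : (Metric.ball y₀ r).domRestrict H = T.curry := by
      ext1 q
      ext1 ζ
      exact hH q q.2 ζ
    rw [this]
    exact T.curry.continuous
  refine contDiffAt_one_iff.2 ⟨fun y ↦ flipOperator (H y), Metric.ball y₀ r,
    Metric.ball_mem_nhds _ hr, continuous_flipOperator.comp_continuousOn hHc, fun y hy ↦ ?_⟩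
  rw [hasFDerivAt_iff_isLittleO, Asymptotics.isLittleO_iff]
  intro ε hε
  have hHcy : ContinuousAt H y := hHc.continuousAt (Metric.isOpen_ball.mem_nhds hy)
  obtain ⟨δ, hδ, hδ'⟩ := Metric.mem_nhds_iff.1 (Filter.inter_mem
    (hHcy (Metric.closedBall_mem_nhds (H y) hε)) (Metric.isOpen_ball.mem_nhds hy))
  filter_upwards [Metric.ball_mem_nhds y hδ] with y' hy'
  refine (ContinuousMap.norm_le _ (by positivity)).2 fun ζ ↦ ?_
  have h1 := hδ' hy'
  simp only [ContinuousMap.sub_apply, flipOperator_apply]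
  rw [hG y' h1.2, hG y hy, hH y hy]
  refine (convex_ball y δ).norm_image_sub_le_of_norm_hasFDerivWithin_le' (f := f ζ)
    (f' := f' ζ) (fun x hx ↦ (hd ζ x (hδ' hx).2).hasFDerivWithinAt) (fun x hx ↦ ?_)
    (Metric.mem_ball_self hδ) hy'
  rw [← hH x (hδ' hx).2, ← hH y hy, ← dist_eq_norm]
  exact (ContinuousMap.dist_apply_le_dist ζ).trans (hδ' hx).1

open MeasureTheory in
/-- The Cauchy integral formula, written with operators on the space of continuous functions on the
circle: `f z = Φ z (f|∂D)` for functions holomorphic near the closed disc, with `Φ` analytic. -/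
lemma exists_analytic_cauchy_operator (z₀ : ℂ) {r : ℝ} (hr : 0 < r) [CompleteSpace F] :
    ∃ Φ : ℂ → C(Metric.sphere z₀ r, F) →L[ℂ] F, AnalyticAt ℂ Φ z₀ ∧
      ∀ (f : ℂ → F) (φ : C(Metric.sphere z₀ r, F)), (∀ ζ, φ ζ = f ζ) →
        DiffContOnCl ℂ f (Metric.ball z₀ r) → ∀ z ∈ Metric.ball z₀ r, Φ z φ = f z := by
  let K := Metric.sphere z₀ r
  let c : C(ℝ, K) := ⟨fun θ ↦ ⟨circleMap z₀ r θ, circleMap_mem_sphere _ hr.le _⟩, by fun_prop⟩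
  let d : ℝ → ℂ := deriv (circleMap z₀ r)
  have hd : Continuous d := by
    have : deriv (circleMap z₀ r) = fun θ ↦ circleMap 0 r θ * Complex.I := by
      ext θ; simp [deriv_circleMap]
    simp only [d, this]; fun_prop
  have hint : ∀ (a : C(K, ℂ)) (φ : C(K, F)), IntervalIntegrable
      (fun θ ↦ d θ • a (c θ) • φ (c θ)) volume 0 (2 * Real.pi) := fun a φ ↦ by
    apply Continuous.intervalIntegrable; fun_prop
  have hdn : ∀ θ, ‖d θ‖ = r := fun θ ↦ by simp [d, deriv_circleMap, abs_of_pos hr]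
  let T : C(K, ℂ) →L[ℂ] C(K, F) →L[ℂ] F := LinearMap.mkContinuous₂
    (LinearMap.mk₂ ℂ (fun a φ ↦ ∫ θ in (0 : ℝ)..2 * Real.pi, d θ • a (c θ) • φ (c θ))
      (fun a b φ ↦ by
        rw [← intervalIntegral.integral_add (hint _ _) (hint _ _)]
        simp [add_smul, smul_add])
      (fun s a φ ↦ by
        rw [← intervalIntegral.integral_smul]
        refine intervalIntegral.integral_congr fun θ _ ↦ ?_
        simp only [ContinuousMap.smul_apply, smul_smul, smul_eq_mul]; congr 1; ring)
      (fun a φ χ ↦ by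
        rw [← intervalIntegral.integral_add (hint _ _) (hint _ _)]
        simp [smul_add])
      (fun s a φ ↦ by
        rw [← intervalIntegral.integral_smul]
        refine intervalIntegral.integral_congr fun θ _ ↦ ?_
        simp only [ContinuousMap.smul_apply, smul_smul]; congr 1; ring))
    (r * (2 * Real.pi)) (fun a φ ↦ by
      have := intervalIntegral.norm_integral_le_of_norm_le_const (a := 0) (b := 2 * Real.pi)
        (f := fun θ ↦ d θ • a (c θ) • φ (c θ)) (C := r * ‖a‖ * ‖φ‖) (fun θ _ ↦ by
          rw [norm_smul, norm_smul, hdn, ← mul_assoc]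
          gcongr
          · exact a.norm_coe_le_norm _
          · exact φ.norm_coe_le_norm _)
      simp only [LinearMap.mk₂_apply]
      refine this.trans (le_of_eq ?_)
      rw [sub_zero, abs_of_pos (by positivity)]; ring)
  have hT : ∀ a φ, T a φ = ∫ θ in (0 : ℝ)..2 * Real.pi, d θ • a (c θ) • φ (c θ) := fun a φ ↦ rfl
  let ι : C(K, ℂ) := ⟨fun ζ ↦ (ζ : ℂ), by fun_prop⟩
  let A : ℂ → C(K, ℂ) := fun z ↦ ι - algebraMap ℂ C(K, ℂ) z
  have hne : ∀ z ∈ Metric.ball z₀ r, ∀ ζ : K, (ζ : ℂ) - z ≠ 0 := fun z hz ζ h ↦ by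
    have h1 := ζ.2
    rw [sub_eq_zero.1 h] at h1
    rw [Metric.mem_sphere] at h1
    rw [Metric.mem_ball] at hz
    linarith
  have hinv : ∀ z (hz : z ∈ Metric.ball z₀ r),
      ∃ a : C(K, ℂ)ˣ, (a : C(K, ℂ)) = A z ∧ ∀ ζ, (↑a⁻¹ : C(K, ℂ)) ζ = ((ζ : ℂ) - z)⁻¹ :=
    fun z hz ↦ by
    refine ⟨⟨A z, ⟨fun ζ ↦ ((ζ : ℂ) - z)⁻¹, Continuous.inv₀ (by fun_prop) (hne z hz)⟩, ?_, ?_⟩,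
      rfl, fun ζ ↦ rfl⟩
    · ext ζ; simpa [A, ι] using mul_inv_cancel₀ (hne z hz ζ)
    · ext ζ; simpa [A, ι] using inv_mul_cancel₀ (hne z hz ζ)
  refine ⟨fun z ↦ (2 * Real.pi * Complex.I : ℂ)⁻¹ • T (Ring.inverse (A z)), ?_, ?_⟩
  · obtain ⟨a, ha, -⟩ := hinv z₀ (Metric.mem_ball_self hr)
    have h1 : AnalyticAt ℂ A z₀ :=
      analyticAt_const.sub ((Algebra.linearMap ℂ C(K, ℂ)).toContinuousLinearMap.analyticAt z₀)
    have h2 : AnalyticAt ℂ (Ring.inverse : C(K, ℂ) → C(K, ℂ)) (A z₀) := by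
      rw [← ha]; exact analyticAt_inverse a
    have h3 : AnalyticAt ℂ (fun z ↦ T (Ring.inverse (A z))) z₀ :=
      (T.analyticAt _).comp (AnalyticAt.comp (f := A) h2 h1)
    exact h3.fun_const_smul (c := (2 * Real.pi * Complex.I : ℂ)⁻¹)
  · intro f φ hφ hf z hz
    obtain ⟨a, ha, ha'⟩ := hinv z hz
    have := hf.circleIntegral_sub_inv_smul hz
    simp only [smul_apply, hT]
    rw [← ha, Ring.inverse_unit]
    simp only [ha', hφ]
    rw [circleIntegral] at this
    rw [inv_smul_eq_iff₀ (by simp [Real.pi_ne_zero])]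
    exact this

/-- Passing from `E'` to `ℂ × E'`: the Cauchy integral formula in the first variable expresses
`f(z, y)` as an operator analytic in `z` applied to a vector analytic in `y`. -/
lemma analyticAt_prod_of_contDiffAt_one {F : Type*} [NormedAddCommGroup F] [NormedSpace ℂ F]
    [CompleteSpace F] {f : ℂ × E' → F} {z₀ : ℂ} {y₀ : E'}
    (H : ∀ (r : ℝ) (g : E' → C(Metric.sphere z₀ r, F)),
      ContDiffAt ℂ 1 g y₀ → AnalyticAt ℂ g y₀)
    (hf : ContDiffAt ℂ 1 f (z₀, y₀)) : AnalyticAt ℂ f (z₀, y₀) := by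
  obtain ⟨f', u, hu, hc, hd⟩ := contDiffAt_one_iff.1 hf
  obtain ⟨r, hr, hru⟩ := Metric.nhds_basis_closedBall.mem_iff.1 hu
  have hru' : ∀ z y, z ∈ Metric.closedBall z₀ r → y ∈ Metric.closedBall y₀ r → (z, y) ∈ u :=
    fun z y hz hy ↦ hru (by rw [← closedBall_prod_same]; exact ⟨hz, hy⟩)
  obtain ⟨Φ, hΦ, hΦ'⟩ := exists_analytic_cauchy_operator (F := F) z₀ hr
  have hfc : ContinuousOn f u := fun p hp ↦ (hd p hp).continuousAt.continuousWithinAt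
  have hmap : MapsTo (fun p : Metric.sphere z₀ r × E' ↦ ((p.1 : ℂ), p.2))
      (univ ×ˢ Metric.ball y₀ r) u := fun p hp ↦
    hru' _ _ (Metric.sphere_subset_closedBall p.1.2) (Metric.ball_subset_closedBall hp.2)
  have hG := H r _ (contDiffAt_one_family (K := Metric.sphere z₀ r)
    (f := fun ζ y ↦ f (ζ, y)) (f' := fun ζ y ↦ (f' (ζ, y)).comp (ContinuousLinearMap.inr ℂ ℂ E'))
    hr (fun ζ y hy ↦ ?_) ?_ ?_)
  · set G : E' → C(Metric.sphere z₀ r, F) := fun y ↦ ContinuousMap.mkD (fun ζ ↦ f (ζ, y)) 0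
    have h1 : AnalyticAt ℂ (fun p : ℂ × E' ↦ Φ p.1 (G p.2)) (z₀, y₀) := by
      have a1 : AnalyticAt ℂ (fun p : ℂ × E' ↦ Φ p.1) (z₀, y₀) :=
        AnalyticAt.fun_comp (f := Prod.fst) hΦ analyticAt_fst
      have a2 : AnalyticAt ℂ (fun p : ℂ × E' ↦ G p.2) (z₀, y₀) :=
        AnalyticAt.fun_comp (f := Prod.snd) hG analyticAt_snd
      exact ((ContinuousLinearMap.apply ℂ F).flip.analyticAt_bilinear _).comp₂ a1 a2
    refine h1.congr ?_
    filter_upwards [Metric.ball_mem_nhds (z₀, y₀) hr] with p hp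
    rw [← ball_prod_same] at hp
    refine hΦ' (fun z ↦ f (z, p.2)) (G p.2) (fun ζ ↦ ?_) ?_ p.1 hp.1
    · have : Continuous (fun ζ : Metric.sphere z₀ r ↦ f (ζ, p.2)) :=
        hfc.comp_continuous (f := fun ζ : Metric.sphere z₀ r ↦ ((ζ : ℂ), p.2)) (by fun_prop)
          (fun ζ ↦ hmap (x := (ζ, p.2)) ⟨mem_univ _, hp.2⟩)
      simp only [G]; rw [ContinuousMap.mkD_apply_of_continuous this]
    · have hdiff : DifferentiableOn ℂ (fun z ↦ f (z, p.2)) (Metric.closedBall z₀ r) :=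
        fun z hz ↦ by
        have := (hd (z, p.2) (hru' _ _ hz (Metric.ball_subset_closedBall hp.2)))
        exact (this.comp z (hasFDerivAt_prodMk_left z p.2)).differentiableAt.differentiableWithinAt
      refine (DifferentiableOn.diffContOnCl ?_)
      rwa [closure_ball z₀ hr.ne']
  · exact (hd (ζ, y) (hmap (x := (ζ, y)) ⟨mem_univ _, hy⟩)).comp y (hasFDerivAt_prodMk_right _ y)
  · exact hfc.comp (f := fun p : Metric.sphere z₀ r × E' ↦ ((p.1 : ℂ), p.2))
      (by fun_prop) hmap
  · have := hc.comp (f := fun p : Metric.sphere z₀ r × E' ↦ ((p.1 : ℂ), p.2))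
      (by fun_prop) hmap
    exact this.clm_comp continuousOn_const

/-- Osgood's lemma on `ℂ^n`, by induction on `n`. The values lie in an arbitrary Banach space
because the induction step passes to functions with values in continuous functions on a circle. -/
lemma analyticAt_pi_of_contDiffAt_one (n : ℕ) :
    ∀ {F : Type u} [NormedAddCommGroup F] [NormedSpace ℂ F] [CompleteSpace F]
      {f : (Fin n → ℂ) → F} {x : Fin n → ℂ}, ContDiffAt ℂ 1 f x → AnalyticAt ℂ f x := by
  induction n with
  | zero =>
    intro F _ _ _ f x _
    have : f = fun _ ↦ f x := by ext y; rw [Subsingleton.elim y x]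
    rw [this]; exact analyticAt_const
  | succ n ih =>
    intro F _ _ _ f x hf
    let e : (Fin (n + 1) → ℂ) ≃L[ℂ] ℂ × (Fin n → ℂ) :=
      ContinuousLinearEquiv.ofFinrankEq (by simp [add_comm])
    have h1 : ContDiffAt ℂ 1 (f ∘ e.symm) ((e x).1, (e x).2) := by
      refine ContDiffAt.comp _ ?_ e.symm.contDiff.contDiffAt
      simpa using hf
    have h2 := analyticAt_prod_of_contDiffAt_one (fun r g hg ↦ ih hg) h1
    have h3 : AnalyticAt ℂ ((f ∘ e.symm) ∘ e) x :=
      AnalyticAt.comp (f := e) h2 (e.analyticAt x)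
    have h4 : (f ∘ e.symm) ∘ e = f := by ext; simp
    rwa [h4] at h3

/-- A complex `C¹` function on a finite-dimensional space is analytic (Osgood). -/
theorem analyticAt_of_contDiffAt_one [FiniteDimensional ℂ E'] [CompleteSpace F] {f : E' → F}
    {x : E'} (hf : ContDiffAt ℂ 1 f x) : AnalyticAt ℂ f x := by
  let e : E' ≃L[ℂ] (Fin (Module.finrank ℂ E') → ℂ) := ContinuousLinearEquiv.ofFinrankEq (by simp)
  have h1 : ContDiffAt ℂ 1 (f ∘ e.symm) (e x) := by
    refine ContDiffAt.comp _ ?_ e.symm.contDiff.contDiffAt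
    simpa using hf
  have h3 : AnalyticAt ℂ ((f ∘ e.symm) ∘ e) x :=
    AnalyticAt.comp (f := e) (analyticAt_pi_of_contDiffAt_one _ h1) (e.analyticAt x)
  have h4 : (f ∘ e.symm) ∘ e = f := by ext; simp
  rwa [h4] at h3

end Osgood

/-! ### Families of kernels and submersions in vector spaces -/

section Comp

variable {W X Y Z : Type*} [NormedAddCommGroup W] [NormedSpace ℂ W]
  [NormedAddCommGroup X] [NormedSpace ℂ X] [NormedAddCommGroup Y] [NormedSpace ℂ Y]
  [NormedAddCommGroup Z] [NormedSpace ℂ Z]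

lemma analyticAt_clm_comp {f : W → Y →L[ℂ] Z} {g : W → X →L[ℂ] Y} {w : W}
    (hf : AnalyticAt ℂ f w) (hg : AnalyticAt ℂ g w) :
    AnalyticAt ℂ (fun x ↦ (f x).comp (g x)) w :=
  (ContinuousLinearMap.analyticAt_bilinear (E := Y →L[ℂ] Z) (F := X →L[ℂ] Y) (G := X →L[ℂ] Z)
    (ContinuousLinearMap.compL ℂ X Y Z) (f w, g w)).comp₂ hf hg

lemma analyticAt_clm_apply {f : W → X →L[ℂ] Y} {g : W → X} {w : W}
    (hf : AnalyticAt ℂ f w) (hg : AnalyticAt ℂ g w) :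
    AnalyticAt ℂ (fun x ↦ f x (g x)) w :=
  (ContinuousLinearMap.analyticAt_bilinear (E := X →L[ℂ] Y) (F := X) (G := Y)
    (ContinuousLinearMap.id ℂ (X →L[ℂ] Y)) (f w, g w)).comp₂ hf hg

end Comp

section Linear

variable {X E F : Type*} [NormedAddCommGroup X] [NormedSpace ℂ X]
  [NormedAddCommGroup E] [NormedSpace ℂ E]
  [NormedAddCommGroup F] [NormedSpace ℂ F] [FiniteDimensional ℂ F]

omit [NormedSpace ℂ X] in
lemma eventually_surjective {G : X → E →L[ℂ] F} {x₀ : X} (hG : ContinuousAt G x₀)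
    (hs : Function.Surjective (G x₀)) : ∀ᶠ x in 𝓝 x₀, Function.Surjective (G x) := by
  have : CompleteSpace F := FiniteDimensional.complete ℂ F
  obtain ⟨R₀, hR₀⟩ := (G x₀).toLinearMap.exists_rightInverse_of_surjective
    (LinearMap.range_eq_top.2 hs)
  let R : F →L[ℂ] E := LinearMap.toContinuousLinearMap R₀
  have h1 : ContinuousAt (fun x ↦ (G x).comp R) x₀ := hG.clm_comp continuousAt_const
  have h2 : (G x₀).comp R = ((1 : (F →L[ℂ] F)ˣ) : F →L[ℂ] F) := by
    ext v; exact LinearMap.congr_fun hR₀ v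
  have h3 : ∀ᶠ x in 𝓝 x₀, IsUnit ((G x).comp R) :=
    h1.tendsto.eventually (by simp only [h2]; exact Units.nhds 1)
  filter_upwards [h3] with x hx w
  exact ⟨R (Ring.inverse ((G x).comp R) w), DFunLike.congr_fun (Ring.mul_inverse_cancel _ hx) w⟩

/-- The kernels of an analytic family of surjective operators are the ranges of an analytic family
of projections: with `R` a right inverse of `G x₀`, take `1 - R (G x ∘ R)⁻¹ G x`. -/
lemma exists_analyticAt_range_eq_ker {G : X → E →L[ℂ] F} {x₀ : X} (hG : AnalyticAt ℂ G x₀)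
    (hs : Function.Surjective (G x₀)) :
    ∃ P : X → E →L[ℂ] E, AnalyticAt ℂ P x₀ ∧
      ∀ᶠ x in 𝓝 x₀, LinearMap.range (P x).toLinearMap = LinearMap.ker (G x).toLinearMap := by
  have : CompleteSpace F := FiniteDimensional.complete ℂ F
  obtain ⟨R₀, hR₀⟩ := (G x₀).toLinearMap.exists_rightInverse_of_surjective
    (LinearMap.range_eq_top.2 hs)
  let R : F →L[ℂ] E := LinearMap.toContinuousLinearMap R₀
  have hR : (G x₀).comp R = 1 := by
    ext v; exact LinearMap.congr_fun hR₀ v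
  let A : X → F →L[ℂ] F := fun x ↦ (G x).comp R
  have hA : AnalyticAt ℂ A x₀ := analyticAt_clm_comp hG analyticAt_const
  have hA₀ : A x₀ = ((1 : (F →L[ℂ] F)ˣ) : F →L[ℂ] F) := hR
  have hinv : AnalyticAt ℂ (fun x ↦ Ring.inverse (A x)) x₀ := by
    refine AnalyticAt.fun_comp (f := A) ?_ hA
    rw [hA₀]; exact analyticAt_inverse _
  have hunit : ∀ᶠ x in 𝓝 x₀, IsUnit (A x) :=
    hA.continuousAt.eventually (by rw [hA₀]; exact Units.nhds 1)
  refine ⟨fun x ↦ 1 - R.comp ((Ring.inverse (A x)).comp (G x)), ?_, ?_⟩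
  · exact analyticAt_const.sub (analyticAt_clm_comp analyticAt_const (analyticAt_clm_comp hinv hG))
  · filter_upwards [hunit] with x hx
    have h1 : ∀ w, G x (R (Ring.inverse (A x) w)) = w := fun w ↦ by
      have := Ring.mul_inverse_cancel _ hx
      exact DFunLike.congr_fun this w
    ext v
    constructor
    · rintro ⟨w, rfl⟩
      simp [h1]
    · intro hv
      have hv' : G x v = 0 := hv
      exact ⟨v, by simp [hv']⟩

/-- The analytic inverse function theorem, as a local biholomorphism with source inside a prescribed
neighborhood. -/
lemma exists_openPartialHomeomorph_coe_eq [CompleteSpace E] {f : E → F} {e₀ : E}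
    (hf : AnalyticAt ℂ f e₀)
    {i : E ≃L[ℂ] F} (hi : fderiv ℂ f e₀ = i) {T : Set E} (hT : T ∈ 𝓝 e₀) :
    ∃ Φ : OpenPartialHomeomorph E F, (∀ e, Φ e = f e) ∧ e₀ ∈ Φ.source ∧ Φ.source ⊆ T ∧
      (∀ e ∈ Φ.source, AnalyticAt ℂ f e) ∧ ∀ q ∈ Φ.target, AnalyticAt ℂ Φ.symm q := by
  have hd : HasFDerivAt f (i : E →L[ℂ] F) e₀ := hi ▸ hf.differentiableAt.hasFDerivAt
  have hc : ContDiffAt ℂ ω f e₀ := hf.contDiffAt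
  let Φ₀ := hc.toOpenPartialHomeomorph f hd (by simp)
  have hmem : e₀ ∈ Φ₀.source := hc.mem_toOpenPartialHomeomorph_source hd _
  have hsymm : AnalyticAt ℂ Φ₀.symm (f e₀) := Φ₀.analyticAt_symm' hmem hf hi
  have hev : ∀ᶠ e in 𝓝 e₀, e ∈ T ∧ AnalyticAt ℂ f e ∧ AnalyticAt ℂ Φ₀.symm (f e) :=
    Filter.Eventually.and hT (hf.eventually_analyticAt.and
      (hf.continuousAt.eventually hsymm.eventually_analyticAt))
  obtain ⟨U, hU, hUo, heU⟩ := eventually_nhds_iff.1 hev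
  refine ⟨Φ₀.restrOpen U hUo, fun e ↦ rfl, ⟨hmem, heU⟩, fun e he ↦ (hU e he.2).1,
    fun e he ↦ (hU e he.2).2.1, fun q hq ↦ ?_⟩
  have h1 := (Φ₀.restrOpen U hUo).map_target hq
  have h2 := (hU _ h1.2).2.2
  have h3 : f ((Φ₀.restrOpen U hUo).symm q) = q := (Φ₀.restrOpen U hUo).right_inv hq
  rwa [h3] at h2

variable [FiniteDimensional ℂ E]

/-- A submersion is, near every point, the first component of a local biholomorphism. -/
lemma exists_openPartialHomeomorph_fst_eq {f : E → F} {e₀ : E} (hf : AnalyticAt ℂ f e₀)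
    (hs : Function.Surjective (fderiv ℂ f e₀)) {T : Set E} (hT : T ∈ 𝓝 e₀) :
    ∃ Φ : OpenPartialHomeomorph E (F × LinearMap.ker (fderiv ℂ f e₀).toLinearMap),
      e₀ ∈ Φ.source ∧ Φ.source ⊆ T ∧ (∀ e, (Φ e).1 = f e) ∧
      (∀ e ∈ Φ.source, AnalyticAt ℂ Φ e) ∧ ∀ q ∈ Φ.target, AnalyticAt ℂ Φ.symm q := by
  have : CompleteSpace E := FiniteDimensional.complete ℂ E
  have : CompleteSpace F := FiniteDimensional.complete ℂ F
  set Z := LinearMap.ker (fderiv ℂ f e₀).toLinearMap with hZ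
  obtain ⟨π₀, hπ₀⟩ := Z.subtype.exists_leftInverse_of_injective (Submodule.ker_subtype Z)
  have hπ : ∀ z : Z, π₀ z = z := fun z ↦ LinearMap.congr_fun hπ₀ z
  let π : E →L[ℂ] Z := LinearMap.toContinuousLinearMap π₀
  let i : E ≃L[ℂ] F × Z := ContinuousLinearMap.equivProdOfSurjectiveOfIsCompl (fderiv ℂ f e₀) π
    (LinearMap.range_eq_top.2 hs) (LinearMap.range_eq_top.2 fun z ↦ ⟨z, hπ z⟩)
    (LinearMap.isCompl_of_proj hπ)
  have hΦ : AnalyticAt ℂ (fun e ↦ (f e, π e)) e₀ := hf.prod (π.analyticAt e₀)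
  have hi : fderiv ℂ (fun e ↦ (f e, π e)) e₀ = i := by
    rw [hf.differentiableAt.fderiv_prodMk π.differentiableAt, π.fderiv]; rfl
  obtain ⟨Φ, h1, h2, h3, h4, h5⟩ := exists_openPartialHomeomorph_coe_eq hΦ hi hT
  refine ⟨Φ, h2, h3, fun e ↦ by rw [h1], fun e he ↦ ?_, h5⟩
  rw [show (Φ : E → F × Z) = fun e ↦ (f e, π e) from funext h1]
  exact h4 e he

end Linear

/-! ### Holomorphic charts -/

section Derivative

variable (E : Type*) [NormedAddCommGroup E] [NormedSpace ℂ E]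
  {M : Type*} [TopologicalSpace M] [ChartedSpace E M]
  (E' : Type*) [NormedAddCommGroup E'] [NormedSpace ℂ E']
  {M' : Type*} [TopologicalSpace M'] [ChartedSpace E' M']
  {E'' : Type*} [NormedAddCommGroup E''] [NormedSpace ℂ E'']
  {M'' : Type*} [TopologicalSpace M''] [ChartedSpace E'' M'']

/-- The derivative of a map between complex manifolds, as an operator between the model spaces
(to which the tangent spaces are definitionally equal). -/
def tderiv (f : M → M') (x : M) : E →L[ℂ] E' := mfderiv 𝓘(ℂ, E) 𝓘(ℂ, E') f x

variable {E E'}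

lemma tderiv_comp {f : M → M'} {g : M' → M''} (x : M)
    (hg : MDifferentiableAt 𝓘(ℂ, E') 𝓘(ℂ, E'') g (f x))
    (hf : MDifferentiableAt 𝓘(ℂ, E) 𝓘(ℂ, E') f x) :
    tderiv E E'' (g ∘ f) x = (tderiv E' E'' g (f x)).comp (tderiv E E' f x) :=
  mfderiv_comp x hg hf

lemma tderiv_eq_fderiv (f : E → E') (x : E) : tderiv E E' f x = fderiv ℂ f x :=
  mfderiv_eq_fderiv

lemma tderiv_congr {f g : M → M'} {x : M} (h : f =ᶠ[𝓝 x] g) :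
    tderiv E E' f x = tderiv E E' g x := by
  unfold tderiv
  exact h.mfderiv_eq

lemma tderiv_id (x : M) : tderiv E E (id : M → M) x = ContinuousLinearMap.id ℂ E :=
  mfderiv_id

end Derivative

section Charts

variable {E : Type*} [NormedAddCommGroup E] [NormedSpace ℂ E]
  {N : Type*} [TopologicalSpace N] [ChartedSpace E N]
  {E' : Type*} [NormedAddCommGroup E'] [NormedSpace ℂ E']
  {V : Type*} [NormedAddCommGroup V] [NormedSpace ℂ V]

/-- A holomorphic chart of `N` with values in an arbitrary normed space `E'`. -/
structure IsHolChart (Ψ : OpenPartialHomeomorph N E') : Prop where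
  holomorphic : ContMDiffOn 𝓘(ℂ, E) 𝓘(ℂ, E') ω Ψ Ψ.source
  holomorphic_symm : ContMDiffOn 𝓘(ℂ, E') 𝓘(ℂ, E) ω Ψ.symm Ψ.target

lemma isHolChart_chartAt [IsManifold 𝓘(ℂ, E) ω N] (p : N) : IsHolChart (E := E) (chartAt E p) :=
  ⟨contMDiffOn_chart, contMDiffOn_chart_symm⟩

namespace IsHolChart

variable {Ψ : OpenPartialHomeomorph N E'} (h : IsHolChart (E := E) Ψ)
include h

lemma contMDiffAt {x : N} (hx : x ∈ Ψ.source) : ContMDiffAt 𝓘(ℂ, E) 𝓘(ℂ, E') ω Ψ x :=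
  h.holomorphic.contMDiffAt (Ψ.open_source.mem_nhds hx)

lemma contMDiffAt_symm {q : E'} (hq : q ∈ Ψ.target) :
    ContMDiffAt 𝓘(ℂ, E') 𝓘(ℂ, E) ω Ψ.symm q :=
  h.holomorphic_symm.contMDiffAt (Ψ.open_target.mem_nhds hq)

lemma mdifferentiableAt {x : N} (hx : x ∈ Ψ.source) :
    MDifferentiableAt 𝓘(ℂ, E) 𝓘(ℂ, E') Ψ x :=
  (h.contMDiffAt hx).mdifferentiableAt (by simp)

lemma mdifferentiableAt_symm {q : E'} (hq : q ∈ Ψ.target) :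
    MDifferentiableAt 𝓘(ℂ, E') 𝓘(ℂ, E) Ψ.symm q :=
  (h.contMDiffAt_symm hq).mdifferentiableAt (by simp)

lemma tderiv_symm_tderiv {x : N} (hx : x ∈ Ψ.source) (v : E) :
    tderiv E' E Ψ.symm (Ψ x) (tderiv E E' Ψ x v) = v := by
  have h1 := tderiv_comp x (h.mdifferentiableAt_symm (Ψ.map_source hx)) (h.mdifferentiableAt hx)
  have h2 : Ψ.symm ∘ Ψ =ᶠ[𝓝 x] id := by
    filter_upwards [Ψ.open_source.mem_nhds hx] with y hy using Ψ.left_inv hy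
  rw [tderiv_congr h2, tderiv_id] at h1
  exact (DFunLike.congr_fun h1 v).symm

lemma tderiv_tderiv_symm {x : N} (hx : x ∈ Ψ.source) (v : E') :
    tderiv E E' Ψ x (tderiv E' E Ψ.symm (Ψ x) v) = v := by
  have hx' : Ψ.symm (Ψ x) = x := Ψ.left_inv hx
  have h0 : MDifferentiableAt 𝓘(ℂ, E) 𝓘(ℂ, E') Ψ (Ψ.symm (Ψ x)) := by
    rw [hx']; exact h.mdifferentiableAt hx
  have h1 := tderiv_comp (Ψ x) h0 (h.mdifferentiableAt_symm (Ψ.map_source hx))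
  have h2 : Ψ ∘ Ψ.symm =ᶠ[𝓝 (Ψ x)] id := by
    filter_upwards [Ψ.open_target.mem_nhds (Ψ.map_source hx)] with y hy using Ψ.right_inv hy
  rw [tderiv_congr h2, tderiv_id, hx'] at h1
  exact (DFunLike.congr_fun h1 v).symm

/-- Composing a holomorphic chart with a local biholomorphism of vector spaces. -/
lemma trans {E'' : Type*} [NormedAddCommGroup E''] [NormedSpace ℂ E''] [CompleteSpace E']
    [CompleteSpace E'']
    {Φ : OpenPartialHomeomorph E' E''} (h1 : ∀ e ∈ Φ.source, AnalyticAt ℂ Φ e)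
    (h2 : ∀ e ∈ Φ.target, AnalyticAt ℂ Φ.symm e) : IsHolChart (E := E) (Ψ.trans Φ) where
  holomorphic := by
    have h3 : ContMDiffOn 𝓘(ℂ, E') 𝓘(ℂ, E'') ω Φ Φ.source := fun e he ↦
      (h1 e he).contDiffAt.contMDiffAt.contMDiffWithinAt
    exact h3.comp (h.holomorphic.mono fun x hx ↦ hx.1) fun x hx ↦ hx.2
  holomorphic_symm := by
    have h3 : ContMDiffOn 𝓘(ℂ, E'') 𝓘(ℂ, E') ω Φ.symm Φ.target := fun e he ↦
      (h2 e he).contDiffAt.contMDiffAt.contMDiffWithinAt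
    exact h.holomorphic_symm.comp (h3.mono fun x hx ↦ hx.1) fun x hx ↦ hx.2

/-- The expression of a holomorphic vector-valued function in a holomorphic chart is analytic. -/
lemma analyticAt_comp_symm [CompleteSpace V] {F : N → V} {x : N}
    (hF : ContMDiffAt 𝓘(ℂ, E) 𝓘(ℂ, V) ω F x)
    (hx : x ∈ Ψ.source) : AnalyticAt ℂ (F ∘ Ψ.symm) (Ψ x) := by
  have h0 : ContMDiffAt 𝓘(ℂ, E) 𝓘(ℂ, V) ω F (Ψ.symm (Ψ x)) := by rwa [Ψ.left_inv hx]
  exact (h0.comp (Ψ x) (h.contMDiffAt_symm (Ψ.map_source hx))).contDiffAt.analyticAt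

lemma fderiv_comp_symm {F : N → V} {x : N} (hF : MDifferentiableAt 𝓘(ℂ, E) 𝓘(ℂ, V) F x)
    (hx : x ∈ Ψ.source) (v : E) :
    fderiv ℂ (F ∘ Ψ.symm) (Ψ x) (tderiv E E' Ψ x v) = tderiv E V F x v := by
  have hx' : Ψ.symm (Ψ x) = x := Ψ.left_inv hx
  have h0 : MDifferentiableAt 𝓘(ℂ, E) 𝓘(ℂ, V) F (Ψ.symm (Ψ x)) := by rwa [hx']
  have h1 := tderiv_comp (Ψ x) h0 (h.mdifferentiableAt_symm (Ψ.map_source hx))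
  rw [tderiv_eq_fderiv] at h1
  rw [h1, hx']
  exact congrArg _ (h.tderiv_symm_tderiv hx v)

end IsHolChart

end Charts

/-! ### Pullbacks of 2-forms -/

section Pullback

variable {E : Type*} [NormedAddCommGroup E] [NormedSpace ℂ E]
  {N : Type*} [TopologicalSpace N] [ChartedSpace E N]
  {X : Type*} [NormedAddCommGroup X] [NormedSpace ℂ X]
  {Y : Type*} [NormedAddCommGroup Y] [NormedSpace ℂ Y]

variable (X) in
/-- A continuous alternating 2-form as a continuous bilinear map. -/
def bilinOfAlternating : (X [⋀^Fin 2]→L[ℂ] ℂ) →L[ℂ] (X →L[ℂ] X →L[ℂ] ℂ) :=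
  (ContinuousLinearMap.compL ℂ X (X [×1]→L[ℂ] ℂ) (X →L[ℂ] ℂ)
    (continuousMultilinearCurryFin1 ℂ X ℂ : (X [×1]→L[ℂ] ℂ) →L[ℂ] (X →L[ℂ] ℂ))).comp
  ((continuousMultilinearCurryLeftEquiv ℂ (fun _ : Fin 2 ↦ X) ℂ :
    (X [×2]→L[ℂ] ℂ) →L[ℂ] (X →L[ℂ] (X [×1]→L[ℂ] ℂ))).comp
  (ContinuousAlternatingMap.toContinuousMultilinearMapCLM ℂ))

@[simp] lemma bilinOfAlternating_apply (α : X [⋀^Fin 2]→L[ℂ] ℂ) (v w : X) :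
    bilinOfAlternating X α v w = α ![v, w] := by
  simp [bilinOfAlternating]

lemma analyticAt_bilinOfAlternating (α : X [⋀^Fin 2]→L[ℂ] ℂ) :
    AnalyticAt ℂ (bilinOfAlternating X) α := by
  apply ContinuousLinearMap.analyticAt

lemma hasFDerivAt_bilinOfAlternating (α : X [⋀^Fin 2]→L[ℂ] ℂ) :
    HasFDerivAt (bilinOfAlternating X) (bilinOfAlternating X) α := by
  apply ContinuousLinearMap.hasFDerivAt

lemma bilinOfAlternating_swap (α : X [⋀^Fin 2]→L[ℂ] ℂ) (v w : X) :
    bilinOfAlternating X α v w = - bilinOfAlternating X α w v := by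
  have h1 : (α : (Fin 2 → X) → ℂ) (![w, v] ∘ Equiv.swap 0 1) = - α ![w, v] :=
    α.toAlternatingMap.map_swap ![w, v] (i := 0) (j := 1) (by simp)
  rw [bilinOfAlternating_apply, bilinOfAlternating_apply, ← h1]
  congr 1
  ext i; fin_cases i <;> rfl

/-- A 2-form at a point, as a bilinear form on the model space. -/
def TwoForm.bilin (Ω : TwoForm E N) (x : N) : E →L[ℂ] E →L[ℂ] ℂ := bilinOfAlternating E (Ω x)

lemma TwoForm.bilin_apply (Ω : TwoForm E N) (x : N) (v w : TangentSpace 𝓘(ℂ, E) x) :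
    Ω.bilin x v w = Ω x ![v, w] := bilinOfAlternating_apply (X := E) _ _ _

lemma TwoForm.bilin_swap (Ω : TwoForm E N) (x : N) (v w : E) :
    Ω.bilin x v w = - Ω.bilin x w v := bilinOfAlternating_swap (X := E) _ _ _

/-- The pullback of a continuous bilinear form under a continuous linear map. -/
def bilinPullback (B : Y →L[ℂ] Y →L[ℂ] ℂ) (D : X →L[ℂ] Y) : X →L[ℂ] X →L[ℂ] ℂ :=
  ((ContinuousLinearMap.compL ℂ X Y ℂ).flip D).comp (B.comp D)

@[simp] lemma bilinPullback_apply (B : Y →L[ℂ] Y →L[ℂ] ℂ) (D : X →L[ℂ] Y) (v w : X) :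
    bilinPullback B D v w = B (D v) (D w) := rfl

lemma analyticAt_bilinPullback {B : X → Y →L[ℂ] Y →L[ℂ] ℂ} {D : X → X →L[ℂ] Y} {x : X}
    (hB : AnalyticAt ℂ B x) (hD : AnalyticAt ℂ D x) :
    AnalyticAt ℂ (fun y ↦ bilinPullback (B y) (D y)) x := by
  have h2 : AnalyticAt ℂ (fun y ↦ (ContinuousLinearMap.compL ℂ X Y ℂ).flip (D y)) x :=
    AnalyticAt.fun_comp (ContinuousLinearMap.analyticAt (𝕜 := ℂ) (E := X →L[ℂ] Y)
      (F := (Y →L[ℂ] ℂ) →L[ℂ] (X →L[ℂ] ℂ)) (ContinuousLinearMap.compL ℂ X Y ℂ).flip (D x)) hD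
  exact analyticAt_clm_comp h2 (analyticAt_clm_comp hB hD)

/-- The pullback of a 2-form on `N` under a map `s` from a normed space, as a field of bilinear
forms. -/
def pullback (Ω : TwoForm E N) (s : X → N) (y : X) : X →L[ℂ] X →L[ℂ] ℂ :=
  bilinPullback (Ω.bilin (s y)) (tderiv X E s y)

lemma pullback_apply (Ω : TwoForm E N) (s : X → N) (y v w : X) :
    pullback Ω s y v w = Ω.bilin (s y) (tderiv X E s y v) (tderiv X E s y w) := rfl

lemma pullback_swap (Ω : TwoForm E N) (s : X → N) (y v w : X) :
    pullback Ω s y v w = - pullback Ω s y w v := by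
  rw [pullback_apply, pullback_apply, TwoForm.bilin_swap]

lemma TwoForm.bilin_inChart (Ω : TwoForm E N) (p : N) (e v w : E) :
    bilinOfAlternating E (Ω.inChart p e) v w = Ω.bilin ((chartAt E p).symm e)
      (tderiv E E (chartAt E p).symm e v) (tderiv E E (chartAt E p).symm e w) := by
  have h : (extChartAt 𝓘(ℂ, E) p).symm = ((chartAt E p).symm : E → N) := by
    ext; simp
  have h1 : ∀ σ : E → N, bilinOfAlternating E
      ((Ω (σ e)).compContinuousLinearMap (mfderiv 𝓘(ℂ, E) 𝓘(ℂ, E) σ e)) v w =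
      Ω.bilin (σ e) (tderiv E E σ e v) (tderiv E E σ e w) := fun σ ↦ by
    refine (bilinOfAlternating_apply (X := E) _ _ _).trans ?_
    refine (ContinuousAlternatingMap.compContinuousLinearMap_apply _ _ _).trans ?_
    refine Eq.trans ?_ (bilinOfAlternating_apply (X := E) _ _ _).symm
    congr 1
    ext i; fin_cases i <;> rfl
  rw [← h]
  exact h1 _

lemma extDeriv_two_apply {α : X → X [⋀^Fin 2]→L[ℂ] ℂ} {x : X} (hα : DifferentiableAt ℂ α x)
    (a b c : X) : extDeriv α x ![a, b, c] =
      fderiv ℂ (fun y ↦ bilinOfAlternating X (α y)) x a b c -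
      fderiv ℂ (fun y ↦ bilinOfAlternating X (α y)) x b a c +
      fderiv ℂ (fun y ↦ bilinOfAlternating X (α y)) x c a b := by
  have h1 : ∀ u v w : X, fderiv ℂ (fun y ↦ bilinOfAlternating X (α y)) x u v w =
      fderiv ℂ (fun y ↦ α y ![v, w]) x u := fun u v w ↦ by
    have h2 : HasFDerivAt (fun y ↦ bilinOfAlternating X (α y))
        ((bilinOfAlternating X).comp (fderiv ℂ α x)) x :=
      HasFDerivAt.comp (g := bilinOfAlternating X) x (hasFDerivAt_bilinOfAlternating _)
        hα.hasFDerivAt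
    have h3 := ((h2.clm_apply (hasFDerivAt_const v x)).clm_apply (hasFDerivAt_const w x)).fderiv
    simp only [bilinOfAlternating_apply] at h3
    rw [h3, h2.fderiv]
    simp
  have e0 : Fin.removeNth 0 ![a, b, c] = ![b, c] := by ext i; fin_cases i <;> rfl
  have e1 : Fin.removeNth 1 ![a, b, c] = ![a, c] := by ext i; fin_cases i <;> rfl
  have e2 : Fin.removeNth 2 ![a, b, c] = ![a, b] := by ext i; fin_cases i <;> rfl
  rw [extDeriv_apply hα, Fin.sum_univ_three, h1, h1, h1, e0, e1, e2]
  simp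
  ring

variable [IsManifold 𝓘(ℂ, E) ω N]

lemma eventually_contMDiffAt {s : X → N} {y : X} (hs : ContMDiffAt 𝓘(ℂ, X) 𝓘(ℂ, E) ω s y) :
    ∀ᶠ z in 𝓝 y, ContMDiffAt 𝓘(ℂ, X) 𝓘(ℂ, E) ω s z :=
  (contMDiffAt_iff_contMDiffAt_nhds (by simp)).1 hs

/-- Near a point, a holomorphic map to `N` factors through the inverse of a preferred chart, and the
pullback of a 2-form is computed from its expression in this chart. -/
lemma exists_pullback_eventuallyEq (Ω : TwoForm E N) {s : X → N} {y : X}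
    (hs : ContMDiffAt 𝓘(ℂ, X) 𝓘(ℂ, E) ω s y) :
    ∃ τ : X → E, AnalyticAt ℂ τ y ∧ τ y ∈ (extChartAt 𝓘(ℂ, E) (s y)).target ∧
      ∀ᶠ z in 𝓝 y, pullback Ω s z =
        bilinOfAlternating X ((Ω.inChart (s y) (τ z)).compContinuousLinearMap (fderiv ℂ τ z)) := by
  have hφ := isHolChart_chartAt (E := E) (s y)
  set φ := chartAt E (s y) with hφd
  have hc : ∀ z, ContMDiffAt 𝓘(ℂ, X) 𝓘(ℂ, E) ω s z → s z ∈ φ.source →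
      AnalyticAt ℂ (φ ∘ s) z := fun z hz hz' ↦
    ((hφ.contMDiffAt hz').comp z hz).contDiffAt.analyticAt
  have hsrc : s y ∈ φ.source := mem_chart_source E (s y)
  refine ⟨φ ∘ s, hc y hs hsrc, ?_, ?_⟩
  · simpa using φ.map_source hsrc
  filter_upwards [eventually_contMDiffAt hs,
    hs.continuousAt.eventually (φ.open_source.mem_nhds hsrc)] with z hz hz'
  have h1 : tderiv X E (φ ∘ s) z = (tderiv E E φ (s z)).comp (tderiv X E s z) :=
    tderiv_comp z (hφ.mdifferentiableAt hz') (hz.mdifferentiableAt (by simp))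
  rw [tderiv_eq_fderiv] at h1
  have h2 : φ.symm (φ (s z)) = s z := φ.left_inv hz'
  have h3 : ∀ v, tderiv E E φ.symm (φ (s z)) (fderiv ℂ (φ ∘ s) z v) = tderiv X E s z v :=
    fun v ↦ by
    rw [h1]
    exact hφ.tderiv_symm_tderiv hz' _
  ext v w
  have h4 := Ω.bilin_inChart (s y) ((φ ∘ s) z) (fderiv ℂ (φ ∘ s) z v) (fderiv ℂ (φ ∘ s) z w)
  rw [← hφd] at h4
  rw [bilinOfAlternating_apply, ContinuousAlternatingMap.compContinuousLinearMap_apply]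
  rw [bilinOfAlternating_apply] at h4
  have h5 : (fderiv ℂ (φ ∘ s) z) ∘ ![v, w] =
      ![fderiv ℂ (φ ∘ s) z v, fderiv ℂ (φ ∘ s) z w] := by
    ext i; fin_cases i <;> rfl
  rw [h5, h4, pullback_apply]
  simp only [Function.comp_apply] at h3 ⊢
  rw [h2, h3, h3]

variable {Ω : TwoForm E N} (hΩ : IsSymplecticForm Ω)
include hΩ

omit [IsManifold 𝓘(ℂ, E) ω N] in
lemma IsSymplecticForm.analyticAt_inChart {p : N} {e : E}
    (he : e ∈ (extChartAt 𝓘(ℂ, E) p).target) : AnalyticAt ℂ (Ω.inChart p) e :=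
  ((hΩ.holomorphic p).contDiffAt ((isOpen_extChartAt_target p).mem_nhds he)).analyticAt

lemma IsSymplecticForm.analyticAt_pullback [CompleteSpace E] {s : X → N} {y : X}
    (hs : ContMDiffAt 𝓘(ℂ, X) 𝓘(ℂ, E) ω s y) : AnalyticAt ℂ (pullback Ω s) y := by
  obtain ⟨τ, hτ, hmem, hev⟩ := exists_pullback_eventuallyEq Ω hs
  have h1 : AnalyticAt ℂ (fun z ↦ bilinOfAlternating E (Ω.inChart (s y) (τ z))) y :=
    (analyticAt_bilinOfAlternating _).fun_comp ((hΩ.analyticAt_inChart hmem).fun_comp hτ)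
  refine (analyticAt_bilinPullback h1 hτ.fderiv).congr ?_
  filter_upwards [hev] with z hz
  rw [hz]
  ext v w
  rw [bilinPullback_apply, bilinOfAlternating_apply, bilinOfAlternating_apply,
    ContinuousAlternatingMap.compContinuousLinearMap_apply]
  congr 1
  ext i; fin_cases i <;> rfl

/-- Pullbacks of a symplectic form are closed. -/
lemma IsSymplecticForm.pullback_closed [CompleteSpace E] {s : X → N} {y : X}
    (hs : ContMDiffAt 𝓘(ℂ, X) 𝓘(ℂ, E) ω s y) (a b c : X) :
    fderiv ℂ (pullback Ω s) y a b c - fderiv ℂ (pullback Ω s) y b a c +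
      fderiv ℂ (pullback Ω s) y c a b = 0 := by
  obtain ⟨τ, hτ, hmem, hev⟩ := exists_pullback_eventuallyEq Ω hs
  have hd := (hΩ.analyticAt_inChart hmem).differentiableAt
  have h1 := extDeriv_pullback hd hτ.contDiffAt (r := ω) (by simp)
  rw [hΩ.closed _ _ hmem] at h1
  have h2 : DifferentiableAt ℂ (fun z ↦
      (Ω.inChart (s y) (τ z)).compContinuousLinearMap (fderiv ℂ τ z)) y :=
    (hd.comp y hτ.differentiableAt).continuousAlternatingMapCompContinuousLinearMap
      hτ.fderiv.differentiableAt
  have h3 := extDeriv_two_apply h2 a b c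
  rw [h1] at h3
  rw [Filter.EventuallyEq.fderiv_eq hev, ← h3]
  rfl

omit [IsManifold 𝓘(ℂ, E) ω N] in
lemma IsSymplecticForm.eq_zero_of_bilin (x : N) (v : E) (h : ∀ w, Ω.bilin x v w = 0) : v = 0 :=
  hΩ.nondegenerate x v fun w ↦ (Ω.bilin_apply x v w).symm.trans (h w)

end Pullback

/-! ### Curves in the level sets of maps of constant rank -/

section ConstantRank

variable {E Y : Type*} [NormedAddCommGroup E] [NormedSpace ℂ E] [FiniteDimensional ℂ E]
  [NormedAddCommGroup Y] [NormedSpace ℂ Y] [FiniteDimensional ℂ Y]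

/-- If the kernels of the derivative of `G` have locally constant dimension, every vector in such a
kernel is the velocity of a holomorphic curve in a level set of `G`. -/
lemma exists_curve_of_constant_rank {G : E → Y} {e₀ : E} (hG : AnalyticAt ℂ G e₀)
    (hk : ∀ᶠ e in 𝓝 e₀, Module.finrank ℂ (LinearMap.ker (fderiv ℂ G e).toLinearMap) =
      Module.finrank ℂ (LinearMap.ker (fderiv ℂ G e₀).toLinearMap))
    {r : E} (hr : fderiv ℂ G e₀ r = 0) :
    ∃ γ : ℂ → E, AnalyticAt ℂ γ 0 ∧ γ 0 = e₀ ∧ fderiv ℂ γ 0 1 = r ∧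
      ∀ᶠ t in 𝓝 0, G (γ t) = G e₀ := by
  have : CompleteSpace E := FiniteDimensional.complete ℂ E
  have : CompleteSpace Y := FiniteDimensional.complete ℂ Y
  set S := LinearMap.range (fderiv ℂ G e₀).toLinearMap with hS
  have : CompleteSpace S := FiniteDimensional.complete ℂ S
  obtain ⟨π₀, hπ₀⟩ := S.subtype.exists_leftInverse_of_injective (Submodule.ker_subtype S)
  have hπ : ∀ z : S, π₀ z = z := fun z ↦ LinearMap.congr_fun hπ₀ z
  let π : Y →L[ℂ] S := LinearMap.toContinuousLinearMap π₀
  have hH : AnalyticAt ℂ (π ∘ G) e₀ := (π.analyticAt _).comp hG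
  have hder : ∀ᶠ e in 𝓝 e₀, fderiv ℂ (π ∘ G) e = π.comp (fderiv ℂ G e) := by
    filter_upwards [hG.eventually_analyticAt] with e he
    rw [fderiv_comp _ π.differentiableAt he.differentiableAt, π.fderiv]
  have hsurj : Function.Surjective (fderiv ℂ (π ∘ G) e₀) := by
    rw [hder.self_of_nhds]
    rintro ⟨_, v, rfl⟩
    exact ⟨v, hπ ⟨_, v, rfl⟩⟩
  -- near `e₀`, the composite `π ∘ G` remains a submersion, so its derivative has the same kernel
  have hsurj' : ∀ᶠ e in 𝓝 e₀, Function.Surjective (fderiv ℂ (π ∘ G) e) :=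
    eventually_surjective hH.fderiv.continuousAt hsurj
  have hdim : ∀ e, Function.Surjective (fderiv ℂ (π ∘ G) e) →
      Module.finrank ℂ (LinearMap.ker (fderiv ℂ (π ∘ G) e).toLinearMap) =
      Module.finrank ℂ (LinearMap.ker (fderiv ℂ G e₀).toLinearMap) := fun e he ↦ by
    have h1 := LinearMap.finrank_range_add_finrank_ker (fderiv ℂ (π ∘ G) e).toLinearMap
    have h2 := LinearMap.finrank_range_add_finrank_ker (fderiv ℂ G e₀).toLinearMap
    rw [LinearMap.range_eq_top.2 he, finrank_top] at h1
    change Module.finrank ℂ S + _ = _ at h2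
    omega
  have hker : ∀ᶠ e in 𝓝 e₀, ∀ v, fderiv ℂ (π ∘ G) e v = 0 → fderiv ℂ G e v = 0 := by
    filter_upwards [hk, hder, hsurj'] with e h1 h2 h3 v hv
    have hle : LinearMap.ker (fderiv ℂ G e).toLinearMap ≤
        LinearMap.ker (fderiv ℂ (π ∘ G) e).toLinearMap := fun v hv ↦ by
      have hv' : fderiv ℂ G e v = 0 := hv
      simp [h2, hv']
    have heq := Submodule.eq_of_le_of_finrank_eq hle (by rw [h1, hdim e h3])
    have : v ∈ LinearMap.ker (fderiv ℂ (π ∘ G) e).toLinearMap := hv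
    rw [← heq] at this
    exact this
  obtain ⟨Φ, hmem, hsub, hfst, hΦ, hΦs⟩ := exists_openPartialHomeomorph_fst_eq hH hsurj
    (Filter.inter_mem hker hG.eventually_analyticAt)
  let ℓ : ℂ → S × LinearMap.ker (fderiv ℂ (π ∘ G) e₀).toLinearMap :=
    fun t ↦ Φ e₀ + t • fderiv ℂ Φ e₀ r
  have hℓ : ∀ t, HasDerivAt ℓ (fderiv ℂ Φ e₀ r) t := fun t ↦ by
    have := ((hasDerivAt_id t).smul_const (fderiv ℂ Φ e₀ r)).const_add (Φ e₀)
    rwa [one_smul] at this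
  have hℓa : AnalyticAt ℂ ℓ 0 := analyticAt_const.add (analyticAt_id.smul analyticAt_const)
  have hℓ0 : ℓ 0 = Φ e₀ := by simp [ℓ]
  have hfst' : (fderiv ℂ Φ e₀ r).1 = 0 := by
    have h1 : fderiv ℂ (Prod.fst ∘ Φ) e₀ = fderiv ℂ (π ∘ G) e₀ := congrArg (fderiv ℂ · e₀) (funext hfst)
    have h2 : fderiv ℂ (Prod.fst ∘ Φ) e₀ = (ContinuousLinearMap.fst ℂ _ _).comp (fderiv ℂ Φ e₀) :=
      ((hasFDerivAt_fst).comp e₀ (hΦ e₀ hmem).differentiableAt.hasFDerivAt).fderiv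
    have h3 := DFunLike.congr_fun h2 r
    have h4 : fderiv ℂ (π ∘ G) e₀ r = 0 := by simp [hder.self_of_nhds, hr]
    rw [h1, h4] at h3
    exact h3.symm
  have hγa : AnalyticAt ℂ (Φ.symm ∘ ℓ) 0 := by
    refine AnalyticAt.comp ?_ hℓa
    rw [hℓ0]; exact hΦs _ (Φ.map_source hmem)
  have hγ0 : (Φ.symm ∘ ℓ) 0 = e₀ := by simp [hℓ0, Φ.left_inv hmem]
  refine ⟨Φ.symm ∘ ℓ, hγa, hγ0, ?_, ?_⟩
  · have h1 : HasFDerivAt (Φ ∘ (Φ.symm ∘ ℓ))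
        ((fderiv ℂ Φ e₀).comp (fderiv ℂ (Φ.symm ∘ ℓ) 0)) 0 := by
      refine HasFDerivAt.comp 0 ?_ hγa.differentiableAt.hasFDerivAt
      rw [hγ0]; exact (hΦ e₀ hmem).differentiableAt.hasFDerivAt
    have hev : ∀ᶠ t in 𝓝 (0 : ℂ), ℓ t ∈ Φ.target :=
      hℓa.continuousAt.eventually (by rw [hℓ0]; exact Φ.open_target.mem_nhds (Φ.map_source hmem))
    have h2 : Φ ∘ (Φ.symm ∘ ℓ) =ᶠ[𝓝 0] ℓ := by
      filter_upwards [hev] with t ht using Φ.right_inv ht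
    have h3 := (h1.congr_of_eventuallyEq h2.symm).unique (hℓ 0).hasFDerivAt
    have h4 := DFunLike.congr_fun h3 1
    simp only [ContinuousLinearMap.comp_apply, ContinuousLinearMap.toSpanSingleton_apply,
      one_smul] at h4
    have h5 : HasFDerivAt (Φ.symm ∘ Φ) ((fderiv ℂ Φ.symm (Φ e₀)).comp (fderiv ℂ Φ e₀)) e₀ :=
      HasFDerivAt.comp e₀ (hΦs _ (Φ.map_source hmem)).differentiableAt.hasFDerivAt
        (hΦ e₀ hmem).differentiableAt.hasFDerivAt
    have h6 : Φ.symm ∘ Φ =ᶠ[𝓝 e₀] id := by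
      filter_upwards [Φ.open_source.mem_nhds hmem] with e he using Φ.left_inv he
    have h7 := (h5.congr_of_eventuallyEq h6.symm).unique (hasFDerivAt_id e₀)
    have h8 : ∀ v, fderiv ℂ Φ.symm (Φ e₀) (fderiv ℂ Φ e₀ v) = v := fun v ↦ DFunLike.congr_fun h7 v
    rw [← h8 (fderiv ℂ (Φ.symm ∘ ℓ) 0 1), h4, h8]
  · have hnear : ∀ᶠ t in 𝓝 (0 : ℂ), AnalyticAt ℂ (Φ.symm ∘ ℓ) t ∧ ℓ t ∈ Φ.target :=
      hγa.eventually_analyticAt.and (hℓa.continuousAt.eventually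
        (by rw [hℓ0]; exact Φ.open_target.mem_nhds (Φ.map_source hmem)))
    obtain ⟨ε, hε, hball⟩ := Metric.mem_nhds_iff.1 hnear
    have hconst : ∀ t ∈ Metric.ball (0 : ℂ) ε, ((Φ.symm ∘ ℓ) t) ∈ Φ.source ∧
        (π ∘ G) ((Φ.symm ∘ ℓ) t) = (Φ e₀).1 := fun t ht ↦ by
      refine ⟨Φ.map_target (hball ht).2, ?_⟩
      rw [← hfst]
      simp [Φ.right_inv (hball ht).2, ℓ, hfst']
    have hd : ∀ t ∈ Metric.ball (0 : ℂ) ε, HasFDerivAt (G ∘ (Φ.symm ∘ ℓ)) (0 : ℂ →L[ℂ] Y) t := by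
      intro t ht
      have h0 := hsub (hconst t ht).1
      have h1 : HasFDerivAt (G ∘ (Φ.symm ∘ ℓ)) _ t :=
        HasFDerivAt.comp t h0.2.differentiableAt.hasFDerivAt
          (hball ht).1.differentiableAt.hasFDerivAt
      have h2 : HasFDerivAt ((π ∘ G) ∘ (Φ.symm ∘ ℓ)) _ t :=
        HasFDerivAt.comp t (f := Φ.symm ∘ ℓ) (g := π ∘ G) (DifferentiableAt.hasFDerivAt
          ((π.differentiableAt).comp _ h0.2.differentiableAt))
          (hball ht).1.differentiableAt.hasFDerivAt
      have h3 : (π ∘ G) ∘ (Φ.symm ∘ ℓ) =ᶠ[𝓝 t] fun _ ↦ (Φ e₀).1 := by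
        filter_upwards [Metric.isOpen_ball.mem_nhds ht] with s hs using (hconst s hs).2
      have h4 := (h2.congr_of_eventuallyEq h3.symm).unique (hasFDerivAt_const _ t)
      have h5 : (fderiv ℂ G ((Φ.symm ∘ ℓ) t)).comp (fderiv ℂ (Φ.symm ∘ ℓ) t) = 0 :=
        ContinuousLinearMap.ext fun c ↦ h0.1 _ (DFunLike.congr_fun h4 c)
      rwa [h5] at h1
    filter_upwards [Metric.ball_mem_nhds (0 : ℂ) hε] with t ht
    have := (convex_ball (0 : ℂ) ε).is_const_of_fderivWithin_eq_zero (𝕜 := ℂ)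
      (f := G ∘ (Φ.symm ∘ ℓ)) (fun s hs ↦ (hd s hs).differentiableAt.differentiableWithinAt)
      (fun s hs ↦ by
        rw [fderivWithin_of_isOpen Metric.isOpen_ball hs, (hd s hs).fderiv]) ht
      (Metric.mem_ball_self hε)
    simpa [hℓ0, Φ.left_inv hmem] using this

end ConstantRank

/-! ### Subgroups that span a real vector space -/

section Lattice

variable {X : Type*} [NormedAddCommGroup X] [NormedSpace ℝ X] [FiniteDimensional ℝ X]

/-- A real subspace spanned by its intersection with `Λ` has a basis contained in `Λ`. -/
lemma exists_basis_mem (Λ : Submodule ℤ X) (W : Submodule ℝ X)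
    (h : Submodule.span ℝ ((Λ : Set X) ∩ W) = W) :
    ∃ b : Fin (Module.finrank ℝ W) → X, LinearIndependent ℝ b ∧ (∀ i, b i ∈ Λ ∧ b i ∈ W) ∧
      Submodule.span ℝ (range b) = W := by
  obtain ⟨s, hs, hspan, hli⟩ := exists_linearIndependent ℝ ((Λ : Set X) ∩ W)
  have hfin : Finite s := hli.finite
  have := Fintype.ofFinite s
  have hcard : Fintype.card s = Module.finrank ℝ W := by
    have h1 := finrank_span_eq_card hli
    rw [Subtype.range_coe, hspan, h] at h1
    exact h1.symm
  let e : Fin (Module.finrank ℝ W) ≃ s := (Fintype.equivFinOfCardEq hcard).symm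
  refine ⟨fun i ↦ e i, hli.comp e e.injective, fun i ↦ hs (e i).2, ?_⟩
  have : range (fun i ↦ (e i : X)) = s := by
    rw [show (fun i ↦ (e i : X)) = Subtype.val ∘ e from rfl, range_comp, e.range_eq_univ]
    simp
  rw [this, hspan, h]

/-- A real subspace spanned by its intersection with `Λ` is compact modulo `Λ`. -/
lemma exists_isCompact_fundamental (Λ : Submodule ℤ X) (W : Submodule ℝ X)
    (h : Submodule.span ℝ ((Λ : Set X) ∩ W) = W) :
    ∃ K : Set X, IsCompact K ∧ K ⊆ W ∧ ∀ w ∈ W, ∃ l ∈ Λ, l ∈ W ∧ w - l ∈ K := by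
  obtain ⟨b, hli, hb, hspan⟩ := exists_basis_mem Λ W h
  refine ⟨(fun c : Fin _ → ℝ ↦ ∑ i, c i • b i) '' (Icc 0 1),
    isCompact_Icc.image (by fun_prop), ?_, fun w hw ↦ ?_⟩
  · rintro _ ⟨c, -, rfl⟩
    exact W.sum_mem fun i _ ↦ W.smul_mem _ (hb i).2
  · rw [← hspan, Submodule.mem_span_range_iff_exists_fun] at hw
    obtain ⟨c, rfl⟩ := hw
    refine ⟨∑ i, ⌊c i⌋ • b i, Λ.sum_mem fun i _ ↦ Λ.smul_mem _ (hb i).1,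
      W.sum_mem fun i _ ↦ W.toAddSubgroup.zsmul_mem (hb i).2 _, fun i ↦ Int.fract (c i), ?_, ?_⟩
    · exact ⟨fun i ↦ Int.fract_nonneg _, fun i ↦ (Int.fract_lt_one _).le⟩
    · simp only [← Finset.sum_sub_distrib]
      refine Finset.sum_congr rfl fun i _ ↦ ?_
      rw [← Int.cast_smul_eq_zsmul ℝ, ← sub_smul, Int.self_sub_floor]

/-- A discrete subgroup is commensurable with each of its subgroups that span the space: a nonzero
multiple of every element is an integral combination of a given basis contained in `Λ`. -/
lemma exists_zsmul_eq_sum (Λ : Submodule ℤ X) [DiscreteTopology Λ] {ι : Type*} [Fintype ι]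
    (b : ι → X) (hb : ∀ i, b i ∈ Λ) (hspan : Submodule.span ℝ (range b) = ⊤) {l : X}
    (hl : l ∈ Λ) : ∃ (q : ℤ) (a : ι → ℤ), q ≠ 0 ∧ q • l = ∑ i, a i • b i := by
  have hl' : l ∈ Submodule.span ℝ (range b) := by rw [hspan]; trivial
  rw [Submodule.mem_span_range_iff_exists_fun] at hl'
  obtain ⟨c, hc⟩ := hl'
  let K : Set X := (fun c : ι → ℝ ↦ ∑ i, c i • b i) '' (Icc 0 1)
  have hK : IsCompact K := isCompact_Icc.image (by fun_prop)
  have hfin : ((Λ : Set X) ∩ K).Finite := by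
    have h1 : DiscreteTopology (Λ.toAddSubgroup : Set X) := ‹DiscreteTopology Λ›
    have h2 : IsClosed (Λ.toAddSubgroup : Set X) := AddSubgroup.isClosed_of_discrete
    have h3 : IsDiscrete (Λ : Set X) := ⟨‹DiscreteTopology Λ›⟩
    exact Metric.finite_isBounded_inter_isClosed h3 hK.isBounded h2 |>.subset
      fun x hx ↦ ⟨hx.2, hx.1⟩
  let g : ℕ → X := fun k ↦ (k : ℤ) • l - ∑ i, ⌊(k : ℝ) * c i⌋ • b i
  have hg : ∀ k, g k ∈ (Λ : Set X) ∩ K := fun k ↦ by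
    refine ⟨Λ.sub_mem (Λ.smul_mem _ hl) (Λ.sum_mem fun i _ ↦ Λ.smul_mem _ (hb i)),
      fun i ↦ Int.fract ((k : ℝ) * c i),
      ⟨fun i ↦ Int.fract_nonneg _, fun i ↦ (Int.fract_lt_one _).le⟩, ?_⟩
    simp only [g]
    rw [← hc, Finset.smul_sum, ← Finset.sum_sub_distrib]
    refine Finset.sum_congr rfl fun i _ ↦ ?_
    rw [← Int.cast_smul_eq_zsmul ℝ, ← Int.cast_smul_eq_zsmul ℝ, smul_smul, ← sub_smul]
    rw [Int.fract]; push_cast; rfl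
  have hni : ¬ Function.Injective g := fun hi ↦
    Set.infinite_range_of_injective hi (hfin.subset (range_subset_iff.2 hg))
  simp only [Function.Injective, not_forall] at hni
  obtain ⟨k, k', hkk, hne⟩ := hni
  refine ⟨(k : ℤ) - k', fun i ↦ ⌊(k : ℝ) * c i⌋ - ⌊(k' : ℝ) * c i⌋, by omega, ?_⟩
  simp only [g] at hkk
  simp only [sub_smul, Finset.sum_sub_distrib]
  rw [sub_eq_sub_iff_add_eq_add] at hkk ⊢
  rw [hkk]; abel

end Lattice

/-! ### Torus fibers of isotropic submersions -/

section Tori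

variable {E : Type*} [NormedAddCommGroup E] [NormedSpace ℂ E]
  {N : Type*} [TopologicalSpace N] [ChartedSpace E N]
  {m : ℕ} {Λ : Submodule ℤ (Fin m → ℂ)} {u : (Fin m → ℂ) → N} {S : Set N}

namespace IsTorusUniformization

variable (hu : IsTorusUniformization E Λ u S)
include hu

lemma mdifferentiableAt (v : Fin m → ℂ) : MDifferentiableAt 𝓘(ℂ, Fin m → ℂ) 𝓘(ℂ, E) u v :=
  (hu.holomorphic v).mdifferentiableAt (by simp)

lemma mem (v : Fin m → ℂ) : u v ∈ S := hu.range_eq ▸ mem_range_self v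

lemma apply_add {l : Fin m → ℂ} (hl : l ∈ Λ) (v : Fin m → ℂ) : u (v + l) = u v :=
  (hu.eq_iff _ _).2 (by simpa using hl)

lemma tderiv_injective (v : Fin m → ℂ) : Function.Injective (tderiv (Fin m → ℂ) E u v) :=
  hu.immersion v

lemma tderiv_add {l : Fin m → ℂ} (hl : l ∈ Λ) (v : Fin m → ℂ) :
    tderiv (Fin m → ℂ) E u (v + l) = tderiv (Fin m → ℂ) E u v := by
  have hd : DifferentiableAt ℂ (fun w : Fin m → ℂ ↦ w + l) v := by fun_prop
  have h1 := tderiv_comp (g := u) (f := fun w ↦ w + l) v (hu.mdifferentiableAt (v + l))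
    hd.mdifferentiableAt
  have h2 : u ∘ (fun w ↦ w + l) = u := funext fun w ↦ hu.apply_add hl w
  have h3 : fderiv ℂ (fun w : Fin m → ℂ ↦ w + l) v = ContinuousLinearMap.id ℂ _ := by
    rw [fderiv_add_const]; exact fderiv_fun_id
  rw [h2, tderiv_eq_fderiv, h3] at h1
  exact h1.symm

lemma exists_isCompact (W : Submodule ℂ (Fin m → ℂ))
    (hW : Submodule.span ℝ ((Λ : Set (Fin m → ℂ)) ∩ W) = W.restrictScalars ℝ) :
    ∃ K : Set (Fin m → ℂ), IsCompact K ∧ K ⊆ W ∧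
      ∀ w ∈ W, ∃ w' ∈ K, ∀ v, u (v + w) = u (v + w') := by
  obtain ⟨K, hK, hKW, h⟩ := exists_isCompact_fundamental Λ (W.restrictScalars ℝ) hW
  refine ⟨K, hK, hKW, fun w hw ↦ ?_⟩
  obtain ⟨l, hl, -, hlK⟩ := h w hw
  refine ⟨w - l, hlK, fun v ↦ ?_⟩
  rw [← hu.apply_add hl (v + (w - l))]
  congr 1; abel

lemma span_inter_top : Submodule.span ℝ ((Λ : Set (Fin m → ℂ)) ∩ (⊤ : Submodule ℂ (Fin m → ℂ))) =
    (⊤ : Submodule ℂ (Fin m → ℂ)).restrictScalars ℝ := by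
  simp [hu.span_top]

/-- A curve contained in the image of an affine subspace `v + W` whose direction is rational with
respect to the lattice is tangent to this image. Rationality makes the image compact, so that points
of the curve near `u v` come from points of `v + W` near `v`. -/
lemma exists_tderiv_eq_of_curve [IsManifold 𝓘(ℂ, E) ω N] [T2Space N] [FiniteDimensional ℂ E]
    (W : Submodule ℂ (Fin m → ℂ))
    (hW : Submodule.span ℝ ((Λ : Set (Fin m → ℂ)) ∩ W) = W.restrictScalars ℝ) (v : Fin m → ℂ)
    {γ : ℂ → N} (hγ : MDifferentiableAt 𝓘(ℂ, ℂ) 𝓘(ℂ, E) γ 0) (h0 : γ 0 = u v)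
    (hmem : ∀ᶠ t in 𝓝 0, ∃ w ∈ W, γ t = u (v + w)) :
    ∃ w ∈ W, tderiv (Fin m → ℂ) E u v w = tderiv ℂ E γ 0 1 := by
  obtain ⟨K, hK, hKW, hKu⟩ := hu.exists_isCompact W hW
  let t : ℕ → ℂ := fun n ↦ 1 / ((n : ℂ) + 1)
  have ht : Filter.Tendsto t Filter.atTop (𝓝 0) := tendsto_one_div_add_atTop_nhds_zero_nat
  have ht0 : ∀ n, t n ≠ 0 := fun n ↦ one_div_ne_zero (Nat.cast_add_one_ne_zero n)
  have h1 : ∀ᶠ n in Filter.atTop, ∃ w, w ∈ K ∧ γ (t n) = u (v + w) := by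
    filter_upwards [ht.eventually hmem] with n hn
    obtain ⟨w, hw, hn⟩ := hn
    obtain ⟨w', hw', h⟩ := hKu w hw
    exact ⟨w', hw', by rw [hn, h]⟩
  obtain ⟨w, hw⟩ := h1.choice
  obtain ⟨w₀, hw₀, φ, hφ, hlim⟩ := hK.tendsto_subseq' (hw.mono fun n hn ↦ hn.1).frequently
  have hw' : ∀ᶠ n in Filter.atTop, w (φ n) ∈ K ∧ γ (t (φ n)) = u (v + w (φ n)) :=
    hφ.tendsto_atTop.eventually hw
  have htφ : Filter.Tendsto (t ∘ φ) Filter.atTop (𝓝 0) := ht.comp hφ.tendsto_atTop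
  have huc : Continuous u := hu.holomorphic.continuous
  have hl : w₀ ∈ Λ := by
    have e1 : Filter.Tendsto (fun n ↦ γ (t (φ n))) Filter.atTop (𝓝 (u v)) := by
      rw [← h0]; exact hγ.continuousAt.tendsto.comp htφ
    have e2 : Filter.Tendsto (fun n ↦ u (v + w (φ n))) Filter.atTop (𝓝 (u (v + w₀))) :=
      (huc.tendsto _).comp (hlim.const_add v)
    have e3 := tendsto_nhds_unique (e1.congr' (hw'.mono fun n hn ↦ hn.2)) e2
    simpa using (hu.eq_iff _ _).1 e3.symm
  -- after subtracting the limit, a lattice vector, the parameters tend to zero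
  let x : ℕ → Fin m → ℂ := fun n ↦ w (φ n) - w₀
  have hx0 : Filter.Tendsto x Filter.atTop (𝓝 0) := by
    simpa [x] using hlim.sub_const w₀
  have hxW : ∀ᶠ n in Filter.atTop, x n ∈ W :=
    hw'.mono fun n hn ↦ W.sub_mem (hKW hn.1) (hKW hw₀)
  have hxu : ∀ᶠ n in Filter.atTop, γ (t (φ n)) = u (v + x n) := by
    filter_upwards [hw'] with n hn
    rw [hn.2, ← hu.apply_add hl (v + x n)]
    congr 1; simp only [x]; abel
  have hχ := isHolChart_chartAt (E := E) (u v)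
  set χ := chartAt E (u v)
  have hsrc : u v ∈ χ.source := mem_chart_source E (u v)
  have hd1 : HasFDerivAt (χ ∘ u) (tderiv (Fin m → ℂ) E (χ ∘ u) v) v := by
    rw [tderiv_eq_fderiv]
    exact ((hχ.mdifferentiableAt hsrc).comp v (hu.mdifferentiableAt v)).differentiableAt.hasFDerivAt
  have hd2 : HasFDerivAt (χ ∘ γ) (tderiv ℂ E (χ ∘ γ) 0) 0 := by
    rw [tderiv_eq_fderiv]
    rw [← h0] at hsrc
    exact ((hχ.mdifferentiableAt hsrc).comp 0 hγ).differentiableAt.hasFDerivAt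
  set A := tderiv (Fin m → ℂ) E (χ ∘ u) v with hA
  set d := tderiv ℂ E (χ ∘ γ) 0 1 with hd
  have hAinj : Function.Injective A := by
    rw [hA, tderiv_comp v (hχ.mdifferentiableAt hsrc) (hu.mdifferentiableAt v)]
    refine Function.Injective.comp (g := tderiv E E χ (u v)) ?_ (hu.tderiv_injective v)
    exact Function.LeftInverse.injective (hχ.tderiv_symm_tderiv hsrc)
  obtain ⟨B₀, hB₀⟩ := A.toLinearMap.exists_leftInverse_of_injective (LinearMap.ker_eq_bot.2 hAinj)
  let B : E →L[ℂ] (Fin m → ℂ) := LinearMap.toContinuousLinearMap B₀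
  have hB : ∀ z, B (A z) = z := fun z ↦ LinearMap.congr_fun hB₀ z
  let τ : ℕ → ℂ := fun n ↦ t (φ n)
  have hτ0 : Filter.Tendsto τ Filter.atTop (𝓝 0) := htφ
  have o1 : (fun n ↦ (χ ∘ u) (v + x n) - (χ ∘ u) v - A (x n)) =o[Filter.atTop] x := by
    have := (hasFDerivAt_iff_isLittleO_nhds_zero.1 hd1).comp_tendsto hx0
    exact this
  have o2 : (fun n ↦ (χ ∘ γ) (τ n) - (χ ∘ γ) 0 - τ n • d) =o[Filter.atTop] τ := by
    have := (hasFDerivAt_iff_isLittleO_nhds_zero.1 hd2).comp_tendsto hτ0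
    refine this.congr_left fun n ↦ ?_
    simp only [Function.comp_apply, zero_add]
    rw [hd, ← map_smul, smul_eq_mul, mul_one]
  have heq : (fun n ↦ ((χ ∘ γ) (τ n) - (χ ∘ γ) 0 - τ n • d) -
      ((χ ∘ u) (v + x n) - (χ ∘ u) v - A (x n))) =ᶠ[Filter.atTop] fun n ↦ A (x n) - τ n • d := by
    filter_upwards [hxu] with n hn
    simp only [Function.comp_apply, h0, τ, hn]
    abel
  have o3 : (fun n ↦ B (A (x n) - τ n • d) +
      B ((χ ∘ u) (v + x n) - (χ ∘ u) v - A (x n))) =o[Filter.atTop] τ := by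
    refine ((B.isBigO_comp _ _).trans_isLittleO o2).congr' ?_ Filter.EventuallyEq.rfl
    filter_upwards [heq] with n hn
    rw [← hn, ← map_add]; congr 1; abel
  have o4 : (fun n ↦ B ((χ ∘ u) (v + x n) - (χ ∘ u) v - A (x n))) =o[Filter.atTop] x :=
    (B.isBigO_comp _ _).trans_isLittleO o1
  -- hence `x n = O(τ n)`
  have O5 : x =O[Filter.atTop] τ := by
    have e1 : (fun n ↦ x n + B ((χ ∘ u) (v + x n) - (χ ∘ u) v - A (x n))) =O[Filter.atTop] τ := by
      have e2 : (fun n ↦ τ n • B d) =O[Filter.atTop] τ :=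
        Asymptotics.IsBigO.of_bound ‖B d‖ (Filter.Eventually.of_forall fun n ↦ by
          rw [norm_smul, mul_comm])
      refine (o3.isBigO.add e2).congr_left fun n ↦ ?_
      rw [map_sub, hB, map_smul]; abel
    have e3 : (fun n ↦ x n + B ((χ ∘ u) (v + x n) - (χ ∘ u) v - A (x n))) =Θ[Filter.atTop] x := by
      refine Asymptotics.IsTheta.add_isLittleO ?_ o4
      exact Asymptotics.isTheta_refl _ _
    exact e3.isBigO_symm.trans e1
  have o6 : (fun n ↦ A (x n) - τ n • d) =o[Filter.atTop] τ :=
    (o2.sub (o1.trans_isBigO O5)).congr' heq Filter.EventuallyEq.rfl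
  have lim1 : Filter.Tendsto (fun n ↦ A ((τ n)⁻¹ • x n)) Filter.atTop (𝓝 d) := by
    have e := o6.tendsto_inv_smul_nhds_zero.add_const d
    rw [zero_add] at e
    refine e.congr fun n ↦ ?_
    rw [smul_sub, inv_smul_smul₀ (ht0 (φ n)), map_smul]; abel
  have lim2 : Filter.Tendsto (fun n ↦ (τ n)⁻¹ • x n) Filter.atTop (𝓝 (B d)) := by
    simpa [Function.comp_def, hB] using (B.continuous.tendsto d).comp lim1
  have hmemW : B d ∈ W := by
    have hcl : IsClosed (W : Set (Fin m → ℂ)) := W.closed_of_finiteDimensional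
    exact hcl.mem_of_tendsto lim2 (hxW.mono fun n hn ↦ W.smul_mem _ hn)
  have hAB : A (B d) = d := tendsto_nhds_unique ((A.continuous.tendsto _).comp lim2) lim1
  have hinj : Function.Injective (tderiv E E χ (u v)) :=
    Function.LeftInverse.injective (hχ.tderiv_symm_tderiv hsrc)
  have e1 : A = (tderiv E E χ (u v)).comp (tderiv (Fin m → ℂ) E u v) :=
    tderiv_comp v (hχ.mdifferentiableAt hsrc) (hu.mdifferentiableAt v)
  have e2 : d = tderiv E E χ (u v) (tderiv ℂ E γ 0 1) := by
    rw [hd, tderiv_comp 0 (hχ.mdifferentiableAt (by rwa [h0])) hγ, h0]; rfl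
  refine ⟨B d, hmemW, hinj ?_⟩
  exact (DFunLike.congr_fun e1 (B d)).symm.trans (hAB.trans e2)

end IsTorusUniformization

end Tori

section Submersion

variable {E : Type*} [NormedAddCommGroup E] [NormedSpace ℂ E] [FiniteDimensional ℂ E]
  {N : Type*} [TopologicalSpace N] [ChartedSpace E N]
  {V : Type*} [NormedAddCommGroup V] [NormedSpace ℂ V] [FiniteDimensional ℂ V]

/-- `F` is a holomorphic submersion of the open set `U` to a vector space, and the tangent spaces
of its fibers are isotropic. -/
structure IsIsotropicSubmersionOn (Ω : TwoForm E N) (F : N → V) (U : Set N) : Prop where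
  isOpen : IsOpen U
  holomorphic : ContMDiffOn 𝓘(ℂ, E) 𝓘(ℂ, V) ω F U
  surjective : ∀ x ∈ U, Function.Surjective (tderiv E V F x)
  isotropic : ∀ x ∈ U, ∀ v w, tderiv E V F x v = 0 → tderiv E V F x w = 0 → Ω.bilin x v w = 0

variable {Ω : TwoForm E N} {F : N → V} {U : Set N}

namespace IsIsotropicSubmersionOn

variable (h : IsIsotropicSubmersionOn Ω F U)
include h

omit [FiniteDimensional ℂ E] [FiniteDimensional ℂ V] in
lemma contMDiffAt {x : N} (hx : x ∈ U) : ContMDiffAt 𝓘(ℂ, E) 𝓘(ℂ, V) ω F x :=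
  h.holomorphic.contMDiffAt (h.isOpen.mem_nhds hx)

omit [FiniteDimensional ℂ E] [FiniteDimensional ℂ V] in
lemma mdifferentiableAt {x : N} (hx : x ∈ U) : MDifferentiableAt 𝓘(ℂ, E) 𝓘(ℂ, V) F x :=
  (h.contMDiffAt hx).mdifferentiableAt (by simp)

variable [IsManifold 𝓘(ℂ, E) ω N]

/-- Near every point, there is a holomorphic chart in which `F` is a linear projection. -/
lemma exists_adapted_chart {p : N} (hp : p ∈ U) :
    ∃ (Z : Submodule ℂ E) (Ψ : OpenPartialHomeomorph N (V × Z)), IsHolChart (E := E) Ψ ∧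
      p ∈ Ψ.source ∧ Ψ.source ⊆ U ∧ ∀ x ∈ Ψ.source, (Ψ x).1 = F x := by
  have : CompleteSpace E := FiniteDimensional.complete ℂ E
  have : CompleteSpace V := FiniteDimensional.complete ℂ V
  have hφ := isHolChart_chartAt (E := E) p
  set φ := chartAt E p
  have hsrc : p ∈ φ.source := mem_chart_source E p
  have han := hφ.analyticAt_comp_symm (h.contMDiffAt hp) hsrc
  have hs : Function.Surjective (fderiv ℂ (F ∘ φ.symm) (φ p)) := fun w ↦ by
    obtain ⟨v, rfl⟩ := h.surjective p hp w
    exact ⟨_, hφ.fderiv_comp_symm (h.mdifferentiableAt hp) hsrc v⟩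
  have hT : φ.target ∩ φ.symm ⁻¹' U ∈ 𝓝 (φ p) := by
    refine Filter.inter_mem (φ.open_target.mem_nhds (φ.map_source hsrc)) ?_
    refine (φ.continuousAt_symm (φ.map_source hsrc)).preimage_mem_nhds ?_
    rw [φ.left_inv hsrc]
    exact h.isOpen.mem_nhds hp
  obtain ⟨Φ, hmem, hsub, hfst, hΦ, hΦs⟩ := exists_openPartialHomeomorph_fst_eq han hs hT
  refine ⟨_, φ.trans Φ, hφ.trans hΦ hΦs, ⟨hsrc, hmem⟩, fun x hx ↦ ?_, fun x hx ↦ ?_⟩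
  · have h1 : φ.symm (φ x) ∈ U := (hsub hx.2).2
    rwa [φ.left_inv hx.1] at h1
  · have h2 : φ.symm (φ x) = x := φ.left_inv hx.1
    simp [hfst, h2]

end IsIsotropicSubmersionOn

omit [ChartedSpace E N] [NormedSpace ℂ V] [FiniteDimensional ℂ E] [FiniteDimensional ℂ V] in
/-- In an adapted chart, moving along a slice does not change the value of `F`. -/
lemma apply_symm_of_adapted {Z : Submodule ℂ E} {Ψ : OpenPartialHomeomorph N (V × Z)}
    (hfst : ∀ x ∈ Ψ.source, (Ψ x).1 = F x) {q : V × Z} (hq : q ∈ Ψ.target) :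
    F (Ψ.symm q) = q.1 := by
  rw [← hfst _ (Ψ.map_target hq), Ψ.right_inv hq]

omit [FiniteDimensional ℂ E] [FiniteDimensional ℂ V] in
lemma tderiv_apply_adapted {Z : Submodule ℂ E} {Ψ : OpenPartialHomeomorph N (V × Z)}
    (hΨ : IsHolChart (E := E) Ψ) (hfst : ∀ x ∈ Ψ.source, (Ψ x).1 = F x) {x : N}
    (hx : x ∈ Ψ.source) (v : E) : (tderiv E (V × Z) Ψ x v).1 = tderiv E V F x v := by
  have h1 : MDifferentiableAt 𝓘(ℂ, V × Z) 𝓘(ℂ, V) (Prod.fst : V × Z → V) (Ψ x) :=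
    differentiableAt_fst.mdifferentiableAt
  have h2 := tderiv_comp x h1 (hΨ.mdifferentiableAt hx)
  have h3 : Prod.fst ∘ Ψ =ᶠ[𝓝 x] F := by
    filter_upwards [Ψ.open_source.mem_nhds hx] with y hy using hfst y hy
  rw [tderiv_congr h3, tderiv_eq_fderiv, fderiv_fst] at h2
  rw [h2]; rfl

variable {m : ℕ} {Λ : Submodule ℤ (Fin m → ℂ)} {u : (Fin m → ℂ) → N} {y : V}

/-- The covector on the base attached to a constant vector field on a torus fiber: contraction with
the 2-form carries `du_v a` to the pullback under `F` of a covector `L a` that does not depend on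
the point `u v` of the fiber. -/
def IsPeriodMap (Ω : TwoForm E N) (F : N → V) (u : (Fin m → ℂ) → N)
    (L : (Fin m → ℂ) →L[ℂ] V →L[ℂ] ℂ) : Prop :=
  ∀ v a w, Ω.bilin (u v) (tderiv (Fin m → ℂ) E u v a) w = L a (tderiv E V F (u v) w)

omit [FiniteDimensional ℂ E] [FiniteDimensional ℂ V] in
lemma IsTorusUniformization.tderiv_tderiv_eq_zero (h : IsIsotropicSubmersionOn Ω F U)
    (hu : IsTorusUniformization E Λ u (U ∩ F ⁻¹' {y})) (v a : Fin m → ℂ) :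
    tderiv E V F (u v) (tderiv (Fin m → ℂ) E u v a) = 0 := by
  have h1 := tderiv_comp v (h.mdifferentiableAt (hu.mem v).1) (hu.mdifferentiableAt v)
  have h2 : F ∘ u = fun _ ↦ y := funext fun w ↦ (hu.mem w).2
  rw [h2, tderiv_eq_fderiv, fderiv_fun_const] at h1
  exact (DFunLike.congr_fun h1 a).symm

variable [IsManifold 𝓘(ℂ, E) ω N]

/-- For a vector `a` and a tangent vector `w` of the base, the contraction of the 2-form with `du_v a` and
a lift of `w` is a holomorphic function on the torus, hence constant by Liouville's theorem. -/
lemma IsTorusUniformization.exists_isPeriodMap (h : IsIsotropicSubmersionOn Ω F U)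
    (hΩ : IsSymplecticForm Ω) (hu : IsTorusUniformization E Λ u (U ∩ F ⁻¹' {y})) :
    ∃ L, IsPeriodMap Ω F u L := by
  have : CompleteSpace E := FiniteDimensional.complete ℂ E
  have : CompleteSpace V := FiniteDimensional.complete ℂ V
  have hFu : ∀ v, F (u v) = y := fun v ↦ (hu.mem v).2
  -- the contraction does not depend on the choice of a lift
  have hlift : ∀ v a w w', tderiv E V F (u v) w = tderiv E V F (u v) w' →
      Ω.bilin (u v) (tderiv (Fin m → ℂ) E u v a) w =
      Ω.bilin (u v) (tderiv (Fin m → ℂ) E u v a) w' := fun v a w w' hw ↦ by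
    rw [← sub_eq_zero, ← map_sub]
    exact h.isotropic _ (hu.mem v).1 _ _ (hu.tderiv_tderiv_eq_zero h v a)
      (by rw [map_sub, hw, sub_self])
  have hsurj : ∀ v, Function.Surjective (tderiv E V F (u v)) :=
    fun v ↦ h.surjective _ (hu.mem v).1
  let g : (Fin m → ℂ) → V → (Fin m → ℂ) → ℂ := fun a w v ↦
    Ω.bilin (u v) (tderiv (Fin m → ℂ) E u v a) (Function.surjInv (hsurj v) w)
  have hg : ∀ a w v w', tderiv E V F (u v) w' = w →
      Ω.bilin (u v) (tderiv (Fin m → ℂ) E u v a) w' = g a w v := fun a w v w' hw ↦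
    hlift v a _ _ (by rw [hw, Function.surjInv_eq (hsurj v)])
  have hdiff : ∀ a w, Differentiable ℂ (g a w) := fun a w v₀ ↦ by
    obtain ⟨Z, Ψ, hΨ, hp, hsub, hfst⟩ := h.exists_adapted_chart (hu.mem v₀).1
    have : CompleteSpace Z := FiniteDimensional.complete ℂ Z
    -- moving transversally to the fiber in the chart, `σ` lifts tangent vectors of the base through each point `u v`
    let σ : (Fin m → ℂ) × V → N := fun q ↦ Ψ.symm (q.2, (Ψ (u q.1)).2)
    have hsrc : ∀ᶠ v in 𝓝 v₀, u v ∈ Ψ.source :=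
      hu.holomorphic.continuous.continuousAt.eventually (Ψ.open_source.mem_nhds hp)
    have hΨu : ∀ v, u v ∈ Ψ.source → Ψ (u v) = (y, (Ψ (u v)).2) := fun v hv ↦
      Prod.ext (by rw [hfst _ hv, hFu]) rfl
    have hσ : ∀ v, u v ∈ Ψ.source →
        ContMDiffAt 𝓘(ℂ, (Fin m → ℂ) × V) 𝓘(ℂ, E) ω σ (v, y) := fun v hv ↦ by
      have h1 : AnalyticAt ℂ (Ψ ∘ u) v :=
        ((hΨ.contMDiffAt hv).comp v (hu.holomorphic v)).contDiffAt.analyticAt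
      have h2 : AnalyticAt ℂ (fun q : (Fin m → ℂ) × V ↦ (q.2, (Ψ (u q.1)).2)) (v, y) := by
        refine analyticAt_snd.prod ?_
        have h3 : AnalyticAt ℂ (fun q : (Fin m → ℂ) × V ↦ Ψ (u q.1)) (v, y) :=
          AnalyticAt.fun_comp (f := Prod.fst) (g := Ψ ∘ u) h1 analyticAt_fst
        exact analyticAt_snd.fun_comp h3
      refine ContMDiffAt.comp (g := Ψ.symm) (v, y) ?_ h2.contDiffAt.contMDiffAt
      have h3 : (y, (Ψ (u v)).2) ∈ Ψ.target := by rw [← hΨu v hv]; exact Ψ.map_source hv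
      exact hΨ.contMDiffAt_symm h3
    have hval : ∀ v, u v ∈ Ψ.source → σ (v, y) = u v := fun v hv ↦ by
      simp only [σ]
      rw [← hΨu v hv, Ψ.left_inv hv]
    have hgσ : ∀ᶠ v in 𝓝 v₀, g a w v = pullback Ω σ (v, y) (a, 0) (0, w) := by
      filter_upwards [hsrc.eventually_nhds] with v hv
      have hv' := hv.self_of_nhds
      have hdσ := (hσ v hv').mdifferentiableAt (by simp : (ω : WithTop ℕ∞) ≠ 0)
      have e1 : tderiv ((Fin m → ℂ) × V) E σ (v, y) (a, 0) = tderiv (Fin m → ℂ) E u v a := by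
        have d1 : HasFDerivAt (fun v : Fin m → ℂ ↦ (v, y)) (ContinuousLinearMap.inl ℂ _ V) v :=
          hasFDerivAt_prodMk_left v y
        have d2 := tderiv_comp (g := σ) (f := fun v ↦ (v, y)) v hdσ
          d1.differentiableAt.mdifferentiableAt
        have d3 : σ ∘ (fun v ↦ (v, y)) =ᶠ[𝓝 v] u := by
          filter_upwards [hv] with v' hv' using hval v' hv'
        rw [tderiv_congr d3, tderiv_eq_fderiv, d1.fderiv] at d2
        rw [d2]; rfl
      have e2 : tderiv E V F (u v) (tderiv ((Fin m → ℂ) × V) E σ (v, y) (0, w)) = w := by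
        have d0 : MDifferentiableAt 𝓘(ℂ, E) 𝓘(ℂ, V) F (σ (v, y)) := by
          rw [hval v hv']; exact h.mdifferentiableAt (hu.mem v).1
        have d2 := tderiv_comp (g := F) (f := σ) (v, y) d0 hdσ
        have d4 : ∀ᶠ q in 𝓝 ((v, y) : (Fin m → ℂ) × V), (q.2, (Ψ (u q.1)).2) ∈ Ψ.target := by
          have c1 : ContinuousAt (fun q : (Fin m → ℂ) × V ↦ (q.2, (Ψ (u q.1)).2)) (v, y) := by
            have c2 : ContinuousAt (fun v ↦ Ψ (u v)) v :=
              (Ψ.continuousAt hv').comp hu.holomorphic.continuous.continuousAt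
            have c3 : ContinuousAt (fun q : (Fin m → ℂ) × V ↦ Ψ (u q.1)) (v, y) :=
              ContinuousAt.comp (f := Prod.fst) (g := fun v ↦ Ψ (u v)) c2 continuousAt_fst
            exact continuousAt_snd.prodMk (continuousAt_snd.comp c3)
          refine c1.eventually (Ψ.open_target.mem_nhds ?_)
          simp only
          rw [← hΨu v hv']; exact Ψ.map_source hv'
        have d3 : F ∘ σ =ᶠ[𝓝 ((v, y) : (Fin m → ℂ) × V)] Prod.snd := by
          filter_upwards [d4] with q hq using apply_symm_of_adapted hfst hq
        rw [tderiv_congr d3, tderiv_eq_fderiv, fderiv_snd, hval v hv'] at d2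
        exact (DFunLike.congr_fun d2 (0, w)).symm
      rw [pullback_apply, e1, hval v hv']
      exact (hg a w v _ e2).symm
    have hB := hΩ.analyticAt_pullback (hσ v₀ hsrc.self_of_nhds)
    have h4 : AnalyticAt ℂ (fun v ↦ pullback Ω σ (v, y)) v₀ :=
      AnalyticAt.fun_comp (f := fun v ↦ (v, y)) (g := pullback Ω σ) hB
        (analyticAt_id.prod analyticAt_const)
    exact ((analyticAt_clm_apply (analyticAt_clm_apply h4 analyticAt_const)
      analyticAt_const).congr (hgσ.mono fun _ h ↦ h.symm)).differentiableAt
  have hconst : ∀ a w v v', g a w v = g a w v' := fun a w v v' ↦ by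
    obtain ⟨K, hK, -, hKl⟩ := exists_isCompact_fundamental Λ ⊤ (by simp [hu.span_top])
    refine (hdiff a w).apply_eq_apply_of_bounded ?_ v v'
    refine (hK.image (hdiff a w).continuous).isBounded.subset ?_
    rintro _ ⟨x, rfl⟩
    obtain ⟨l, hl, -, hxl⟩ := hKl x trivial
    refine ⟨x - l, hxl, ?_⟩
    have hx : x = (x - l) + l := by abel
    have e1 : u x = u (x - l) := by conv_lhs => rw [hx, hu.apply_add hl]
    have e2 : tderiv (Fin m → ℂ) E u x = tderiv (Fin m → ℂ) E u (x - l) := by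
      conv_lhs => rw [hx, hu.tderiv_add hl]
    rw [← hg a w x (Function.surjInv (hsurj (x - l)) w) (by rw [e1, Function.surjInv_eq (hsurj (x - l))])]
    rw [e1, e2]
  obtain ⟨R₀, hR₀⟩ := (tderiv E V F (u 0)).toLinearMap.exists_rightInverse_of_surjective
    (LinearMap.range_eq_top.2 (hsurj 0))
  let R : V →L[ℂ] E := LinearMap.toContinuousLinearMap R₀
  have hR : ∀ w, tderiv E V F (u 0) (R w) = w := fun w ↦ LinearMap.congr_fun hR₀ w
  refine ⟨((ContinuousLinearMap.compL ℂ V E ℂ).flip R).comp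
    ((Ω.bilin (u 0)).comp (tderiv (Fin m → ℂ) E u 0)), fun v a w ↦ ?_⟩
  have h1 := hg a (tderiv E V F (u v) w) v w rfl
  have h2 := hg a (tderiv E V F (u v) w) 0 _ (hR _)
  rw [h1, hconst a _ v 0, ← h2]
  rfl

omit [FiniteDimensional ℂ E] [FiniteDimensional ℂ V] [IsManifold 𝓘(ℂ, E) ω N] in
lemma IsPeriodMap.injective (hΩ : IsSymplecticForm Ω) {S : Set N}
    (hu : IsTorusUniformization E Λ u S) {L : (Fin m → ℂ) →L[ℂ] V →L[ℂ] ℂ}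
    (hL : IsPeriodMap Ω F u L) : Function.Injective L := by
  refine (injective_iff_map_eq_zero L).2 fun a ha ↦ ?_
  have h1 : tderiv (Fin m → ℂ) E u 0 a = 0 := by
    refine hΩ.eq_zero_of_bilin (u 0) _ fun w ↦ ?_
    rw [hL 0 a w, ha]; rfl
  exact hu.tderiv_injective 0 (by rw [h1, map_zero])

end Submersion

/-! ### Lifts to the universal cover of a torus fiber -/

section Lift

variable {E : Type*} [NormedAddCommGroup E] [NormedSpace ℂ E] [FiniteDimensional ℂ E]
  {N : Type*} [TopologicalSpace N] [ChartedSpace E N] [T2Space N] [IsManifold 𝓘(ℂ, E) ω N]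
  {V : Type*} [NormedAddCommGroup V] [NormedSpace ℂ V] [FiniteDimensional ℂ V]
  {Ω : TwoForm E N} {F : N → V} {U : Set N}
  {m : ℕ} {Λ : Submodule ℤ (Fin m → ℂ)} {u : (Fin m → ℂ) → N} {y : V}

/-- Near each of its points, a slice of an adapted chart lifts to the universal cover of the torus
fiber that contains it. -/
lemma IsTorusUniformization.exists_slice_lift (h : IsIsotropicSubmersionOn Ω F U)
    (hu : IsTorusUniformization E Λ u (U ∩ F ⁻¹' {y})) {Z : Submodule ℂ E}
    {Ψ : OpenPartialHomeomorph N (V × Z)} (hΨ : IsHolChart (E := E) Ψ) (hΨU : Ψ.source ⊆ U)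
    (hfst : ∀ x ∈ Ψ.source, (Ψ x).1 = F x) {v₀ : Fin m → ℂ} (hv₀ : u v₀ ∈ Ψ.source) :
    ∃ ζ : Z → Fin m → ℂ, (∀ᶠ v in 𝓝 v₀, ζ (Ψ (u v)).2 = v) ∧
      ∀ᶠ z in 𝓝 (Ψ (u v₀)).2, DifferentiableAt ℂ ζ z ∧ u (ζ z) = Ψ.symm (y, z) := by
  have : CompleteSpace V := FiniteDimensional.complete ℂ V
  have : CompleteSpace Z := FiniteDimensional.complete ℂ Z
  have hΨu : ∀ v, u v ∈ Ψ.source → Ψ (u v) = (y, (Ψ (u v)).2) := fun v hv ↦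
    Prod.ext (by rw [hfst _ hv, (hu.mem v).2]) rfl
  have hcomp : AnalyticAt ℂ (Ψ ∘ u) v₀ :=
    ((hΨ.contMDiffAt hv₀).comp v₀ (hu.holomorphic v₀)).contDiffAt.analyticAt
  have hκ : AnalyticAt ℂ (fun v ↦ (Ψ (u v)).2) v₀ := analyticAt_snd.fun_comp hcomp
  have hdκ : ∀ a, fderiv ℂ (fun v ↦ (Ψ (u v)).2) v₀ a =
      (tderiv E (V × Z) Ψ (u v₀) (tderiv (Fin m → ℂ) E u v₀ a)).2 := fun a ↦ by
    have h1 : fderiv ℂ (Ψ ∘ u) v₀ = _ := (tderiv_eq_fderiv _ _).symm.trans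
      (tderiv_comp v₀ (hΨ.mdifferentiableAt hv₀) (hu.mdifferentiableAt v₀))
    have h2 : fderiv ℂ (fun v ↦ (Ψ (u v)).2) v₀ =
        (ContinuousLinearMap.snd ℂ V Z).comp (fderiv ℂ (Ψ ∘ u) v₀) :=
      (hasFDerivAt_snd.comp v₀ hcomp.differentiableAt.hasFDerivAt).fderiv
    rw [h2, h1]; rfl
  have hfst0 : ∀ a, (tderiv E (V × Z) Ψ (u v₀) (tderiv (Fin m → ℂ) E u v₀ a)).1 = 0 := fun a ↦ by
    rw [tderiv_apply_adapted hΨ hfst hv₀, hu.tderiv_tderiv_eq_zero h]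
  have hinj : Function.Injective (fderiv ℂ (fun v ↦ (Ψ (u v)).2) v₀) := by
    refine (injective_iff_map_eq_zero _).2 fun a ha ↦ ?_
    rw [hdκ] at ha
    have h1 : tderiv E (V × Z) Ψ (u v₀) (tderiv (Fin m → ℂ) E u v₀ a) = 0 :=
      Prod.ext (hfst0 a) ha
    have h2 := hΨ.tderiv_symm_tderiv hv₀ (tderiv (Fin m → ℂ) E u v₀ a)
    rw [h1, map_zero] at h2
    exact hu.tderiv_injective v₀ (by rw [← h2, map_zero])
  have hsurj : Function.Surjective (fderiv ℂ (fun v ↦ (Ψ (u v)).2) v₀) := fun ż ↦ by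
    -- the line through `u v₀` in the slice, with velocity `ż`
    let ℓ : ℂ → V × Z := fun t ↦ Ψ (u v₀) + t • ((0, ż) : V × Z)
    have hℓ : HasFDerivAt ℓ (ContinuousLinearMap.toSpanSingleton ℂ ((0, ż) : V × Z)) 0 := by
      have := ((hasDerivAt_id (0 : ℂ)).smul_const ((0, ż) : V × Z)).const_add (Ψ (u v₀))
      rw [one_smul] at this
      exact this.hasFDerivAt
    have hℓ0 : ℓ 0 = Ψ (u v₀) := by simp [ℓ]
    have hm : MDifferentiableAt 𝓘(ℂ, V × Z) 𝓘(ℂ, E) Ψ.symm (ℓ 0) := by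
      rw [hℓ0]; exact hΨ.mdifferentiableAt_symm (Ψ.map_source hv₀)
    have hmem : ∀ᶠ t in 𝓝 (0 : ℂ), ∃ w ∈ (⊤ : Submodule ℂ (Fin m → ℂ)),
        (Ψ.symm ∘ ℓ) t = u (v₀ + w) := by
      have h1 : ∀ᶠ t in 𝓝 (0 : ℂ), ℓ t ∈ Ψ.target := hℓ.continuousAt.eventually
        (by rw [hℓ0]; exact Ψ.open_target.mem_nhds (Ψ.map_source hv₀))
      filter_upwards [h1] with t ht
      have h2 : Ψ.symm (ℓ t) ∈ U ∩ F ⁻¹' {y} := by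
        refine ⟨hΨU (Ψ.map_target ht), ?_⟩
        rw [mem_preimage, mem_singleton_iff, apply_symm_of_adapted hfst ht]
        have e : (Ψ (u v₀)).1 = y := congrArg Prod.fst (hΨu v₀ hv₀)
        simp [ℓ, e]
      rw [← hu.range_eq] at h2
      obtain ⟨w, hw⟩ := h2
      exact ⟨w - v₀, trivial, by rw [add_sub_cancel, hw]; rfl⟩
    obtain ⟨a, -, ha⟩ := hu.exists_tderiv_eq_of_curve ⊤ hu.span_inter_top v₀
      (hm.comp 0 hℓ.differentiableAt.mdifferentiableAt)
      (by simp [hℓ0, Ψ.left_inv hv₀]) hmem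
    refine ⟨a, ?_⟩
    rw [hdκ, ha, tderiv_comp 0 hm hℓ.differentiableAt.mdifferentiableAt, tderiv_eq_fderiv,
      hℓ.fderiv, hℓ0]
    simp only [ContinuousLinearMap.comp_apply, ContinuousLinearMap.toSpanSingleton_apply, one_smul]
    rw [hΨ.tderiv_tderiv_symm hv₀]
  let i : (Fin m → ℂ) ≃L[ℂ] Z := ContinuousLinearEquiv.ofBijective
    (fderiv ℂ (fun v ↦ (Ψ (u v)).2) v₀) (LinearMap.ker_eq_bot.2 hinj) (LinearMap.range_eq_top.2 hsurj)
  have hT : u ⁻¹' Ψ.source ∈ 𝓝 v₀ :=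
    hu.holomorphic.continuous.continuousAt.preimage_mem_nhds (Ψ.open_source.mem_nhds hv₀)
  obtain ⟨Φ, hΦ, hmem, hsub, -, hΦs⟩ := exists_openPartialHomeomorph_coe_eq hκ (i := i) rfl hT
  refine ⟨Φ.symm, ?_, ?_⟩
  · filter_upwards [Φ.open_source.mem_nhds hmem] with v hv
    rw [← hΦ, Φ.left_inv hv]
  · rw [← hΦ]
    filter_upwards [Φ.open_target.mem_nhds (Φ.map_source hmem)] with z hz
    refine ⟨(hΦs z hz).differentiableAt, ?_⟩
    have h1 := hsub (Φ.map_target hz)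
    have h2 := hΨu _ h1
    rw [← hΦ, Φ.right_inv hz] at h2
    rw [← h2, Ψ.left_inv h1]

/-- Curves in a torus fiber lift locally to its universal cover. -/
lemma IsTorusUniformization.exists_local_lift (h : IsIsotropicSubmersionOn Ω F U)
    (hu : IsTorusUniformization E Λ u (U ∩ F ⁻¹' {y})) {c : ℂ → N} {t₀ : ℂ}
    (hc : ∀ᶠ t in 𝓝 t₀, MDifferentiableAt 𝓘(ℂ, ℂ) 𝓘(ℂ, E) c t ∧ F (c t) = y)
    {v₀ : Fin m → ℂ} (hv₀ : u v₀ = c t₀) :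
    ∃ v : ℂ → Fin m → ℂ, v t₀ = v₀ ∧
      ∀ᶠ t in 𝓝 t₀, DifferentiableAt ℂ v t ∧ u (v t) = c t := by
  obtain ⟨Z, Ψ, hΨ, hp, hsub, hfst⟩ := h.exists_adapted_chart (hu.mem v₀).1
  obtain ⟨ζ, hζ₀, hζ⟩ := hu.exists_slice_lift h hΨ hsub hfst hp
  have hcc : ContinuousAt c t₀ := hc.self_of_nhds.1.continuousAt
  rw [hv₀] at hζ hp
  have h1 : ∀ᶠ t in 𝓝 t₀, c t ∈ Ψ.source := hcc.eventually (Ψ.open_source.mem_nhds hp)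
  have h2 : ContinuousAt (fun t ↦ (Ψ (c t)).2) t₀ :=
    continuousAt_snd.comp ((Ψ.continuousAt hp).comp hcc)
  refine ⟨fun t ↦ ζ (Ψ (c t)).2, ?_, ?_⟩
  · simp only; rw [← hv₀]; exact hζ₀.self_of_nhds
  · filter_upwards [h1, h2.eventually hζ, hc] with t ht hz hct
    have h3 : DifferentiableAt ℂ (fun t ↦ (Ψ (c t)).2) t :=
      differentiableAt_snd.comp t ((hΨ.mdifferentiableAt ht).comp t hct.1).differentiableAt
    refine ⟨hz.1.comp t h3, ?_⟩
    rw [hz.2]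
    have h4 : (y, (Ψ (c t)).2) = Ψ (c t) := Prod.ext (by rw [hfst _ ht, hct.2]) rfl
    rw [h4, Ψ.left_inv ht]

end Lift

/-! ### Integrals over families of arcs -/

section ParametricIntegral

variable {H : Type*} [NormedAddCommGroup H] [NormedSpace ℂ H]
  {G : Type*} [NormedAddCommGroup G] [NormedSpace ℂ G]

omit [NormedSpace ℂ H] in
lemma continuous_prodMk_ofReal (y : H) : Continuous fun t : ℝ ↦ (y, (t : ℂ)) :=
  continuous_const.prodMk Complex.continuous_ofReal

omit [NormedSpace ℂ H] in
lemma continuousAt_map_ofReal (y : H) (t : ℝ) :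
    ContinuousAt (fun q : H × ℝ ↦ (q.1, (q.2 : ℂ))) (y, t) :=
  (continuous_fst.prodMk (Complex.continuous_ofReal.comp continuous_snd)).continuousAt

/-- Differentiation under the integral sign for an integrand that is holomorphic near the segment
over which it is integrated. -/
lemma hasFDerivAt_integral_of_analyticAt [CompleteSpace G] {A : H × ℂ → G} {y : H}
    (hA : ∀ t ∈ Icc (0 : ℝ) 1, AnalyticAt ℂ A (y, (t : ℂ))) :
    HasFDerivAt (fun y' ↦ ∫ t in (0 : ℝ)..1, A (y', (t : ℂ)))
      (∫ t in (0 : ℝ)..1, (fderiv ℂ A (y, (t : ℂ))).comp (ContinuousLinearMap.inl ℂ H ℂ)) y := by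
  have hcont : ∀ y', (∀ t ∈ Icc (0 : ℝ) 1, AnalyticAt ℂ A (y', (t : ℂ))) →
      ContinuousOn (fun t : ℝ ↦ A (y', (t : ℂ))) (uIcc 0 1) := fun y' h t ht ↦ by
    rw [uIcc_of_le zero_le_one] at ht
    exact (ContinuousAt.comp (f := fun t : ℝ ↦ (y', (t : ℂ))) (h t ht).continuousAt
      (continuous_prodMk_ofReal y').continuousAt).continuousWithinAt
  have hcont' : ContinuousOn (fun t : ℝ ↦ (fderiv ℂ A (y, (t : ℂ))).comp
      (ContinuousLinearMap.inl ℂ H ℂ)) (uIcc 0 1) := fun t ht ↦ by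
    rw [uIcc_of_le zero_le_one] at ht
    have h1 : ContinuousAt (fun t : ℝ ↦ fderiv ℂ A (y, (t : ℂ))) t :=
      ContinuousAt.comp (f := fun t : ℝ ↦ (y, (t : ℂ))) (hA t ht).fderiv.continuousAt
        (continuous_prodMk_ofReal y).continuousAt
    exact (h1.clm_comp continuousAt_const).continuousWithinAt
  obtain ⟨M, hM⟩ := (isCompact_uIcc (a := (0 : ℝ)) (b := 1)).exists_bound_of_continuousOn hcont'
  have hev : ∀ᶠ y' in 𝓝 y, ∀ t ∈ Icc (0 : ℝ) 1, AnalyticAt ℂ A (y', (t : ℂ)) ∧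
      ‖(fderiv ℂ A (y', (t : ℂ))).comp (ContinuousLinearMap.inl ℂ H ℂ)‖ < M + 1 := by
    refine isCompact_Icc.eventually_forall_of_forall_eventually fun t ht ↦ ?_
    have h1 : ContinuousAt (fun q ↦ ‖(fderiv ℂ A q).comp (ContinuousLinearMap.inl ℂ H ℂ)‖)
        (y, (t : ℂ)) := ((hA t ht).fderiv.continuousAt.clm_comp continuousAt_const).norm
    have h2 := hM t (by rwa [uIcc_of_le zero_le_one])
    have h3 := (continuousAt_map_ofReal y t).eventually
      ((hA t ht).eventually_analyticAt.and
      (h1.eventually (gt_mem_nhds (show _ < M + 1 by simp only; linarith))))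
    exact h3
  obtain ⟨s, hs, hsub⟩ := hev.exists_mem
  refine intervalIntegral.hasFDerivAt_integral_of_dominated_of_fderiv_le (s := s)
    (F' := fun y' t ↦ (fderiv ℂ A (y', (t : ℂ))).comp (ContinuousLinearMap.inl ℂ H ℂ))
    (bound := fun _ ↦ M + 1) hs ?_ ?_ ?_ ?_ ?_ ?_
  · filter_upwards [hs] with y' hy'
    exact (((hcont y' fun t ht ↦ (hsub y' hy' t ht).1).mono uIoc_subset_uIcc).aestronglyMeasurable
      measurableSet_uIoc)
  · exact (hcont y hA).intervalIntegrable
  · exact (hcont'.mono uIoc_subset_uIcc).aestronglyMeasurable measurableSet_uIoc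
  · refine Filter.Eventually.of_forall fun t ht y' hy' ↦ ?_
    rw [uIoc_of_le zero_le_one] at ht
    exact (hsub y' hy' t ⟨ht.1.le, ht.2⟩).2.le
  · exact intervalIntegrable_const
  · refine Filter.Eventually.of_forall fun t ht y' hy' ↦ ?_
    rw [uIoc_of_le zero_le_one] at ht
    have h1 := (hsub y' hy' t ⟨ht.1.le, ht.2⟩).1.differentiableAt.hasFDerivAt
    exact h1.comp y' (hasFDerivAt_prodMk_left y' (t : ℂ))

end ParametricIntegral

section Arc

variable {E : Type*} [NormedAddCommGroup E] [NormedSpace ℂ E] [FiniteDimensional ℂ E]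
  {N : Type*} [TopologicalSpace N] [ChartedSpace E N]
  {V : Type*} [NormedAddCommGroup V] [NormedSpace ℂ V] [FiniteDimensional ℂ V]

variable (E) in
/-- A holomorphic family of arcs: for base points near `y`, the map `C (y, ·)` is a curve in the
fiber of `F` over `y`, defined near the real interval `[0, 1]`. -/
def IsArcFamilyAt (F : N → V) (U : Set N) (C : V × ℂ → N) (y : V) : Prop :=
  ∀ t ∈ Icc (0 : ℝ) 1, ∀ᶠ q in 𝓝 (y, (t : ℂ)),
    ContMDiffAt 𝓘(ℂ, V × ℂ) 𝓘(ℂ, E) ω C q ∧ C q ∈ U ∧ F (C q) = q.1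

/-- The part of a bilinear form on `V × ℂ` that pairs the direction of the parameter with the
directions of the base. -/
def mixedPart (V : Type*) [NormedAddCommGroup V] [NormedSpace ℂ V] :
    ((V × ℂ) →L[ℂ] (V × ℂ) →L[ℂ] ℂ) →L[ℂ] (V →L[ℂ] ℂ) :=
  ((ContinuousLinearMap.compL ℂ V (V × ℂ) ℂ).flip (ContinuousLinearMap.inl ℂ V ℂ)).comp
    (ContinuousLinearMap.apply ℂ ((V × ℂ) →L[ℂ] ℂ) ((0, 1) : V × ℂ))

omit [FiniteDimensional ℂ V] in
@[simp] lemma mixedPart_apply (β : (V × ℂ) →L[ℂ] (V × ℂ) →L[ℂ] ℂ) (w : V) :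
    mixedPart V β w = β (0, 1) (w, 0) := rfl

/-- The 1-form on the base obtained by integrating the pullback of the 2-form along the arcs of a
family. -/
def arcForm (Ω : TwoForm E N) (C : V × ℂ → N) (y : V) : V →L[ℂ] ℂ :=
  ∫ t in (0 : ℝ)..1, mixedPart V (pullback Ω C (y, (t : ℂ)))

variable {Ω : TwoForm E N} {F : N → V} {U : Set N} {C : V × ℂ → N} {y : V}

omit [FiniteDimensional ℂ E] [FiniteDimensional ℂ V] in
lemma IsArcFamilyAt.eventually (hC : IsArcFamilyAt E F U C y) :
    ∀ᶠ y' in 𝓝 y, IsArcFamilyAt E F U C y' :=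
  isCompact_Icc.eventually_forall_of_forall_eventually fun t ht ↦
    (continuousAt_map_ofReal y t).eventually (hC t ht).eventually_nhds

variable [IsManifold 𝓘(ℂ, E) ω N]

omit [FiniteDimensional ℂ V] in
lemma IsArcFamilyAt.analyticAt (hΩ : IsSymplecticForm Ω) (hC : IsArcFamilyAt E F U C y)
    {t : ℝ} (ht : t ∈ Icc (0 : ℝ) 1) : AnalyticAt ℂ (pullback Ω C) (y, (t : ℂ)) := by
  have : CompleteSpace E := FiniteDimensional.complete ℂ E
  exact hΩ.analyticAt_pullback (hC t ht).self_of_nhds.1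

omit [FiniteDimensional ℂ V] in
lemma IsArcFamilyAt.analyticAt_mixedPart (hΩ : IsSymplecticForm Ω) (hC : IsArcFamilyAt E F U C y)
    {t : ℝ} (ht : t ∈ Icc (0 : ℝ) 1) :
    AnalyticAt ℂ (fun q ↦ mixedPart V (pullback Ω C q)) (y, (t : ℂ)) :=
  AnalyticAt.fun_comp (ContinuousLinearMap.analyticAt (𝕜 := ℂ)
    (E := (V × ℂ) →L[ℂ] (V × ℂ) →L[ℂ] ℂ) (F := V →L[ℂ] ℂ) (mixedPart V) _) (hC.analyticAt hΩ ht)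

omit [FiniteDimensional ℂ V] in
lemma IsArcFamilyAt.continuousOn_mixedPart (hΩ : IsSymplecticForm Ω)
    (hC : IsArcFamilyAt E F U C y) :
    ContinuousOn (fun t : ℝ ↦ mixedPart V (pullback Ω C (y, (t : ℂ)))) (Icc 0 1) := fun _ ht ↦
  (ContinuousAt.comp (f := fun t : ℝ ↦ (y, (t : ℂ))) (hC.analyticAt_mixedPart hΩ ht).continuousAt
    (continuous_prodMk_ofReal y).continuousAt).continuousWithinAt

omit [FiniteDimensional ℂ V] [FiniteDimensional ℂ E] [IsManifold 𝓘(ℂ, E) ω N] in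
lemma pullback_comp (Ω : TwoForm E N) {X Y : Type*} [NormedAddCommGroup X] [NormedSpace ℂ X]
    [NormedAddCommGroup Y] [NormedSpace ℂ Y] {C : Y → N} {j : X → Y} {D : X →L[ℂ] Y} {x : X}
    (hC : MDifferentiableAt 𝓘(ℂ, Y) 𝓘(ℂ, E) C (j x)) (hj : HasFDerivAt j D x) (a b : X) :
    pullback Ω (C ∘ j) x a b = pullback Ω C (j x) (D a) (D b) := by
  rw [pullback_apply, pullback_apply, tderiv_comp x hC hj.differentiableAt.mdifferentiableAt,
    tderiv_eq_fderiv, hj.fderiv]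
  rfl

set_option maxSynthPendingDepth 3 in
/-- The exterior derivative of the 1-form of a family of arcs is the difference of the pullbacks of
the 2-form by the end points: this is where closedness of the 2-form enters. -/
lemma IsArcFamilyAt.arcForm_spec (hΩ : IsSymplecticForm Ω) (hC : IsArcFamilyAt E F U C y) :
    DifferentiableAt ℂ (arcForm Ω C) y ∧ ∀ a b : V,
      fderiv ℂ (arcForm Ω C) y a b - fderiv ℂ (arcForm Ω C) y b a =
        pullback Ω (fun z ↦ C (z, 1)) y a b - pullback Ω (fun z ↦ C (z, 0)) y a b := by
  have : CompleteSpace E := FiniteDimensional.complete ℂ E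
  have : CompleteSpace V := FiniteDimensional.complete ℂ V
  have hd := hasFDerivAt_integral_of_analyticAt (A := fun q ↦ mixedPart V (pullback Ω C q)) (y := y)
    fun t ht ↦ hC.analyticAt_mixedPart hΩ ht
  refine ⟨hd.differentiableAt, fun a b ↦ ?_⟩
  have hd' : HasFDerivAt (arcForm Ω C) _ y := hd
  have hcβ : ∀ t ∈ Icc (0 : ℝ) 1,
      ContinuousAt (fun t : ℝ ↦ fderiv ℂ (pullback Ω C) (y, (t : ℂ))) t := fun t ht ↦
    ContinuousAt.comp (f := fun t : ℝ ↦ (y, (t : ℂ))) (hC.analyticAt hΩ ht).fderiv.continuousAt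
      (continuous_prodMk_ofReal y).continuousAt
  have hfm : ∀ t ∈ Icc (0 : ℝ) 1, fderiv ℂ (fun q ↦ mixedPart V (pullback Ω C q)) (y, (t : ℂ)) =
      (mixedPart V).comp (fderiv ℂ (pullback Ω C) (y, (t : ℂ))) := fun t ht ↦ by
    have h1 : HasFDerivAt (mixedPart V) (mixedPart V) (pullback Ω C (y, (t : ℂ))) := by
      apply ContinuousLinearMap.hasFDerivAt
    exact (HasFDerivAt.comp (g := mixedPart V) _ h1
      (hC.analyticAt hΩ ht).differentiableAt.hasFDerivAt).fderiv
  have hint : IntervalIntegrable (fun t : ℝ ↦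
      (fderiv ℂ (fun q ↦ mixedPart V (pullback Ω C q)) (y, (t : ℂ))).comp
        (ContinuousLinearMap.inl ℂ V ℂ)) MeasureTheory.volume 0 1 := by
    refine ContinuousOn.intervalIntegrable fun t ht ↦ ?_
    rw [uIcc_of_le zero_le_one] at ht
    have h1 : ContinuousAt (fun t : ℝ ↦
        fderiv ℂ (fun q ↦ mixedPart V (pullback Ω C q)) (y, (t : ℂ))) t :=
      ContinuousAt.comp (f := fun t : ℝ ↦ (y, (t : ℂ)))
        (hC.analyticAt_mixedPart hΩ ht).fderiv.continuousAt
        (continuous_prodMk_ofReal y).continuousAt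
    exact (h1.clm_comp continuousAt_const).continuousWithinAt
  have hval : ∀ a b : V, fderiv ℂ (arcForm Ω C) y a b =
      ∫ t in (0 : ℝ)..1, fderiv ℂ (pullback Ω C) (y, (t : ℂ)) (a, 0) (0, 1) (b, 0) := fun a b ↦ by
    rw [hd'.fderiv, ContinuousLinearMap.intervalIntegral_apply hint,
      ContinuousLinearMap.intervalIntegral_apply]
    · refine intervalIntegral.integral_congr fun t ht ↦ ?_
      rw [uIcc_of_le zero_le_one] at ht
      rw [hfm t ht]
      rfl
    · exact ⟨hint.1.apply_continuousLinearMap a, hint.2.apply_continuousLinearMap a⟩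
  have hcc : ∀ u v w : V × ℂ, IntervalIntegrable
      (fun t : ℝ ↦ fderiv ℂ (pullback Ω C) (y, (t : ℂ)) u v w) MeasureTheory.volume 0 1 :=
    fun u v w ↦ by
    refine ContinuousOn.intervalIntegrable fun t ht ↦ ?_
    rw [uIcc_of_le zero_le_one] at ht
    exact ((((hcβ t ht).clm_apply continuousAt_const).clm_apply continuousAt_const).clm_apply
      continuousAt_const).continuousWithinAt
  have happ : ∀ t ∈ Icc (0 : ℝ) 1, ∀ u v w : V × ℂ,
      HasFDerivAt (fun q ↦ pullback Ω C q v w)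
        (((ContinuousLinearMap.apply ℂ ℂ w).comp
          (ContinuousLinearMap.apply ℂ ((V × ℂ) →L[ℂ] ℂ) v)).comp
          (fderiv ℂ (pullback Ω C) (y, (t : ℂ)))) (y, (t : ℂ)) := fun t ht u v w ↦ by
    have h1 := (((hC.analyticAt hΩ ht).differentiableAt.hasFDerivAt.clm_apply
      (hasFDerivAt_const v _)).clm_apply (hasFDerivAt_const w _))
    refine h1.congr_fderiv ?_
    refine ContinuousLinearMap.ext fun x ↦ ?_
    simp
  have hskew : ∀ t ∈ Icc (0 : ℝ) 1, ∀ u v w : V × ℂ,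
      fderiv ℂ (pullback Ω C) (y, (t : ℂ)) u v w = - fderiv ℂ (pullback Ω C) (y, (t : ℂ)) u w v :=
    fun t ht u v w ↦ by
    have h1 := (happ t ht u v w).unique ((happ t ht u w v).neg.congr_of_eventuallyEq
      (Filter.Eventually.of_forall fun q ↦ pullback_swap Ω C q v w))
    exact DFunLike.congr_fun h1 u
  rw [hval, hval, ← intervalIntegral.integral_sub (hcc _ _ _) (hcc _ _ _)]
  have hderiv : ∀ t ∈ uIcc (0 : ℝ) 1, HasDerivAt (fun t : ℝ ↦ pullback Ω C (y, (t : ℂ)) (a, 0) (b, 0))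
      (fderiv ℂ (pullback Ω C) (y, (t : ℂ)) (0, 1) (a, 0) (b, 0)) t := fun t ht ↦ by
    rw [uIcc_of_le zero_le_one] at ht
    have h1 := (happ t ht 0 (a, 0) (b, 0)).comp_hasDerivAt (t : ℂ)
      ((hasDerivAt_const (t : ℂ) y).prodMk (hasDerivAt_id (t : ℂ)))
    exact h1.comp_ofReal
  -- by closedness, the integrand of the exterior derivative is the derivative along the arc
  have hftc := intervalIntegral.integral_eq_sub_of_hasDerivAt hderiv (hcc _ _ _)
  have hends : ∀ t ∈ Icc (0 : ℝ) 1, pullback Ω (fun z ↦ C (z, (t : ℂ))) y a b =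
      pullback Ω C (y, (t : ℂ)) (a, 0) (b, 0) := fun t ht ↦
    pullback_comp Ω (C := C) (j := fun z ↦ (z, (t : ℂ)))
      ((hC t ht).self_of_nhds.1.mdifferentiableAt (by simp)) (hasFDerivAt_prodMk_left y (t : ℂ)) a b
  have h0 := hends 0 (by simp)
  have h1 := hends 1 (by simp)
  simp only [Complex.ofReal_zero, Complex.ofReal_one] at h0 h1 hftc
  rw [h0, h1, ← hftc]
  refine intervalIntegral.integral_congr fun t ht ↦ ?_
  rw [uIcc_of_le zero_le_one] at ht
  have h2 := hΩ.pullback_closed (hC t ht).self_of_nhds.1 (a, 0) (0, 1) (b, 0)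
  have h3 := hskew t ht (b, 0) (0, 1) (a, 0)
  rw [h3]
  linear_combination h2

end Arc

section ArcLift

variable {E : Type*} [NormedAddCommGroup E] [NormedSpace ℂ E] [FiniteDimensional ℂ E]
  {N : Type*} [TopologicalSpace N] [ChartedSpace E N] [T2Space N] [IsManifold 𝓘(ℂ, E) ω N]
  {V : Type*} [NormedAddCommGroup V] [NormedSpace ℂ V] [FiniteDimensional ℂ V]
  {Ω : TwoForm E N} {F : N → V} {U : Set N} {C : V × ℂ → N} {y : V}
  {m : ℕ} {Λ : Submodule ℤ (Fin m → ℂ)} {u : (Fin m → ℂ) → N}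
  {L : (Fin m → ℂ) →L[ℂ] V →L[ℂ] ℂ}

omit [T2Space N] [FiniteDimensional ℂ V] in
lemma IsArcFamilyAt.intervalIntegrable (hΩ : IsSymplecticForm Ω) (hC : IsArcFamilyAt E F U C y)
    {t t' : ℝ} (ht : t ∈ Icc (0 : ℝ) 1) (ht' : t' ∈ Icc (0 : ℝ) 1) :
    IntervalIntegrable (fun s : ℝ ↦ mixedPart V (pullback Ω C (y, (s : ℂ))))
      MeasureTheory.volume t t' :=
  ((hC.continuousOn_mixedPart hΩ).mono (uIcc_subset_Icc ht ht')).intervalIntegrable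

omit [T2Space N] in
/-- The integral of the 2-form along an arc in a torus fiber is read off from a lift of the arc to
the universal cover. -/
lemma IsArcFamilyAt.integral_eq_of_lift (h : IsIsotropicSubmersionOn Ω F U)
    (hΩ : IsSymplecticForm Ω) (hC : IsArcFamilyAt E F U C y)
    (hu : IsTorusUniformization E Λ u (U ∩ F ⁻¹' {y})) (hL : IsPeriodMap Ω F u L)
    {t t' : ℝ} (ht : t ∈ Icc (0 : ℝ) 1) (ht' : t' ∈ Icc (0 : ℝ) 1) {v : ℂ → Fin m → ℂ}
    (hv : ∀ s ∈ uIcc t t', ∀ᶠ z in 𝓝 (s : ℂ), DifferentiableAt ℂ v z ∧ u (v z) = C (y, z)) :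
    ∫ s in t..t', mixedPart V (pullback Ω C (y, (s : ℂ))) = L (v t' - v t) := by
  have : CompleteSpace V := FiniteDimensional.complete ℂ V
  rw [map_sub]
  refine intervalIntegral.integral_eq_sub_of_hasDerivAt (f := fun s : ℝ ↦ L (v (s : ℂ)))
    (fun s hs ↦ ?_) (hC.intervalIntegrable hΩ ht ht')
  obtain ⟨hd, hval⟩ := (hv s hs).self_of_nhds
  have h1 : HasDerivAt (fun z ↦ L (v z)) (L (deriv v (s : ℂ))) (s : ℂ) :=
    HasFDerivAt.comp_hasDerivAt (l := L) (s : ℂ) (by apply ContinuousLinearMap.hasFDerivAt)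
      hd.hasDerivAt
  have h1' : HasDerivAt (fun s : ℝ ↦ L (v (s : ℂ))) ((1 : ℂ) • L (deriv v (s : ℂ))) s :=
    HasDerivAt.scomp (g₁ := fun z ↦ L (v z)) (h := fun s : ℝ ↦ (s : ℂ)) s h1
      (Complex.ofRealCLM.hasDerivAt (x := s))
  refine h1'.congr_deriv ?_
  rw [one_smul]
  obtain ⟨hCs, hCU, hCF⟩ := (hC s (uIcc_subset_Icc ht ht' hs)).self_of_nhds
  have hCd := hCs.mdifferentiableAt (by simp : (ω : WithTop ℕ∞) ≠ 0)
  -- the velocity of the arc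
  have e1 : tderiv (V × ℂ) E C (y, (s : ℂ)) (0, 1) =
      tderiv (Fin m → ℂ) E u (v s) (deriv v (s : ℂ)) := by
    have d1 : HasFDerivAt (fun z : ℂ ↦ (y, z)) (ContinuousLinearMap.inr ℂ V ℂ) (s : ℂ) :=
      hasFDerivAt_prodMk_right y (s : ℂ)
    have d2 := tderiv_comp (g := C) (f := fun z : ℂ ↦ (y, z)) (s : ℂ) hCd
      d1.differentiableAt.mdifferentiableAt
    have d3 := tderiv_comp (g := u) (f := v) (s : ℂ) (hu.mdifferentiableAt _) hd.mdifferentiableAt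
    have d4 : u ∘ v =ᶠ[𝓝 (s : ℂ)] C ∘ (fun z : ℂ ↦ (y, z)) := (hv s hs).mono fun z hz ↦ hz.2
    rw [tderiv_congr d4, d2, tderiv_eq_fderiv, tderiv_eq_fderiv, d1.fderiv] at d3
    have d5 := DFunLike.congr_fun d3 1
    simpa using d5
  have e2 : ∀ w, tderiv E V F (C (y, (s : ℂ))) (tderiv (V × ℂ) E C (y, (s : ℂ)) (w, 0)) = w :=
    fun w ↦ by
    have d2 := tderiv_comp (g := F) (f := C) (y, (s : ℂ)) (h.mdifferentiableAt hCU) hCd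
    have d3 : F ∘ C =ᶠ[𝓝 (y, (s : ℂ))] Prod.fst :=
      (hC s (uIcc_subset_Icc ht ht' hs)).mono fun q hq ↦ hq.2.2
    rw [tderiv_congr d3, tderiv_eq_fderiv, fderiv_fst] at d2
    exact (DFunLike.congr_fun d2 (w, 0)).symm
  ext w
  have h2 := hL (v s) (deriv v (s : ℂ)) (tderiv (V × ℂ) E C (y, (s : ℂ)) (w, 0))
  rw [← e1, hval, e2] at h2
  rw [mixedPart_apply, pullback_apply, h2]

/-- Arcs in a torus fiber lift to its universal cover, and the 1-form of the family of arcs is given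
by the difference of the end points of the lift. -/
lemma IsArcFamilyAt.exists_lift (h : IsIsotropicSubmersionOn Ω F U)
    (hΩ : IsSymplecticForm Ω) (hC : IsArcFamilyAt E F U C y)
    (hu : IsTorusUniformization E Λ u (U ∩ F ⁻¹' {y})) (hL : IsPeriodMap Ω F u L)
    {v : Fin m → ℂ} (hv : u v = C (y, 0)) :
    ∃ v', u v' = C (y, 1) ∧ arcForm Ω C y = L (v' - v) := by
  -- local lifts exist, and those on adjacent intervals match up to translation by a lattice vector
  let P : ℝ → ℝ → Prop := fun t t' ↦ ∃ v v' : Fin m → ℂ, u v = C (y, (t : ℂ)) ∧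
    u v' = C (y, (t' : ℂ)) ∧ ∫ s in t..t', mixedPart V (pullback Ω C (y, (s : ℂ))) = L (v' - v)
  have hP : P 0 1 := by
    refine isPreconnected_Icc.induction₂ (s := Icc (0 : ℝ) 1) P (fun t ht ↦ ?_) ?_ ?_
      (by simp) (by simp)
    · have hmem : C (y, (t : ℂ)) ∈ U ∩ F ⁻¹' {y} := (hC t ht).self_of_nhds.2
      rw [← hu.range_eq] at hmem
      obtain ⟨v₀, hv₀⟩ := hmem
      have hc : ∀ᶠ z in 𝓝 (t : ℂ), MDifferentiableAt 𝓘(ℂ, ℂ) 𝓘(ℂ, E) (fun z ↦ C (y, z)) z ∧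
          F (C (y, z)) = y := by
        have c1 : ContinuousAt (fun z : ℂ ↦ (y, z)) (t : ℂ) :=
          (continuous_const.prodMk continuous_id).continuousAt
        filter_upwards [c1.eventually (hC t ht)] with z hz
        exact ⟨(hz.1.mdifferentiableAt (by simp)).comp z
          (hasFDerivAt_prodMk_right y z).differentiableAt.mdifferentiableAt, hz.2.2⟩
      obtain ⟨v, hv0, hv⟩ := hu.exists_local_lift h hc hv₀
      have hv' : ∀ᶠ s : ℝ in 𝓝 t, ∀ᶠ z in 𝓝 (s : ℂ), DifferentiableAt ℂ v z ∧ u (v z) = C (y, z) :=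
        Complex.continuous_ofReal.continuousAt.eventually hv.eventually_nhds
      obtain ⟨ε, hε, hball⟩ := Metric.eventually_nhds_iff_ball.1 hv'
      filter_upwards [self_mem_nhdsWithin, nhdsWithin_le_nhds (Metric.ball_mem_nhds t hε)]
        with t' ht' hball'
      have hsub : uIcc t t' ⊆ Metric.ball t ε := by
        rw [Real.ball_eq_Ioo] at hball' ⊢
        exact ordConnected_Ioo.uIcc_subset (mem_Ioo.2 ⟨by linarith, by linarith⟩) hball'
      refine ⟨v t, v t', (hv.self_of_nhds).2, (hball t' hball').self_of_nhds.2, ?_⟩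
      exact hC.integral_eq_of_lift h hΩ hu hL ht ht' fun s hs ↦ hball s (hsub hs)
    · rintro a b c ha hb hc ⟨v, v', hv, hv', hi⟩ ⟨w, w', hw, hw', hi'⟩
      have hl : w - v' ∈ Λ := (hu.eq_iff _ _).1 (by rw [hw, hv'])
      refine ⟨v + (w - v'), w', by rw [hu.apply_add hl, hv], hw', ?_⟩
      rw [← intervalIntegral.integral_add_adjacent_intervals (hC.intervalIntegrable hΩ ha hb)
        (hC.intervalIntegrable hΩ hb hc), hi, hi', ← map_add]
      congr 1; abel
    · rintro a b ha hb ⟨v, v', hv, hv', hi⟩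
      refine ⟨v', v, hv', hv, ?_⟩
      rw [intervalIntegral.integral_symm, hi, ← map_neg, neg_sub]
  obtain ⟨w, w', hw, hw', hi⟩ := hP
  rw [Complex.ofReal_zero] at hw
  rw [Complex.ofReal_one] at hw'
  have hl : v - w ∈ Λ := (hu.eq_iff _ _).1 (by rw [hv, hw])
  refine ⟨w' + (v - w), by rw [hu.apply_add hl, hw'], ?_⟩
  rw [arcForm, hi]
  congr 1; abel

end ArcLift

/-! ### Forms that compare two sections -/

section Transport

variable {E : Type*} [NormedAddCommGroup E] [NormedSpace ℂ E] [FiniteDimensional ℂ E]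
  {N : Type*} [TopologicalSpace N] [ChartedSpace E N] [T2Space N] [IsManifold 𝓘(ℂ, E) ω N]
  {V : Type*} [NormedAddCommGroup V] [NormedSpace ℂ V] [FiniteDimensional ℂ V]
  {Ω : TwoForm E N} {F : N → V} {U : Set N} {y : V}

variable (E) in
/-- `s` is a holomorphic section of `F` near `y`. -/
def IsLocalSection (F : N → V) (U : Set N) (y : V) (s : V → N) : Prop :=
  ∀ᶠ z in 𝓝 y, ContMDiffAt 𝓘(ℂ, V) 𝓘(ℂ, E) ω s z ∧ s z ∈ U ∧ F (s z) = z

/-- The 1-form `θ` measures, at the base point `y`, the difference of two sections `s` and `s'`: its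
exterior derivative is the difference of the pullbacks of the 2-form, and if the fiber over `y` is a
torus, then its value corresponds to a difference of lifts of `s y` and `s' y` to the universal
cover. -/
structure IsTransport (Ω : TwoForm E N) (F : N → V) (U : Set N) (s s' : V → N)
    (θ : V → V →L[ℂ] ℂ) (y : V) : Prop where
  differentiableAt : DifferentiableAt ℂ θ y
  fderiv_sub : ∀ a b, fderiv ℂ θ y a b - fderiv ℂ θ y b a =
    pullback Ω s' y a b - pullback Ω s y a b
  exists_lift : ∀ (m : ℕ) (Λ : Submodule ℤ (Fin m → ℂ)) (u : (Fin m → ℂ) → N),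
    IsTorusUniformization E Λ u (U ∩ F ⁻¹' {y}) → ∀ L, IsPeriodMap Ω F u L →
      ∀ v, u v = s y → ∃ v', u v' = s' y ∧ θ y = L (v' - v)

omit [FiniteDimensional ℂ E] [T2Space N] [IsManifold 𝓘(ℂ, E) ω N] [FiniteDimensional ℂ V] in
lemma IsTransport.trans {s s' s'' : V → N} {θ θ' : V → V →L[ℂ] ℂ}
    (h : IsTransport Ω F U s s' θ y) (h' : IsTransport Ω F U s' s'' θ' y) :
    IsTransport Ω F U s s'' (fun z ↦ θ z + θ' z) y where
  differentiableAt := h.differentiableAt.add h'.differentiableAt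
  fderiv_sub a b := by
    rw [fderiv_fun_add h.differentiableAt h'.differentiableAt]
    have h1 := h.fderiv_sub a b
    have h2 := h'.fderiv_sub a b
    simp only [add_apply]
    linear_combination h1 + h2
  exists_lift m Λ u hu L hL v hv := by
    obtain ⟨v', hv', e⟩ := h.exists_lift m Λ u hu L hL v hv
    obtain ⟨v'', hv'', e'⟩ := h'.exists_lift m Λ u hu L hL v' hv'
    refine ⟨v'', hv'', ?_⟩
    rw [e, e', ← map_add]
    congr 1; abel

omit [FiniteDimensional ℂ E] [T2Space N] [IsManifold 𝓘(ℂ, E) ω N] [FiniteDimensional ℂ V] in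
lemma IsTransport.symm {s s' : V → N} {θ : V → V →L[ℂ] ℂ}
    (h : IsTransport Ω F U s s' θ y) (hs : s y ∈ U ∩ F ⁻¹' {y}) :
    IsTransport Ω F U s' s (fun z ↦ - θ z) y where
  differentiableAt := h.differentiableAt.neg
  fderiv_sub a b := by
    rw [fderiv_fun_neg]
    have h1 := h.fderiv_sub a b
    simp only [neg_apply]
    linear_combination -h1
  exists_lift m Λ u hu L hL v hv := by
    rw [← hu.range_eq] at hs
    obtain ⟨w, hw⟩ := hs
    obtain ⟨w', hw', e⟩ := h.exists_lift m Λ u hu L hL w hw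
    have hl : v - w' ∈ Λ := (hu.eq_iff _ _).1 (by rw [hv, hw'])
    refine ⟨w + (v - w'), by rw [hu.apply_add hl, hw], ?_⟩
    rw [e, ← map_neg]
    congr 1; abel

lemma IsArcFamilyAt.isTransport (h : IsIsotropicSubmersionOn Ω F U) (hΩ : IsSymplecticForm Ω)
    {C : V × ℂ → N} (hC : IsArcFamilyAt E F U C y) {s s' : V → N}
    (hs : ∀ᶠ z in 𝓝 y, C (z, 0) = s z) (hs' : ∀ᶠ z in 𝓝 y, C (z, 1) = s' z) :
    IsTransport Ω F U s s' (arcForm Ω C) y where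
  differentiableAt := (hC.arcForm_spec hΩ).1
  fderiv_sub a b := by
    rw [(hC.arcForm_spec hΩ).2]
    simp only [pullback]
    rw [tderiv_congr hs, tderiv_congr hs', hs.self_of_nhds, hs'.self_of_nhds]
  exists_lift m Λ u hu L hL v hv := by
    rw [← hs'.self_of_nhds]
    exact hC.exists_lift h hΩ hu hL (by rw [hv, hs.self_of_nhds])

omit [T2Space N] in
/-- Through every point there is a local holomorphic section of `F`. -/
lemma IsIsotropicSubmersionOn.exists_isLocalSection (h : IsIsotropicSubmersionOn Ω F U) {p : N}
    (hp : p ∈ U) : ∃ s, IsLocalSection E F U (F p) s ∧ s (F p) = p := by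
  obtain ⟨Z, Ψ, hΨ, hsrc, hsub, hfst⟩ := h.exists_adapted_chart hp
  have hFp : (F p, (Ψ p).2) = Ψ p := Prod.ext (hfst p hsrc).symm rfl
  refine ⟨fun z ↦ Ψ.symm (z, (Ψ p).2), ?_, by simp only [hFp, Ψ.left_inv hsrc]⟩
  have hc : ContinuousAt (fun z : V ↦ (z, (Ψ p).2)) (F p) :=
    (continuous_id.prodMk continuous_const).continuousAt
  have hev : ∀ᶠ z in 𝓝 (F p), (z, (Ψ p).2) ∈ Ψ.target :=
    hc.eventually (Ψ.open_target.mem_nhds (by simp only [hFp]; exact Ψ.map_source hsrc))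
  filter_upwards [hev] with z hz
  refine ⟨?_, hsub (Ψ.map_target hz), apply_symm_of_adapted hfst hz⟩
  refine ContMDiffAt.comp (g := Ψ.symm) z (hΨ.contMDiffAt_symm hz) ?_
  exact (contDiffAt_id.prodMk contDiffAt_const).contMDiffAt

variable {m : ℕ} {Λ : Submodule ℤ (Fin m → ℂ)} {u : (Fin m → ℂ) → N}
  {L : (Fin m → ℂ) →L[ℂ] V →L[ℂ] ℂ}

/-- Two points `w`, `w'` of the universal cover of a torus fiber are related if `L (w' - w)`
extends, for all local sections through `u w` and `u w'`, to a 1-form measuring the difference of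
these sections. -/
def PeriodRel (Ω : TwoForm E N) (F : N → V) (U : Set N) (y : V) (u : (Fin m → ℂ) → N)
    (L : (Fin m → ℂ) →L[ℂ] V →L[ℂ] ℂ) (w w' : Fin m → ℂ) : Prop :=
  ∀ s s', IsLocalSection E F U y s → IsLocalSection E F U y s' → s y = u w → s' y = u w' →
    ∃ θ, (∀ᶠ z in 𝓝 y, IsTransport Ω F U s s' θ z) ∧ θ y = L (w' - w)

/-- In an adapted chart, two sections through nearby points are joined by straight segments of the
slices, which form a family of arcs. -/
lemma eventually_periodRel (h : IsIsotropicSubmersionOn Ω F U) (hΩ : IsSymplecticForm Ω)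
    (hu : IsTorusUniformization E Λ u (U ∩ F ⁻¹' {y})) (hL : IsPeriodMap Ω F u L)
    (w : Fin m → ℂ) : ∀ᶠ w' in 𝓝 w, PeriodRel Ω F U y u L w w' := by
  have : CompleteSpace V := FiniteDimensional.complete ℂ V
  obtain ⟨Z, Ψ, hΨ, hsrc, hsub, hfst⟩ := h.exists_adapted_chart (hu.mem w).1
  have : CompleteSpace Z := FiniteDimensional.complete ℂ Z
  obtain ⟨ζ, hζ₀, hζ⟩ := hu.exists_slice_lift h hΨ hsub hfst hsrc
  have hΨu : ∀ v, u v ∈ Ψ.source → Ψ (u v) = (y, (Ψ (u v)).2) := fun v hv ↦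
    Prod.ext (by rw [hfst _ hv, (hu.mem v).2]) rfl
  set z₀ := (Ψ (u w)).2 with hz₀
  have htar : (y, z₀) ∈ Ψ.target := by rw [← hΨu w hsrc]; exact Ψ.map_source hsrc
  -- a ball in which the arcs are straight segments of the slice
  have hgood : ∀ᶠ z in 𝓝 z₀, (∀ᶠ z' in 𝓝 z, DifferentiableAt ℂ ζ z' ∧ u (ζ z') = Ψ.symm (y, z')) ∧
      (y, z) ∈ Ψ.target := by
    refine hζ.eventually_nhds.and ?_
    have hc : ContinuousAt (fun z : Z ↦ (y, z)) z₀ :=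
      (continuous_const.prodMk continuous_id).continuousAt
    exact hc.eventually (Ψ.open_target.mem_nhds htar)
  obtain ⟨ε, hε, hball⟩ := Metric.eventually_nhds_iff_ball.1 hgood
  have hcu : ContinuousAt (fun v ↦ (Ψ (u v)).2) w :=
    continuousAt_snd.comp ((Ψ.continuousAt hsrc).comp hu.holomorphic.continuous.continuousAt)
  filter_upwards [hu.holomorphic.continuous.continuousAt.eventually (Ψ.open_source.mem_nhds hsrc),
    hcu.eventually (Metric.ball_mem_nhds z₀ hε), hζ₀] with w' hw' hz' hζw' s s' hs hs' hsy hsy'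
  set z₁ := (Ψ (u w')).2 with hz₁
  have hzs : ∀ {σ : V → N} {x : Fin m → ℂ}, IsLocalSection E F U y σ → σ y = u x →
      u x ∈ Ψ.source → ∀ᶠ z in 𝓝 y, σ z ∈ Ψ.source ∧ AnalyticAt ℂ (fun z ↦ (Ψ (σ z)).2) z ∧
        Ψ.symm (z, (Ψ (σ z)).2) = σ z := fun {σ x} hσ hσy hx ↦ by
    have h1 : ∀ᶠ z in 𝓝 y, σ z ∈ Ψ.source := hσ.self_of_nhds.1.continuousAt.eventually
      (Ψ.open_source.mem_nhds (by rwa [hσy]))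
    filter_upwards [hσ, h1] with z hz hz'
    refine ⟨hz', ?_, ?_⟩
    · have h2 : AnalyticAt ℂ (Ψ ∘ σ) z := ((hΨ.contMDiffAt hz').comp z hz.1).contDiffAt.analyticAt
      exact analyticAt_snd.fun_comp h2
    · have h2 : (z, (Ψ (σ z)).2) = Ψ (σ z) := Prod.ext (by rw [hfst _ hz', hz.2.2]) rfl
      rw [h2, Ψ.left_inv hz']
  have hs1 := hzs hs hsy hsrc
  have hs1' := hzs hs' hsy' hw'
  let κ : V × ℂ → V × Z := fun q ↦
    (q.1, (Ψ (s q.1)).2 + q.2 • ((Ψ (s' q.1)).2 - (Ψ (s q.1)).2))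
  have hκan : ∀ z, AnalyticAt ℂ (fun z ↦ (Ψ (s z)).2) z → AnalyticAt ℂ (fun z ↦ (Ψ (s' z)).2) z →
      ∀ t : ℂ, AnalyticAt ℂ κ (z, t) := fun z h1 h2 t ↦ by
    have h3 : AnalyticAt ℂ (fun q : V × ℂ ↦ (Ψ (s q.1)).2) (z, t) :=
      AnalyticAt.fun_comp (f := Prod.fst) (g := fun z ↦ (Ψ (s z)).2) h1 analyticAt_fst
    have h4 : AnalyticAt ℂ (fun q : V × ℂ ↦ (Ψ (s' q.1)).2) (z, t) :=
      AnalyticAt.fun_comp (f := Prod.fst) (g := fun z ↦ (Ψ (s' z)).2) h2 analyticAt_fst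
    exact analyticAt_fst.prod (h3.fun_add (analyticAt_snd.fun_smul (h4.fun_sub h3)))
  have hκy : ∀ t : ℂ, κ (y, t) = (y, z₀ + t • (z₁ - z₀)) := fun t ↦ by
    simp only [κ, hsy, hsy', hz₀, hz₁]
  have hseg : ∀ t ∈ Icc (0 : ℝ) 1, z₀ + (t : ℂ) • (z₁ - z₀) ∈ Metric.ball z₀ ε := fun t ht ↦ by
    replace hz' : ‖z₁ - z₀‖ < ε := mem_ball_iff_norm.1 hz'
    rw [mem_ball_iff_norm]
    rw [add_sub_cancel_left, norm_smul, Complex.norm_real, Real.norm_eq_abs, abs_of_nonneg ht.1]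
    exact (mul_le_of_le_one_left (norm_nonneg _) ht.2).trans_lt hz'
  have hC : IsArcFamilyAt E F U (Ψ.symm ∘ κ) y := fun t ht ↦ by
    have h1 : κ (y, (t : ℂ)) ∈ Ψ.target := by rw [hκy]; exact (hball _ (hseg t ht)).2
    have h2 := (hκan y hs1.self_of_nhds.2.1 hs1'.self_of_nhds.2.1 (t : ℂ)).eventually_analyticAt
    have h3 := h2.self_of_nhds.continuousAt.eventually (Ψ.open_target.mem_nhds h1)
    filter_upwards [h2, h3] with q hq hq'
    exact ⟨(hΨ.contMDiffAt_symm hq').comp q hq.contDiffAt.contMDiffAt, hsub (Ψ.map_target hq'),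
      apply_symm_of_adapted hfst hq'⟩
  refine ⟨arcForm Ω (Ψ.symm ∘ κ), ?_, ?_⟩
  · filter_upwards [hC.eventually, hs1.eventually_nhds, hs1'.eventually_nhds] with z hz hz1 hz1'
    refine hz.isTransport h hΩ (hz1.mono fun x hx ↦ ?_) (hz1'.mono fun x hx ↦ ?_)
    · simp [κ, hx.2.2]
    · simp [κ, hx.2.2]
  · have h1 := hC.integral_eq_of_lift h hΩ hu hL (t := 0) (t' := 1) (by simp) (by simp)
      (v := fun t ↦ ζ (z₀ + t • (z₁ - z₀))) fun t ht ↦ by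
        rw [uIcc_of_le zero_le_one] at ht
        have hc : ContinuousAt (fun t : ℂ ↦ z₀ + t • (z₁ - z₀)) (t : ℂ) := by fun_prop
        filter_upwards [hc.eventually (hball _ (hseg t ht)).1] with τ hτ
        refine ⟨hτ.1.comp τ (by fun_prop), ?_⟩
        rw [hτ.2, Function.comp_apply, hκy]
    rw [arcForm, h1]
    have e0 : ζ z₀ = w := hζ₀.self_of_nhds
    simp [e0, hζw']

/-- Nearby points are related, the relation is symmetric and transitive, and `ℂ^m` is connected. -/
lemma periodRel (h : IsIsotropicSubmersionOn Ω F U) (hΩ : IsSymplecticForm Ω)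
    (hu : IsTorusUniformization E Λ u (U ∩ F ⁻¹' {y})) (hL : IsPeriodMap Ω F u L)
    (w w' : Fin m → ℂ) : PeriodRel Ω F U y u L w w' := by
  refine isPreconnected_univ.induction₂ (PeriodRel Ω F U y u L) (fun x _ ↦ ?_) ?_ ?_
    (mem_univ w) (mem_univ w')
  · rw [nhdsWithin_univ]; exact eventually_periodRel h hΩ hu hL x
  · intro a b c _ _ _ hab hbc s s'' hs hs'' hsy hsy''
    obtain ⟨s', hs', hsy'⟩ := h.exists_isLocalSection (hu.mem b).1
    rw [(hu.mem b).2] at hs' hsy'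
    obtain ⟨θ, hθ, e⟩ := hab s s' hs hs' hsy hsy'
    obtain ⟨θ', hθ', e'⟩ := hbc s' s'' hs' hs'' hsy' hsy''
    refine ⟨fun z ↦ θ z + θ' z, (hθ.and hθ').mono fun z hz ↦ hz.1.trans hz.2, ?_⟩
    simp only
    rw [e, e', ← map_add]
    congr 1; abel
  · intro a b _ _ hab s s' hs hs' hsy hsy'
    obtain ⟨θ, hθ, e⟩ := hab s' s hs' hs hsy' hsy
    refine ⟨fun z ↦ - θ z, (hθ.and hs').mono fun z hz ↦ hz.1.symm hz.2.2, ?_⟩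
    simp only
    rw [e, ← map_neg, neg_sub]

/-- Every period of a torus fiber extends to a holomorphic closed 1-form on the base, near the given
point, whose values are periods of the neighbouring torus fibers. -/
lemma exists_period_form (h : IsIsotropicSubmersionOn Ω F U) (hΩ : IsSymplecticForm Ω)
    (hu : IsTorusUniformization E Λ u (U ∩ F ⁻¹' {y})) (hL : IsPeriodMap Ω F u L)
    {l : Fin m → ℂ} (hl : l ∈ Λ) :
    ∃ θ : V → V →L[ℂ] ℂ, θ y = L l ∧ ∀ᶠ z in 𝓝 y, DifferentiableAt ℂ θ z ∧
      (∀ a b, fderiv ℂ θ z a b = fderiv ℂ θ z b a) ∧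
      ∀ (m' : ℕ) (Λ' : Submodule ℤ (Fin m' → ℂ)) (u' : (Fin m' → ℂ) → N),
        IsTorusUniformization E Λ' u' (U ∩ F ⁻¹' {z}) → ∀ L', IsPeriodMap Ω F u' L' →
          ∃ l' ∈ Λ', θ z = L' l' := by
  obtain ⟨s, hs, hsy⟩ := h.exists_isLocalSection (hu.mem 0).1
  rw [(hu.mem 0).2] at hs hsy
  have hsl : s y = u l := by rw [hsy]; simpa using (hu.apply_add hl 0).symm
  obtain ⟨θ, hθ, e⟩ := periodRel h hΩ hu hL 0 l s s hs hs hsy hsl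
  refine ⟨θ, by rw [e, sub_zero], ?_⟩
  filter_upwards [hθ, hs] with z hz hsz
  refine ⟨hz.differentiableAt, fun a b ↦ ?_, fun m' Λ' u' hu' L' hL' ↦ ?_⟩
  · have := hz.fderiv_sub a b
    rwa [sub_self, sub_eq_zero] at this
  · have hmem : s z ∈ U ∩ F ⁻¹' {z} := hsz.2
    rw [← hu'.range_eq] at hmem
    obtain ⟨v, hv⟩ := hmem
    obtain ⟨v', hv', e'⟩ := hz.exists_lift m' Λ' u' hu' L' hL' v hv
    exact ⟨v' - v, (hu'.eq_iff _ _).1 (by rw [hv, hv']), e'⟩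

end Transport

/-! ### Foliations defined by closed forms -/

section VectorSpace

variable {E : Type*} [NormedAddCommGroup E] [NormedSpace ℂ E]
  {V : Type*} [NormedAddCommGroup V] [NormedSpace ℂ V]
  {X : Type*} [NormedAddCommGroup X] [NormedSpace ℂ X]

/-- If the zero sets of countably many analytic maps cover a ball, then one of these maps vanishes
on the whole ball: by Baire's theorem one of the zero sets has an interior point. -/
lemma exists_forall_eq_zero_of_countable [CompleteSpace E] {ι : Type*} [Countable ι]
    {Φ : ι → E → X} {e₀ : E} {ε : ℝ} (hε : 0 < ε)
    (hΦ : ∀ s, ∀ e ∈ Metric.ball e₀ ε, AnalyticAt ℂ (Φ s) e)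
    (hcover : ∀ e ∈ Metric.ball e₀ ε, ∃ s, Φ s e = 0) :
    ∃ s, ∀ e ∈ Metric.ball e₀ ε, Φ s e = 0 := by
  have hK : Metric.closedBall e₀ (ε / 2) ⊆ Metric.ball e₀ ε :=
    Metric.closedBall_subset_ball (by linarith)
  let c : Option ι → Set E := fun o ↦ o.elim (Metric.ball e₀ (ε / 2))ᶜ
    fun s ↦ Metric.closedBall e₀ (ε / 2) ∩ Φ s ⁻¹' {0}
  have hc : ∀ o, IsClosed (c o) := by
    rintro (_ | s)
    · exact Metric.isOpen_ball.isClosed_compl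
    · refine ContinuousOn.preimage_isClosed_of_isClosed (fun e he ↦ ?_) Metric.isClosed_closedBall
        isClosed_singleton
      exact (hΦ s e (hK he)).continuousAt.continuousWithinAt
  have hU : ⋃ o, c o = univ := by
    refine eq_univ_of_forall fun e ↦ ?_
    by_cases he : e ∈ Metric.ball e₀ (ε / 2)
    · have he' := Metric.ball_subset_closedBall he
      obtain ⟨s, hs⟩ := hcover e (hK he')
      exact mem_iUnion.2 ⟨some s, he', hs⟩
    · exact mem_iUnion.2 ⟨none, he⟩
  obtain ⟨z, hz, hz'⟩ := (dense_iUnion_interior_of_closed hc hU).inter_open_nonempty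
    (Metric.ball e₀ (ε / 2)) Metric.isOpen_ball ⟨e₀, Metric.mem_ball_self (by linarith)⟩
  obtain ⟨_ | s, ho⟩ := mem_iUnion.1 hz'
  · exact absurd hz (interior_subset ho)
  refine ⟨s, fun e he ↦ ?_⟩
  have h1 : Φ s =ᶠ[𝓝 z] 0 := by
    filter_upwards [mem_interior_iff_mem_nhds.1 ho] with x hx using hx.2
  exact AnalyticOnNhd.eqOn_zero_of_preconnected_of_eventuallyEq_zero (fun e he ↦ hΦ s e he)
    (convex_ball e₀ ε).isPreconnected (hK (Metric.ball_subset_closedBall hz)) h1 he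

/-- The holomorphic Poincaré lemma for 1-forms. -/
lemma exists_primitive [FiniteDimensional ℂ V] {θ : V → V →L[ℂ] ℂ} {y : V}
    (h : ∀ᶠ z in 𝓝 y, DifferentiableAt ℂ θ z ∧ ∀ a b, fderiv ℂ θ z a b = fderiv ℂ θ z b a) :
    ∃ η : V → ℂ, ∀ᶠ z in 𝓝 y, AnalyticAt ℂ η z ∧ fderiv ℂ η z = θ z := by
  obtain ⟨ε, hε, hball⟩ := Metric.eventually_nhds_iff_ball.1 h
  have hR : ∀ z ∈ Metric.ball y ε, HasFDerivAt (fun z ↦ (θ z).restrictScalars ℝ)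
      ((ContinuousLinearMap.restrictScalarsL ℂ V ℂ ℝ ℝ).comp
        ((fderiv ℂ θ z).restrictScalars ℝ)) z := fun z hz ↦
    ((ContinuousLinearMap.restrictScalarsL ℂ V ℂ ℝ ℝ).hasFDerivAt).comp z
      ((hball z hz).1.hasFDerivAt.restrictScalars ℝ)
  obtain ⟨η, hη⟩ := (convex_ball y ε).exists_forall_hasFDerivAt_of_fderiv_symmetric
    Metric.isOpen_ball
    (fun z hz ↦ (hR z hz).differentiableAt.differentiableWithinAt) fun z hz a b ↦ by
      rw [(hR z hz).fderiv]; exact (hball z hz).2 a b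
  have hC : ∀ z ∈ Metric.ball y ε, HasFDerivAt η (θ z) z := fun z hz ↦
    hasFDerivAt_of_restrictScalars ℝ (hη z hz) rfl
  refine ⟨η, ?_⟩
  filter_upwards [Metric.isOpen_ball.mem_nhds (Metric.mem_ball_self hε)] with z hz
  refine ⟨analyticAt_of_contDiffAt_one ?_, (hC z hz).fderiv⟩
  refine contDiffAt_one_iff.2 ⟨θ, _, Metric.isOpen_ball.mem_nhds hz, fun x hx ↦ ?_, hC⟩
  exact (hball x hx).1.continuousAt.continuousWithinAt

lemma le_finrank_span_of_linearIndependent_real {M : Type*} [AddCommGroup M] [Module ℂ M]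
    [FiniteDimensional ℂ M] {d : ℕ} {v : Fin (2 * d) → M} (hv : LinearIndependent ℝ v) :
    d ≤ Module.finrank ℂ (Submodule.span ℂ (range v)) := by
  have h1 : LinearIndependent ℝ fun j ↦
      (⟨v j, Submodule.subset_span (mem_range_self j)⟩ : Submodule.span ℂ (range v)) :=
    LinearIndependent.of_comp ((Submodule.span ℂ (range v)).subtype.restrictScalars ℝ) hv
  have h2 := h1.fintype_card_le_finrank
  rw [← Module.finrank_mul_finrank ℝ ℂ, Complex.finrank_real_complex, Fintype.card_fin] at h2
  omega

lemma surjective_of_linearIndependent {k : ℕ} {A : E →L[ℂ] Fin k → ℂ} {a : Fin k → E →L[ℂ] ℂ}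
    (hA : ∀ v l, A v l = a l v) (ha : LinearIndependent ℂ a) : Function.Surjective A := by
  change Function.Surjective A.toLinearMap
  rw [← LinearMap.range_eq_top]
  by_contra hne
  obtain ⟨φ, hφ, hker⟩ := Submodule.exists_le_ker_of_lt_top _ (lt_top_iff_ne_top.2 hne)
  refine hφ (LinearMap.pi_ext' fun l ↦ LinearMap.ext_ring ?_)
  refine Fintype.linearIndependent_iff.1 ha (fun l ↦ φ (Pi.single l 1)) ?_ l
  ext v
  have h1 : φ (A v) = 0 := hker ⟨v, rfl⟩
  rw [← LinearMap.sum_single_apply _ (A v), map_sum] at h1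
  simp only [FunLike.coe_sum, Finset.sum_apply, FunLike.coe_smul, Pi.smul_apply, zero_apply]
  rw [← h1]
  refine Finset.sum_congr rfl fun l _ ↦ ?_
  rw [← hA]
  have h2 : (Pi.single l (A v l) : Fin k → ℂ) = A v l • Pi.single l 1 := by
    rw [← Pi.single_smul]; simp
  simp [h2, mul_comm]

end VectorSpace

section Foliation

variable {E : Type*} [NormedAddCommGroup E] [NormedSpace ℂ E] [FiniteDimensional ℂ E]
  {V : Type*} [NormedAddCommGroup V] [NormedSpace ℂ V] [FiniteDimensional ℂ V]
  {V' : Type*} [NormedAddCommGroup V'] [NormedSpace ℂ V'] [FiniteDimensional ℂ V']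

/-- Let `θ i` be closed 1-forms on the base of a submersion `F`, linearly independent over `ℝ`.
Suppose that at every point the annihilator of `ker dF + ker dG` has constant dimension `d` and
contains `2 * d` integral combinations of the pulled back forms, linearly independent over `ℝ`,
where the coefficients may depend on the point. Then these coefficients can be chosen locally
constant, and `ker dF + ker dG` is the kernel of the differential of a submersion. -/
lemma exists_submersion_ker_eq {ι : Type*} [Fintype ι] {F : E → V} {G : E → V'} {e₀ : E}
    (hF : AnalyticAt ℂ F e₀) (hFs : Function.Surjective (fderiv ℂ F e₀))
    (hG : AnalyticAt ℂ G e₀) (hGs : Function.Surjective (fderiv ℂ G e₀))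
    {θ : ι → V → V →L[ℂ] ℂ}
    (hθ : ∀ i, ∀ᶠ z in 𝓝 (F e₀), DifferentiableAt ℂ (θ i) z ∧
      ∀ a b, fderiv ℂ (θ i) z a b = fderiv ℂ (θ i) z b a)
    (hind : LinearIndependent ℝ fun i ↦ θ i (F e₀)) {d : ℕ}
    (hrank : ∀ᶠ e in 𝓝 e₀, Module.finrank ℂ
      ((fderiv ℂ F e).toLinearMap.ker ⊔ (fderiv ℂ G e).toLinearMap.ker :
        Submodule ℂ E) + d = Module.finrank ℂ E)
    (hS : ∀ᶠ e in 𝓝 e₀, ∃ S : Fin (2 * d) → ι → ℤ,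
      LinearIndependent ℝ (fun j i ↦ (S j i : ℝ)) ∧
      ∀ j, ∀ v ∈ (fderiv ℂ F e).toLinearMap.ker ⊔ (fderiv ℂ G e).toLinearMap.ker,
        ∑ i, (S j i : ℂ) * θ i (F e) (fderiv ℂ F e v) = 0) :
    ∃ (k : ℕ) (g : E → Fin k → ℂ), ∀ᶠ e in 𝓝 e₀, AnalyticAt ℂ g e ∧
      Function.Surjective (fderiv ℂ g e) ∧ (fderiv ℂ g e).toLinearMap.ker =
        (fderiv ℂ F e).toLinearMap.ker ⊔ (fderiv ℂ G e).toLinearMap.ker := by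
  have : CompleteSpace E := FiniteDimensional.complete ℂ E
  have : CompleteSpace V := FiniteDimensional.complete ℂ V
  have : CompleteSpace V' := FiniteDimensional.complete ℂ V'
  choose η hη using fun i ↦ exists_primitive (hθ i)
  -- the pulled back forms are the differentials of the functions `η i ∘ F`
  have hηF : ∀ᶠ e in 𝓝 e₀, ∀ i, AnalyticAt ℂ (η i ∘ F) e ∧
      fderiv ℂ (η i ∘ F) e = (θ i (F e)).comp (fderiv ℂ F e) := by
    refine Filter.eventually_all.2 fun i ↦ ?_
    filter_upwards [hF.eventually_analyticAt, hF.continuousAt.eventually (hη i)] with e he he'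
    refine ⟨he'.1.comp he, ?_⟩
    rw [← he'.2]
    exact fderiv_comp e he'.1.differentiableAt he.differentiableAt
  let ρ : (Fin (2 * d) → ι → ℤ) → Fin (2 * d) → E → ℂ := fun S j e ↦ ∑ i, (S j i : ℂ) * η i (F e)
  have hρ : ∀ᶠ e in 𝓝 e₀, ∀ S j, AnalyticAt ℂ (ρ S j) e ∧
      ∀ v, fderiv ℂ (ρ S j) e v = ∑ i, (S j i : ℂ) * θ i (F e) (fderiv ℂ F e v) := by
    filter_upwards [hηF] with e he S j
    have h1 : ∀ i ∈ Finset.univ, HasFDerivAt (fun e ↦ (S j i : ℂ) * η i (F e))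
        ((S j i : ℂ) • (θ i (F e)).comp (fderiv ℂ F e)) e := fun i _ ↦ by
      have := (he i).1.differentiableAt.hasFDerivAt
      rw [(he i).2] at this
      exact this.const_mul _
    refine ⟨Finset.analyticAt_fun_sum _ fun i _ ↦ analyticAt_const.fun_mul (he i).1, fun v ↦ ?_⟩
    rw [(HasFDerivAt.fun_sum h1).fderiv]
    simp
  obtain ⟨P, hP, hPk⟩ := exists_analyticAt_range_eq_ker hF.fderiv hFs
  obtain ⟨Q, hQ, hQk⟩ := exists_analyticAt_range_eq_ker hG.fderiv hGs
  -- `Φ S` vanishes at `e` if the forms with coefficients `S` annihilate both kernels there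
  let Φ : (Fin (2 * d) → ι → ℤ) → E → Fin (2 * d) → (E →L[ℂ] ℂ) × (E →L[ℂ] ℂ) := fun S e j ↦
    ((fderiv ℂ (ρ S j) e).comp (P e), (fderiv ℂ (ρ S j) e).comp (Q e))
  have hΦ0 : ∀ e, (P e).toLinearMap.range = (fderiv ℂ F e).toLinearMap.ker →
      (Q e).toLinearMap.range = (fderiv ℂ G e).toLinearMap.ker → ∀ S, Φ S e = 0 ↔
      ∀ j, ∀ v ∈ (fderiv ℂ F e).toLinearMap.ker ⊔ (fderiv ℂ G e).toLinearMap.ker,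
        fderiv ℂ (ρ S j) e v = 0 := fun e h1 h2 S ↦ by
    rw [← h1, ← h2]
    refine ⟨fun h j v hv ↦ ?_, fun h ↦ funext fun j ↦ Prod.ext ?_ ?_⟩
    · obtain ⟨_, ⟨a, rfl⟩, _, ⟨b, rfl⟩, rfl⟩ := Submodule.mem_sup.1 hv
      have h3 := congrFun h j
      have h4 := DFunLike.congr_fun (congrArg Prod.fst h3) a
      have h5 := DFunLike.congr_fun (congrArg Prod.snd h3) b
      rw [map_add]
      exact (congrArg₂ (· + ·) h4 h5).trans (add_zero _)
    · ext a
      exact h j _ (Submodule.mem_sup_left ⟨a, rfl⟩)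
    · ext a
      exact h j _ (Submodule.mem_sup_right ⟨a, rfl⟩)
  obtain ⟨ε, hε, hball⟩ := Metric.eventually_nhds_iff_ball.1
    (hρ.eventually_nhds.and (hP.eventually_analyticAt.and (hQ.eventually_analyticAt.and
      (hPk.and (hQk.and hS)))))
  obtain ⟨S, hSΦ⟩ := exists_forall_eq_zero_of_countable
    (ι := {S : Fin (2 * d) → ι → ℤ // LinearIndependent ℝ (fun j i ↦ (S j i : ℝ))})
    (Φ := fun S ↦ Φ S.1) (e₀ := e₀) hε
    (fun S e he ↦ by
      obtain ⟨h1, h2, h3, -⟩ := hball e he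
      refine AnalyticAt.pi fun j ↦ ?_
      have h4 := (h1.self_of_nhds S.1 j).1.fderiv
      exact (analyticAt_clm_comp h4 h2).prod (analyticAt_clm_comp h4 h3))
    (fun e he ↦ by
      obtain ⟨h1, -, -, h4, h5, S, hSi, hS0⟩ := hball e he
      refine ⟨⟨S, hSi⟩, (hΦ0 e h4 h5 S).2 fun j v hv ↦ ?_⟩
      rw [(h1.self_of_nhds S j).2]
      exact hS0 j v hv)
  -- choose a maximal subfamily that is linearly independent over `ℂ` at the given point
  have h0 := hball e₀ (Metric.mem_ball_self hε)
  obtain ⟨f, hfmem, -, hfind⟩ := Submodule.exists_fun_fin_finrank_span_eq ℂ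
    (range fun j ↦ fderiv ℂ (ρ S.1 j) e₀)
  have hkd : d ≤ Module.finrank ℂ (Submodule.span ℂ (range fun j ↦ fderiv ℂ (ρ S.1 j) e₀)) := by
    have h1 : LinearIndependent ℝ fun j ↦ fderiv ℂ (ρ S.1 j) e₀ := by
      rw [Fintype.linearIndependent_iff]
      intro a ha
      refine Fintype.linearIndependent_iff.1 S.2 a (funext fun i ↦ ?_)
      refine Fintype.linearIndependent_iff.1 hind (fun i ↦ (∑ j, a j • fun i ↦ (S.1 j i : ℝ)) i) ?_ i
      ext w
      obtain ⟨v, rfl⟩ := hFs w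
      have h2 := DFunLike.congr_fun ha v
      simp only [FunLike.coe_sum, Finset.sum_apply, FunLike.coe_smul,
        Pi.smul_apply, (h0.1.self_of_nhds S.1 _).2, zero_apply] at h2 ⊢
      rw [← h2]
      simp only [Finset.smul_sum, Finset.sum_smul, smul_eq_mul]
      rw [Finset.sum_comm]
      refine Finset.sum_congr rfl fun i _ ↦ Finset.sum_congr rfl fun j _ ↦ ?_
      simp only [Complex.real_smul]
      push_cast; ring
    exact le_finrank_span_of_linearIndependent_real h1
  generalize Module.finrank ℂ (Submodule.span ℂ (range fun j ↦ fderiv ℂ (ρ S.1 j) e₀)) = k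
    at f hfmem hfind hkd
  choose c hc using hfmem
  refine ⟨k, fun e l ↦ ρ S.1 (c l) e, ?_⟩
  have hcont : ContinuousAt (fun e ↦ fun l : Fin k ↦ fderiv ℂ (ρ S.1 (c l)) e) e₀ :=
    continuousAt_pi.2 fun l ↦ (h0.1.self_of_nhds S.1 (c l)).1.fderiv.continuousAt
  have hopen : ∀ᶠ e in 𝓝 e₀, LinearIndependent ℂ fun l : Fin k ↦ fderiv ℂ (ρ S.1 (c l)) e := by
    refine hcont.eventually (isOpen_setOfPred_linearIndependent.mem_nhds ?_)
    have : (fun l : Fin k ↦ fderiv ℂ (ρ S.1 (c l)) e₀) = f := funext hc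
    change LinearIndependent ℂ fun l : Fin k ↦ fderiv ℂ (ρ S.1 (c l)) e₀
    rw [this]; exact hfind
  filter_upwards [Metric.isOpen_ball.mem_nhds (Metric.mem_ball_self hε), hopen, hrank]
    with e he hli hre
  obtain ⟨h1, -, -, h4, h5, -⟩ := hball e he
  have hg : AnalyticAt ℂ (fun e (l : Fin k) ↦ ρ S.1 (c l) e) e :=
    AnalyticAt.pi fun l ↦ (h1.self_of_nhds S.1 (c l)).1
  have hdg : ∀ v l, fderiv ℂ (fun e (l : Fin k) ↦ ρ S.1 (c l) e) e v l =
      fderiv ℂ (ρ S.1 (c l)) e v := fun v l ↦ by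
    rw [fderiv_pi fun l ↦ (h1.self_of_nhds S.1 (c l)).1.differentiableAt]; rfl
  have hsurj : Function.Surjective (fderiv ℂ (fun e (l : Fin k) ↦ ρ S.1 (c l) e) e) :=
    surjective_of_linearIndependent hdg hli
  refine ⟨hg, hsurj, ?_⟩
  symm
  -- `k ≥ d`, so the kernel is not larger than the sum that it contains
  refine Submodule.eq_of_le_of_finrank_le (fun v hv ↦ ?_) ?_
  · refine LinearMap.mem_ker.2 (funext fun l ↦ ?_)
    exact (hdg v l).trans ((hΦ0 e h4 h5 S.1).1 (hSΦ e he) (c l) v hv)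
  · have h6 := (fderiv ℂ (fun e (l : Fin k) ↦ ρ S.1 (c l) e) e).toLinearMap.finrank_range_add_finrank_ker
    rw [LinearMap.range_eq_top.2 hsurj, finrank_top, Module.finrank_fin_fun] at h6
    omega

end Foliation

/-! ### Integrability near a point -/

section Kernels

variable {E : Type*} [NormedAddCommGroup E] [NormedSpace ℂ E]
  {N : Type*} [TopologicalSpace N] [ChartedSpace E N]
  {E' : Type*} [NormedAddCommGroup E'] [NormedSpace ℂ E']
  {V : Type*} [NormedAddCommGroup V] [NormedSpace ℂ V]
  {V' : Type*} [NormedAddCommGroup V'] [NormedSpace ℂ V']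

variable (E V) in
/-- The kernel of the derivative, as a subspace of the model space. -/
def tker (F : N → V) (x : N) : Submodule ℂ E := (tderiv E V F x).toLinearMap.ker

@[simp] lemma mem_tker {F : N → V} {x : N} {v : E} : v ∈ tker E V F x ↔ tderiv E V F x v = 0 :=
  Iff.rfl

/-- The derivative of a holomorphic chart, as an isomorphism. -/
def IsHolChart.tderivEquiv {Ψ : OpenPartialHomeomorph N E'} (h : IsHolChart (E := E) Ψ) {x : N}
    (hx : x ∈ Ψ.source) : E ≃ₗ[ℂ] E' :=
  LinearEquiv.ofLinearMap (tderiv E E' Ψ x).toLinearMap (tderiv E' E Ψ.symm (Ψ x)).toLinearMap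
    (LinearMap.ext fun v ↦ h.tderiv_tderiv_symm hx v)
    (LinearMap.ext fun v ↦ h.tderiv_symm_tderiv hx v)

lemma IsHolChart.ker_fderiv_comp_symm {Ψ : OpenPartialHomeomorph N E'}
    (h : IsHolChart (E := E) Ψ) {F : N → V} {x : N}
    (hF : MDifferentiableAt 𝓘(ℂ, E) 𝓘(ℂ, V) F x) (hx : x ∈ Ψ.source) :
    (fderiv ℂ (F ∘ Ψ.symm) (Ψ x)).toLinearMap.ker =
      (tker E V F x).map (h.tderivEquiv hx).toLinearMap := by
  ext w
  rw [Submodule.mem_map]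
  constructor
  · intro hw
    refine ⟨(h.tderivEquiv hx).symm w, ?_, (h.tderivEquiv hx).apply_symm_apply w⟩
    rw [mem_tker, ← h.fderiv_comp_symm hF hx]
    change fderiv ℂ (F ∘ Ψ.symm) (Ψ x) (h.tderivEquiv hx ((h.tderivEquiv hx).symm w)) = 0
    rw [LinearEquiv.apply_symm_apply]
    exact hw
  · rintro ⟨v, hv, rfl⟩
    exact (h.fderiv_comp_symm hF hx v).trans hv

omit [NormedSpace ℂ E'] in
/-- Transport of a property that holds near a point to a chart. -/
lemma eventually_symm_of_eventually {Ψ : OpenPartialHomeomorph N E'} {x₀ : N} (hx₀ : x₀ ∈ Ψ.source)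
    {p : N → Prop} (hp : ∀ᶠ x in 𝓝 x₀, p x) :
    ∀ᶠ e in 𝓝 (Ψ x₀), ∃ x ∈ Ψ.source, e = Ψ x ∧ p x := by
  have h1 : ∀ᶠ e in 𝓝 (Ψ x₀), p (Ψ.symm e) :=
    (Ψ.continuousAt_symm (Ψ.map_source hx₀)).eventually (by rwa [Ψ.left_inv hx₀])
  filter_upwards [h1, Ψ.open_target.mem_nhds (Ψ.map_source hx₀)] with e he he'
  exact ⟨Ψ.symm e, Ψ.map_target he', (Ψ.right_inv he').symm, he⟩

lemma finrank_tker [FiniteDimensional ℂ E] {F : N → V} {x : N}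
    (h : Function.Surjective (tderiv E V F x)) :
    Module.finrank ℂ V + Module.finrank ℂ (tker E V F x) = Module.finrank ℂ E := by
  have h1 := (tderiv E V F x).toLinearMap.finrank_range_add_finrank_ker
  rwa [LinearMap.range_eq_top.2 h, finrank_top] at h1

end Kernels

section Local

variable {E : Type*} [NormedAddCommGroup E] [NormedSpace ℂ E] [FiniteDimensional ℂ E]
  {N : Type*} [TopologicalSpace N] [ChartedSpace E N] [T2Space N] [IsManifold 𝓘(ℂ, E) ω N]
  {V : Type*} [NormedAddCommGroup V] [NormedSpace ℂ V] [FiniteDimensional ℂ V]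
  {V' : Type*} [NormedAddCommGroup V'] [NormedSpace ℂ V'] [FiniteDimensional ℂ V']
  {Ω : TwoForm E N} {F : N → V} {U : Set N} {G : N → V'} {U' : Set N}

omit [T2Space N] in
/-- A vector tangent to the fibers of both maps is the velocity of a curve in the intersection of
the fibers, provided the dimension of the intersection of the tangent spaces is constant. -/
lemma exists_curve_of_mem_tker_inf (hU : IsOpen U) (hU' : IsOpen U')
    (hF : ContMDiffOn 𝓘(ℂ, E) 𝓘(ℂ, V) ω F U) (hG : ContMDiffOn 𝓘(ℂ, E) 𝓘(ℂ, V') ω G U')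
    {x : N} (hx : x ∈ U) (hx' : x ∈ U')
    (hconst : ∀ᶠ z in 𝓝 x, Module.finrank ℂ (tker E V F z ⊓ tker E V' G z : Submodule ℂ E) =
      Module.finrank ℂ (tker E V F x ⊓ tker E V' G x : Submodule ℂ E))
    {r : E} (hr : r ∈ tker E V F x ⊓ tker E V' G x) :
    ∃ γ : ℂ → N, MDifferentiableAt 𝓘(ℂ, ℂ) 𝓘(ℂ, E) γ 0 ∧ γ 0 = x ∧ tderiv ℂ E γ 0 1 = r ∧
      ∀ᶠ t in 𝓝 0, F (γ t) = F x ∧ G (γ t) = G x := by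
  have : CompleteSpace E := FiniteDimensional.complete ℂ E
  have : CompleteSpace V := FiniteDimensional.complete ℂ V
  have : CompleteSpace V' := FiniteDimensional.complete ℂ V'
  have hφ := isHolChart_chartAt (E := E) x
  set φ := chartAt E x
  have hsrc : x ∈ φ.source := mem_chart_source E x
  have hFat : ∀ z ∈ U, ContMDiffAt 𝓘(ℂ, E) 𝓘(ℂ, V) ω F z := fun z hz ↦
    hF.contMDiffAt (hU.mem_nhds hz)
  have hGat : ∀ z ∈ U', ContMDiffAt 𝓘(ℂ, E) 𝓘(ℂ, V') ω G z := fun z hz ↦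
    hG.contMDiffAt (hU'.mem_nhds hz)
  let H : E → V × V' := fun e ↦ ((F ∘ φ.symm) e, (G ∘ φ.symm) e)
  have hH : AnalyticAt ℂ H (φ x) :=
    (hφ.analyticAt_comp_symm (hFat x hx) hsrc).prod (hφ.analyticAt_comp_symm (hGat x hx') hsrc)
  have hker : ∀ z ∈ U, z ∈ U' → ∀ hz : z ∈ φ.source, (fderiv ℂ H (φ z)).toLinearMap.ker =
      (tker E V F z ⊓ tker E V' G z).map (hφ.tderivEquiv hz).toLinearMap :=
    fun z hzU hzU' hz ↦ by
    rw [Submodule.map_inf _ (hφ.tderivEquiv hz).injective,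
      ← hφ.ker_fderiv_comp_symm ((hFat z hzU).mdifferentiableAt (by simp)) hz,
      ← hφ.ker_fderiv_comp_symm ((hGat z hzU').mdifferentiableAt (by simp)) hz]
    have h1 := ((hφ.analyticAt_comp_symm (hFat z hzU) hz).differentiableAt.hasFDerivAt.prodMk
      (hφ.analyticAt_comp_symm (hGat z hzU') hz).differentiableAt.hasFDerivAt).fderiv
    rw [h1]
    ext v
    simp
  have hfin : ∀ z ∈ U, z ∈ U' → z ∈ φ.source →
      Module.finrank ℂ (fderiv ℂ H (φ z)).toLinearMap.ker =
      Module.finrank ℂ (tker E V F z ⊓ tker E V' G z : Submodule ℂ E) := fun z hzU hzU' hz ↦ by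
    rw [hker z hzU hzU' hz]
    exact LinearEquiv.finrank_map_eq (hφ.tderivEquiv hz) _
  have hcr : ∀ᶠ e in 𝓝 (φ x), Module.finrank ℂ (fderiv ℂ H e).toLinearMap.ker =
      Module.finrank ℂ (fderiv ℂ H (φ x)).toLinearMap.ker := by
    filter_upwards [eventually_symm_of_eventually hsrc (hconst.and ((hU.eventually_mem hx).and
      (hU'.eventually_mem hx')))] with e ⟨z, hz, he, h1, h2, h3⟩
    rw [he, hfin z h2 h3 hz, hfin x hx hx' hsrc, h1]
  have hr' : fderiv ℂ H (φ x) (tderiv E E φ x r) = 0 := by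
    have : tderiv E E φ x r ∈ (fderiv ℂ H (φ x)).toLinearMap.ker := by
      rw [hker x hx hx' hsrc]
      exact ⟨r, hr, rfl⟩
    exact this
  obtain ⟨γ, hγ, hγ0, hγr, hγH⟩ := exists_curve_of_constant_rank hH hcr hr'
  have hm : MDifferentiableAt 𝓘(ℂ, E) 𝓘(ℂ, E) φ.symm (γ 0) := by
    rw [hγ0]; exact hφ.mdifferentiableAt_symm (φ.map_source hsrc)
  refine ⟨φ.symm ∘ γ, hm.comp 0 hγ.differentiableAt.mdifferentiableAt, ?_, ?_, ?_⟩
  · rw [Function.comp_apply, hγ0, φ.left_inv hsrc]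
  · rw [tderiv_comp 0 hm hγ.differentiableAt.mdifferentiableAt, tderiv_eq_fderiv,
      ContinuousLinearMap.comp_apply, hγr, hγ0]
    exact hφ.tderiv_symm_tderiv hsrc r
  · filter_upwards [hγH] with t ht
    have h1 := congrArg Prod.fst ht
    have h2 := congrArg Prod.snd ht
    simp only [H, Function.comp_apply, φ.left_inv hsrc] at h1 h2
    exact ⟨h1, h2⟩

variable {m : ℕ} {Λ : Submodule ℤ (Fin m → ℂ)} {u : (Fin m → ℂ) → N} {y : V}

/-- If the intersection of the fibers through `u v` is, near `u v`, the image of the affine subspace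
`v + W` with `W` rational, then its tangent space is the image of `W`. -/
lemma IsTorusUniformization.tker_inf_eq_map (h : IsIsotropicSubmersionOn Ω F U) (hU' : IsOpen U')
    (hG : ContMDiffOn 𝓘(ℂ, E) 𝓘(ℂ, V') ω G U')
    (hu : IsTorusUniformization E Λ u (U ∩ F ⁻¹' {y})) {W : Submodule ℂ (Fin m → ℂ)}
    (hW : Submodule.span ℝ ((Λ : Set (Fin m → ℂ)) ∩ W) = W.restrictScalars ℝ) {v : Fin m → ℂ}
    (hv : u v ∈ U')
    (hconst : ∀ᶠ z in 𝓝 (u v), Module.finrank ℂ (tker E V F z ⊓ tker E V' G z : Submodule ℂ E) =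
      Module.finrank ℂ (tker E V F (u v) ⊓ tker E V' G (u v) : Submodule ℂ E))
    (hloc : ∀ᶠ z in 𝓝 (u v), (F z = F (u v) ∧ G z = G (u v)) ↔ ∃ w ∈ W, z = u (v + w)) :
    tker E V F (u v) ⊓ tker E V' G (u v) = W.map (tderiv (Fin m → ℂ) E u v).toLinearMap := by
  refine le_antisymm (fun r hr ↦ ?_) ?_
  · obtain ⟨γ, hγ, hγ0, rfl, hγF⟩ := exists_curve_of_mem_tker_inf h.isOpen hU' h.holomorphic hG
      (hu.mem v).1 hv hconst hr
    have h1 : ∀ᶠ t in 𝓝 (0 : ℂ), ∃ w ∈ W, γ t = u (v + w) := by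
      filter_upwards [hγF, hγ.continuousAt.eventually (by rwa [hγ0])] with t h1 h2
      exact h2.1 h1
    obtain ⟨w, hw, e⟩ := hu.exists_tderiv_eq_of_curve W hW v hγ hγ0 h1
    exact ⟨w, hw, e⟩
  · rintro _ ⟨w, hw, rfl⟩
    refine ⟨hu.tderiv_tderiv_eq_zero h v w, ?_⟩
    -- `G` is constant along the line `v + ℂ w`
    have hl : HasFDerivAt (fun t : ℂ ↦ v + t • w) (ContinuousLinearMap.toSpanSingleton ℂ w) 0 := by
      have := ((hasDerivAt_id (0 : ℂ)).smul_const w).const_add v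
      rw [one_smul] at this
      exact this.hasFDerivAt
    have hl0 : v + (0 : ℂ) • w = v := by simp
    have h1 : (G ∘ u) ∘ (fun t : ℂ ↦ v + t • w) =ᶠ[𝓝 0] fun _ ↦ G (u v) := by
      have hc : ContinuousAt (fun t : ℂ ↦ u (v + t • w)) 0 :=
        hu.holomorphic.continuous.continuousAt.comp hl.continuousAt
      have hloc' : ∀ᶠ z in 𝓝 (u (v + (0 : ℂ) • w)),
          (F z = F (u v) ∧ G z = G (u v)) ↔ ∃ w ∈ W, z = u (v + w) := by rwa [hl0]
      filter_upwards [hc.eventually hloc'] with t ht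
      exact (ht.2 ⟨t • w, W.smul_mem t hw, rfl⟩).2
    have hGv : MDifferentiableAt 𝓘(ℂ, E) 𝓘(ℂ, V') G (u v) :=
      (hG.contMDiffAt (hU'.mem_nhds hv)).mdifferentiableAt (by simp)
    have hGu : MDifferentiableAt 𝓘(ℂ, Fin m → ℂ) 𝓘(ℂ, V') (G ∘ u) (v + (0 : ℂ) • w) := by
      rw [hl0]; exact hGv.comp v (hu.mdifferentiableAt v)
    have h2 := tderiv_comp (g := G ∘ u) (f := fun t : ℂ ↦ v + t • w) 0 hGu
      hl.differentiableAt.mdifferentiableAt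
    rw [tderiv_congr h1, tderiv_eq_fderiv, fderiv_fun_const, tderiv_eq_fderiv (fun t : ℂ ↦ v + t • w),
      hl.fderiv, hl0, tderiv_comp v hGv (hu.mdifferentiableAt v)] at h2
    have h3 := DFunLike.congr_fun h2 1
    simpa using h3.symm

/-- A torus fiber of a submersion has the expected dimension. -/
lemma IsTorusUniformization.finrank_eq (h : IsIsotropicSubmersionOn Ω F U)
    (hu : IsTorusUniformization E Λ u (U ∩ F ⁻¹' {y})) :
    Module.finrank ℂ V + m = Module.finrank ℂ E := by
  have hr : ∀ z ∈ U, Module.finrank ℂ V + Module.finrank ℂ (tker E V F z) = Module.finrank ℂ E :=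
    fun z hz ↦ finrank_tker (h.surjective z hz)
  have h1 := hu.tker_inf_eq_map h h.isOpen h.holomorphic hu.span_inter_top (v := 0) (hu.mem 0).1
    (by
      filter_upwards [h.isOpen.mem_nhds (hu.mem 0).1] with z hz
      have := hr z hz
      have := hr _ (hu.mem 0).1
      rw [inf_idem, inf_idem]; omega)
    (by
      filter_upwards [h.isOpen.mem_nhds (hu.mem 0).1] with z hz
      rw [(hu.mem 0).2, and_self]
      constructor
      · intro hz'
        have : z ∈ U ∩ F ⁻¹' {y} := ⟨hz, hz'⟩
        rw [← hu.range_eq] at this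
        obtain ⟨w, rfl⟩ := this
        exact ⟨w, trivial, by rw [zero_add]⟩
      · rintro ⟨w, -, rfl⟩
        exact (hu.mem _).2)
  rw [inf_idem, Submodule.map_top] at h1
  have h2 := hr _ (hu.mem 0).1
  rw [h1, LinearMap.finrank_range_of_inj (hu.tderiv_injective 0), Module.finrank_fin_fun] at h2
  exact h2

omit [T2Space N] [FiniteDimensional ℂ E] [IsManifold 𝓘(ℂ, E) ω N] [FiniteDimensional ℂ V]
  [FiniteDimensional ℂ V'] in
/-- On a torus fiber, the lattice vectors in a rational subspace `W` tangent to the fibers of both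
maps are, up to positive multiples, integral combinations of given independent periods; the
corresponding combinations of covectors annihilate the sum of the tangent spaces. -/
lemma IsTorusUniformization.exists_int_coefficients (h : IsIsotropicSubmersionOn Ω F U)
    (h' : IsIsotropicSubmersionOn Ω G U')
    (hu : IsTorusUniformization E Λ u (U ∩ F ⁻¹' {y})) {L : (Fin m → ℂ) →L[ℂ] V →L[ℂ] ℂ}
    (hL : IsPeriodMap Ω F u L) {ι : Type*} [Fintype ι] {μ : ι → Fin m → ℂ} (hμ : ∀ i, μ i ∈ Λ)
    (hspan : Submodule.span ℝ (range μ) = ⊤) {W : Submodule ℂ (Fin m → ℂ)}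
    (hW : Submodule.span ℝ ((Λ : Set (Fin m → ℂ)) ∩ W) = W.restrictScalars ℝ) {v : Fin m → ℂ}
    (hv : u v ∈ U') (hG : ∀ w ∈ W, tderiv E V' G (u v) (tderiv (Fin m → ℂ) E u v w) = 0) {d : ℕ}
    (hd : Module.finrank ℂ W = d) :
    ∃ S : Fin (2 * d) → ι → ℤ, LinearIndependent ℝ (fun j i ↦ (S j i : ℝ)) ∧
      ∀ j, ∀ a ∈ tker E V F (u v) ⊔ tker E V' G (u v),
        ∑ i, (S j i : ℂ) * L (μ i) (tderiv E V F (u v) a) = 0 := by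
  have := hu.discrete
  have hdim : Module.finrank ℝ (W.restrictScalars ℝ) = 2 * d := by
    rw [← hd]; exact finrank_real_of_complex W
  obtain ⟨b, hbind, hbmem, -⟩ := exists_basis_mem Λ (W.restrictScalars ℝ) hW
  generalize Module.finrank ℝ (W.restrictScalars ℝ) = n at b hbind hbmem hdim
  subst hdim
  choose q S hq hqS using fun j ↦ exists_zsmul_eq_sum Λ μ hμ hspan (hbmem j).1
  refine ⟨S, ?_, fun j a ha ↦ ?_⟩
  · rw [Fintype.linearIndependent_iff]
    intro c hc j
    have h1 : ∑ j, (c j * q j) • b j = 0 := by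
      have h2 : ∀ j, (c j * q j) • b j = ∑ i, (c j * S j i) • μ i := fun j ↦ by
        rw [mul_smul, Int.cast_smul_eq_zsmul, hqS, Finset.smul_sum]
        refine Finset.sum_congr rfl fun i _ ↦ ?_
        rw [mul_smul, Int.cast_smul_eq_zsmul]
      simp_rw [h2]
      rw [Finset.sum_comm]
      refine Finset.sum_eq_zero fun i _ ↦ ?_
      rw [← Finset.sum_smul]
      have h3 := congrFun hc i
      simp only [Finset.sum_apply, Pi.smul_apply, smul_eq_mul, Pi.zero_apply] at h3
      rw [h3, zero_smul]
    have h2 := Fintype.linearIndependent_iff.1 hbind _ h1 j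
    exact (mul_eq_zero.1 h2).resolve_right (by exact_mod_cast hq j)
  · have h1 : ∑ i, (S j i : ℂ) * L (μ i) (tderiv E V F (u v) a) =
        q j * Ω.bilin (u v) (tderiv (Fin m → ℂ) E u v (b j)) a := by
      have h2 := congrArg (fun x ↦ L x (tderiv E V F (u v) a)) (hqS j)
      simp only [map_sum, map_zsmul, FunLike.coe_sum, Finset.sum_apply] at h2
      rw [hL v (b j) a]
      simpa [zsmul_eq_mul] using h2.symm
    obtain ⟨a₁, ha₁, a₂, ha₂, rfl⟩ := Submodule.mem_sup.1 ha
    rw [h1, map_add,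
      h.isotropic _ (hu.mem v).1 _ _ (hu.tderiv_tderiv_eq_zero h v (b j)) ha₁,
      h'.isotropic _ hv _ _ (hG _ (hbmem j).2) ha₂, add_zero, mul_zero]

/-- Integrability of the sum of the tangent spaces near a point. -/
lemma exists_submersion_tker_eq (h : IsIsotropicSubmersionOn Ω F U)
    (h' : IsIsotropicSubmersionOn Ω G U') (hΩ : IsSymplecticForm Ω)
    (hdim : Module.finrank ℂ V + Module.finrank ℂ V' = Module.finrank ℂ E)
    {x₀ : N} (hx₀ : x₀ ∈ U) (hx₀' : x₀ ∈ U')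
    (hconst : ∀ᶠ x in 𝓝 x₀, Module.finrank ℂ (tker E V F x ⊔ tker E V' G x : Submodule ℂ E) =
      Module.finrank ℂ (tker E V F x₀ ⊔ tker E V' G x₀ : Submodule ℂ E))
    (htor : ∀ᶠ x in 𝓝 x₀, ∃ (m : ℕ) (Λ : Submodule ℤ (Fin m → ℂ)) (u : (Fin m → ℂ) → N)
      (W : Submodule ℂ (Fin m → ℂ)) (v : Fin m → ℂ),
      IsTorusUniformization E Λ u (U ∩ F ⁻¹' {F x}) ∧
      Submodule.span ℝ ((Λ : Set (Fin m → ℂ)) ∩ W) = W.restrictScalars ℝ ∧ u v = x ∧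
      ∀ᶠ z in 𝓝 x, (F z = F x ∧ G z = G x) ↔ ∃ w ∈ W, z = u (v + w)) :
    ∃ (k : ℕ) (g : N → Fin k → ℂ), ∀ᶠ x in 𝓝 x₀,
      ContMDiffAt 𝓘(ℂ, E) 𝓘(ℂ, Fin k → ℂ) ω g x ∧
      Function.Surjective (tderiv E (Fin k → ℂ) g x) ∧
      tker E (Fin k → ℂ) g x = tker E V F x ⊔ tker E V' G x := by
  have : CompleteSpace E := FiniteDimensional.complete ℂ E
  have : CompleteSpace V := FiniteDimensional.complete ℂ V
  have : CompleteSpace V' := FiniteDimensional.complete ℂ V'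
  have hUU : ∀ᶠ x in 𝓝 x₀, x ∈ U ∧ x ∈ U' :=
    (h.isOpen.eventually_mem hx₀).and (h'.isOpen.eventually_mem hx₀')
  -- the dimension of the intersection of the tangent spaces is the codimension of their sum
  have hRD : ∀ x ∈ U, x ∈ U' → Module.finrank ℂ (tker E V F x ⊔ tker E V' G x : Submodule ℂ E) +
      Module.finrank ℂ (tker E V F x ⊓ tker E V' G x : Submodule ℂ E) = Module.finrank ℂ E :=
    fun x hx hx' ↦ by
    have h1 := Submodule.finrank_sup_add_finrank_inf_eq (tker E V F x) (tker E V' G x)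
    have h2 := finrank_tker (h.surjective x hx)
    have h3 := finrank_tker (h'.surjective x hx')
    omega
  set d := Module.finrank ℂ (tker E V F x₀ ⊓ tker E V' G x₀ : Submodule ℂ E) with hd
  have hR : ∀ᶠ x in 𝓝 x₀,
      Module.finrank ℂ (tker E V F x ⊓ tker E V' G x : Submodule ℂ E) = d := by
    filter_upwards [hconst, hUU] with x hx hx'
    have h1 := hRD x hx'.1 hx'.2
    have h2 := hRD x₀ hx₀ hx₀'
    omega
  -- the period forms obtained from a basis of lattice vectors for the fiber through `x₀`
  obtain ⟨m₀, Λ₀, u₀, -, -, hu₀, -⟩ := htor.self_of_nhds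
  obtain ⟨L₀, hL₀⟩ := hu₀.exists_isPeriodMap h hΩ
  obtain ⟨b, hbind, hbmem, -⟩ := exists_basis_mem Λ₀ ⊤ (by simpa using hu₀.span_top)
  choose θ hθ₀ hθ using fun i ↦ exists_period_form h hΩ hu₀ hL₀ (hbmem i).1
  have hind : LinearIndependent ℝ fun i ↦ θ i (F x₀) := by
    simp_rw [hθ₀]
    exact hbind.map' (L₀.toLinearMap.restrictScalars ℝ)
      (LinearMap.ker_eq_bot.2 (hL₀.injective hΩ hu₀))
  have hθind : ∀ᶠ z in 𝓝 (F x₀), LinearIndependent ℝ fun i ↦ θ i z := by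
    have hc : ContinuousAt (fun z i ↦ θ i z) (F x₀) :=
      continuousAt_pi.2 fun i ↦ (hθ i).self_of_nhds.1.continuousAt
    exact hc.eventually (isOpen_setOfPred_linearIndependent.mem_nhds hind)
  have hFc : ContinuousAt F x₀ := (h.contMDiffAt hx₀).continuousAt
  have hS : ∀ᶠ x in 𝓝 x₀, ∃ S : Fin (2 * d) → _ → ℤ,
      LinearIndependent ℝ (fun j i ↦ (S j i : ℝ)) ∧
      ∀ j, ∀ a ∈ tker E V F x ⊔ tker E V' G x,
        ∑ i, (S j i : ℂ) * θ i (F x) (tderiv E V F x a) = 0 := by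
    filter_upwards [htor, hUU, hR.eventually_nhds, hFc.eventually hθind,
      hFc.eventually (Filter.eventually_all.2 hθ)] with x hx hxU hRx hxind hxθ
    obtain ⟨m, Λ, u, W, v, hu, hW, rfl, hloc⟩ := hx
    obtain ⟨L, hL⟩ := hu.exists_isPeriodMap h hΩ
    choose μ hμ hμθ using fun i ↦ (hxθ i).2.2 m Λ u hu L hL
    have hmap := hu.tker_inf_eq_map h h'.isOpen h'.holomorphic hW hxU.2
      (hRx.mono fun z hz ↦ hz.trans hRx.self_of_nhds.symm) hloc
    have hWd : Module.finrank ℂ W = d := by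
      rw [← hRx.self_of_nhds, hmap]
      exact (LinearEquiv.finrank_eq
        (Submodule.equivMapOfInjective _ (hu.tderiv_injective v) W))
    simp_rw [hμθ] at hxind ⊢
    have hμind : LinearIndependent ℝ μ :=
      LinearIndependent.of_comp (L.toLinearMap.restrictScalars ℝ) hxind
    have hspan : Submodule.span ℝ (range μ) = ⊤ := by
      refine hμind.span_eq_top_of_card_eq_finrank' ?_
      have e1 := hu.finrank_eq h
      have e2 := hu₀.finrank_eq h
      have e3 : m = m₀ := by omega
      rw [Fintype.card_fin, finrank_top, finrank_real_of_complex, finrank_real_of_complex,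
        Module.finrank_fin_fun, Module.finrank_fin_fun, e3]
    refine hu.exists_int_coefficients h h' hL hμ hspan hW hxU.2 (fun w hw ↦ ?_) hWd
    have : tderiv (Fin m → ℂ) E u v w ∈ tker E V F (u v) ⊓ tker E V' G (u v) := by
      rw [hmap]; exact ⟨w, hw, rfl⟩
    exact this.2
  -- translation to a chart
  have hφ := isHolChart_chartAt (E := E) x₀
  set φ := chartAt E x₀
  have hsrc : x₀ ∈ φ.source := mem_chart_source E x₀
  have hF0 : (F ∘ φ.symm) (φ x₀) = F x₀ := by rw [Function.comp_apply, φ.left_inv hsrc]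
  have hsup : ∀ x ∈ U, x ∈ U' → ∀ hx : x ∈ φ.source,
      (fderiv ℂ (F ∘ φ.symm) (φ x)).toLinearMap.ker ⊔ (fderiv ℂ (G ∘ φ.symm) (φ x)).toLinearMap.ker =
      (tker E V F x ⊔ tker E V' G x).map (hφ.tderivEquiv hx).toLinearMap := fun x hxU hxU' hx ↦ by
    rw [hφ.ker_fderiv_comp_symm (h.mdifferentiableAt hxU) hx,
      hφ.ker_fderiv_comp_symm (h'.mdifferentiableAt hxU') hx, Submodule.map_sup]
  have hsF : Function.Surjective (fderiv ℂ (F ∘ φ.symm) (φ x₀)) := fun w ↦ by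
    obtain ⟨a, rfl⟩ := h.surjective x₀ hx₀ w
    exact ⟨_, hφ.fderiv_comp_symm (h.mdifferentiableAt hx₀) hsrc a⟩
  have hsG : Function.Surjective (fderiv ℂ (G ∘ φ.symm) (φ x₀)) := fun w ↦ by
    obtain ⟨a, rfl⟩ := h'.surjective x₀ hx₀' w
    exact ⟨_, hφ.fderiv_comp_symm (h'.mdifferentiableAt hx₀') hsrc a⟩
  obtain ⟨k, g, hg⟩ := exists_submersion_ker_eq (d := d) (θ := θ)
    (hφ.analyticAt_comp_symm (h.contMDiffAt hx₀) hsrc) hsF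
    (hφ.analyticAt_comp_symm (h'.contMDiffAt hx₀') hsrc) hsG
    (fun i ↦ by rw [hF0]; exact (hθ i).mono fun z hz ↦ ⟨hz.1, hz.2.1⟩)
    (by rw [hF0]; exact hind)
    (by
      filter_upwards [eventually_symm_of_eventually hsrc (hUU.and hR)] with e ⟨x, hx, he, hxU, hxR⟩
      rw [he, hsup x hxU.1 hxU.2 hx, ← hRD x hxU.1 hxU.2, hxR]
      congr 1
      exact LinearEquiv.finrank_map_eq (hφ.tderivEquiv hx) _)
    (by
      filter_upwards [eventually_symm_of_eventually hsrc (hUU.and hS)]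
        with e ⟨x, hx, he, hxU, S, hSi, hS0⟩
      refine ⟨S, hSi, fun j a ha ↦ ?_⟩
      subst he
      rw [hsup x hxU.1 hxU.2 hx] at ha
      obtain ⟨a, ha, rfl⟩ := ha
      have h1 := hφ.fderiv_comp_symm (h.mdifferentiableAt hxU.1) hx a
      have h2 : (F ∘ φ.symm) (φ x) = F x := by rw [Function.comp_apply, φ.left_inv hx]
      rw [← hS0 j a ha, ← h1, h2]
      rfl)
  refine ⟨k, g ∘ φ, ?_⟩
  have hφc : ContinuousAt φ x₀ := φ.continuousAt hsrc
  filter_upwards [hφc.eventually hg, hUU, φ.open_source.mem_nhds hsrc] with x ⟨hgx, hgs, hgk⟩ hxU hx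
  have hdg : tderiv E (Fin k → ℂ) (g ∘ φ) x = (fderiv ℂ g (φ x)).comp (tderiv E E φ x) := by
    rw [tderiv_comp x hgx.differentiableAt.mdifferentiableAt (hφ.mdifferentiableAt hx),
      tderiv_eq_fderiv]
  refine ⟨hgx.contDiffAt.contMDiffAt.comp x (hφ.contMDiffAt hx), ?_, ?_⟩
  · rw [hdg]
    exact hgs.comp (hφ.tderivEquiv hx).surjective
  · rw [hsup x hxU.1 hxU.2 hx] at hgk
    ext a
    have h1 : a ∈ tker E (Fin k → ℂ) (g ∘ φ) x ↔
        hφ.tderivEquiv hx a ∈ (fderiv ℂ g (φ x)).toLinearMap.ker := by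
      rw [mem_tker, hdg]; rfl
    rw [h1, hgk]
    exact (hφ.tderivEquiv hx).injective.mem_set_image

end Local

/-! ### Lagrangian fibrations in charts of the base -/

section Fibration

variable {E : Type*} [NormedAddCommGroup E] [NormedSpace ℂ E]
  {N : Type*} [TopologicalSpace N] [ChartedSpace E N]
  {E' : Type*} [NormedAddCommGroup E'] [NormedSpace ℂ E']
  {B : Type*} [TopologicalSpace B] [ChartedSpace E' B]
  {Ω : TwoForm E N} {O : Set N} {f : N → B}

/-- A fibration followed by a chart of its base. -/
abbrev chartMap (E' : Type*) [NormedAddCommGroup E'] {B : Type*} [TopologicalSpace B]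
    [ChartedSpace E' B] (f : N → B) (b : B) : N → E' := chartAt E' b ∘ f

/-- The part of `O` that the fibration maps to the domain of a chart of its base. -/
abbrev chartDom (E' : Type*) [NormedAddCommGroup E'] {B : Type*} [TopologicalSpace B]
    [ChartedSpace E' B] (O : Set N) (f : N → B) (b : B) : Set N :=
  O ∩ f ⁻¹' (chartAt E' b).source

namespace IsSmoothLagrangianFibrationOn

variable (h : IsSmoothLagrangianFibrationOn (E' := E') Ω O f) (hO : IsOpen O)
include h hO

lemma contMDiffAt {x : N} (hx : x ∈ O) : ContMDiffAt 𝓘(ℂ, E) 𝓘(ℂ, E') ω f x :=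
  h.holomorphic.contMDiffAt (hO.mem_nhds hx)

lemma isOpen_chartDom (b : B) : IsOpen (chartDom E' O f b) :=
  h.holomorphic.continuousOn.isOpen_inter_preimage hO (chartAt E' b).open_source

variable [IsManifold 𝓘(ℂ, E') ω B]

lemma contMDiffOn_chartMap (b : B) :
    ContMDiffOn 𝓘(ℂ, E) 𝓘(ℂ, E') ω (chartMap E' f b) (chartDom E' O f b) := fun x hx ↦
  (((isHolChart_chartAt (E := E') b).contMDiffAt hx.2).comp x
    (h.contMDiffAt hO hx.1)).contMDiffWithinAt

lemma tderiv_chartMap {b : B} {x : N} (hx : x ∈ chartDom E' O f b) (v : E) :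
    tderiv E E' (chartMap E' f b) x v =
      (isHolChart_chartAt (E := E') b).tderivEquiv hx.2 (tderiv E E' f x v) := by
  rw [tderiv_comp x ((isHolChart_chartAt (E := E') b).mdifferentiableAt hx.2)
    ((h.contMDiffAt hO hx.1).mdifferentiableAt (by simp))]
  rfl

lemma tker_chartMap {b : B} {x : N} (hx : x ∈ chartDom E' O f b) :
    tker E E' (chartMap E' f b) x = fiberTangent (E' := E') f x := by
  ext v
  rw [mem_tker, h.tderiv_chartMap hO hx, LinearEquiv.map_eq_zero_iff]
  rfl

lemma surjective_tderiv_chartMap {b : B} {x : N} (hx : x ∈ chartDom E' O f b) :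
    Function.Surjective (tderiv E E' (chartMap E' f b) x) := fun w ↦ by
  obtain ⟨v, hv⟩ := h.submersion x hx.1 (((isHolChart_chartAt (E := E') b).tderivEquiv hx.2).symm w)
  refine ⟨v, (h.tderiv_chartMap hO hx v).trans ?_⟩
  exact (congrArg _ hv).trans (LinearEquiv.apply_symm_apply _ w)

variable [FiniteDimensional ℂ E] [FiniteDimensional ℂ E'] [IsManifold 𝓘(ℂ, E) ω N]

/-- Submersions are open. -/
lemma map_nhds_eq {x : N} (hx : x ∈ O) : Filter.map f (𝓝 x) = 𝓝 (f x) := by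
  have : CompleteSpace E := FiniteDimensional.complete ℂ E
  have : CompleteSpace E' := FiniteDimensional.complete ℂ E'
  have hφ := isHolChart_chartAt (E := E) x
  set φ := chartAt E x
  have hsrc : x ∈ φ.source := mem_chart_source E x
  set c := chartAt E' (f x) with hc
  have hcs : f x ∈ c.source := mem_chart_source E' (f x)
  have hxD : x ∈ chartDom E' O f (f x) := ⟨hx, hcs⟩
  have hF := (h.contMDiffOn_chartMap hO (f x)).contMDiffAt
    ((h.isOpen_chartDom hO (f x)).mem_nhds hxD)
  set F := chartMap E' f (f x) with hFd
  have hF' : AnalyticAt ℂ (F ∘ φ.symm) (φ x) := hφ.analyticAt_comp_symm hF hsrc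
  have hFs : Function.Surjective (fderiv ℂ (F ∘ φ.symm) (φ x)) := fun w ↦ by
    obtain ⟨a, rfl⟩ := h.surjective_tderiv_chartMap hO hxD w
    exact ⟨_, hφ.fderiv_comp_symm (hF.mdifferentiableAt (by simp)) hsrc a⟩
  have h1 := hF'.hasStrictFDerivAt.map_nhds_eq_of_surj (LinearMap.range_eq_top.2 hFs)
  have hval : (F ∘ φ.symm) (φ x) = c (f x) := by
    simp only [hFd, hc, Function.comp_apply, φ.left_inv hsrc]
  have h2 : f =ᶠ[𝓝 x] c.symm ∘ (F ∘ φ.symm) ∘ φ := by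
    filter_upwards [φ.open_source.mem_nhds hsrc,
      (h.isOpen_chartDom hO (f x)).mem_nhds hxD] with z hz hz'
    simp only [hFd, hc, Function.comp_apply, φ.left_inv hz]
    exact (c.left_inv hz'.2).symm
  rw [Filter.map_congr h2, ← Filter.map_map, ← Filter.map_map, φ.map_nhds_eq hsrc, h1, hval,
    c.symm.map_nhds_eq (c.map_source hcs), c.left_inv hcs]

/-- The fibers of a Lagrangian fibration are isotropic everywhere, by continuity. -/
lemma bilin_eq_zero (hΩ : IsSymplecticForm Ω) {x : N} (hx : x ∈ O) {v w : E}
    (hv : tderiv E E' f x v = 0) (hw : tderiv E E' f x w = 0) : Ω.bilin x v w = 0 := by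
  have : CompleteSpace E := FiniteDimensional.complete ℂ E
  have : CompleteSpace E' := FiniteDimensional.complete ℂ E'
  have hφ := isHolChart_chartAt (E := E) x
  set φ := chartAt E x
  have hsrc : x ∈ φ.source := mem_chart_source E x
  have hxD : x ∈ chartDom E' O f (f x) := ⟨hx, mem_chart_source E' (f x)⟩
  have hD := (h.isOpen_chartDom hO (f x))
  have hF : ∀ z ∈ chartDom E' O f (f x),
      ContMDiffAt 𝓘(ℂ, E) 𝓘(ℂ, E') ω (chartMap E' f (f x)) z := fun z hz ↦
    (h.contMDiffOn_chartMap hO (f x)).contMDiffAt (hD.mem_nhds hz)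
  have htk : ∀ z ∈ chartDom E' O f (f x), tker E E' (chartMap E' f (f x)) z =
    fiberTangent (E' := E') f z := fun z hz ↦ h.tker_chartMap hO hz
  set F := chartMap E' f (f x)
  have hF' : AnalyticAt ℂ (F ∘ φ.symm) (φ x) := hφ.analyticAt_comp_symm (hF x hxD) hsrc
  have hFs : Function.Surjective (fderiv ℂ (F ∘ φ.symm) (φ x)) := fun w ↦ by
    obtain ⟨a, rfl⟩ := h.surjective_tderiv_chartMap hO hxD w
    exact ⟨_, hφ.fderiv_comp_symm ((hF x hxD).mdifferentiableAt (by simp)) hsrc a⟩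
  obtain ⟨P, hP, hPk⟩ := exists_analyticAt_range_eq_ker hF'.fderiv hFs
  have hPz : ∀ z, ∀ hz : z ∈ φ.source, z ∈ chartDom E' O f (f x) →
      (P (φ z)).toLinearMap.range = (fderiv ℂ (F ∘ φ.symm) (φ z)).toLinearMap.ker →
      ∀ a, ∃ a' ∈ fiberTangent (E' := E') f z, P (φ z) a = tderiv E E φ z a' :=
    fun z hz hzD hzP a ↦ by
    have h1 : P (φ z) a ∈ (P (φ z)).toLinearMap.range := ⟨a, rfl⟩
    rw [hzP, hφ.ker_fderiv_comp_symm ((hF z hzD).mdifferentiableAt (by simp)) hz] at h1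
    obtain ⟨a', ha', e⟩ := h1
    exact ⟨a', by rw [← htk z hzD]; exact ha', e.symm⟩
  have hrange : ∀ a : E, tderiv E E' f x a = 0 → ∃ a', P (φ x) a' = tderiv E E φ x a := fun a ha ↦ by
    have h1 : tderiv E E φ x a ∈ (P (φ x)).toLinearMap.range := by
      rw [hPk.self_of_nhds, hφ.ker_fderiv_comp_symm ((hF x hxD).mdifferentiableAt (by simp)) hsrc]
      exact ⟨a, by rw [htk x hxD]; exact ha, rfl⟩
    exact h1
  obtain ⟨v', hv'⟩ := hrange v hv
  obtain ⟨w', hw'⟩ := hrange w hw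
  have hsm : ContMDiffAt 𝓘(ℂ, E) 𝓘(ℂ, E) ω φ.symm (φ x) := hφ.contMDiffAt_symm (φ.map_source hsrc)
  -- extend both vectors to sections of the tangent spaces of the fibers
  let β : E → ℂ := fun e ↦ pullback Ω φ.symm e (P e v') (P e w')
  have hβ : ContinuousAt (β ∘ φ) x := by
    have h1 : ContinuousAt β (φ x) :=
      (analyticAt_clm_apply (analyticAt_clm_apply (hΩ.analyticAt_pullback hsm)
        (analyticAt_clm_apply hP analyticAt_const))
        (analyticAt_clm_apply hP analyticAt_const)).continuousAt
    exact h1.comp (φ.continuousAt hsrc)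
  have hβx : ∀ z, ∀ hz : z ∈ φ.source, ∀ a b a' b', P (φ z) a = tderiv E E φ z a' →
      P (φ z) b = tderiv E E φ z b' →
      pullback Ω φ.symm (φ z) (P (φ z) a) (P (φ z) b) = Ω.bilin z a' b' :=
    fun z hz a b a' b' ha hb ↦ by
    rw [pullback_apply, ha, hb, hφ.tderiv_symm_tderiv hz, hφ.tderiv_symm_tderiv hz, φ.left_inv hz]
  rw [← hβx x hsrc v' w' v w hv' hw']
  by_contra hne
  obtain ⟨T, -, hTd, hT⟩ := h.lagrangian
  have h1 : ∃ᶠ z in 𝓝 x, f z ∈ T := by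
    have h2 : ∃ᶠ b in 𝓝 (f x), b ∈ T := mem_closure_iff_frequently.1 (hTd (f x))
    rw [← h.map_nhds_eq hO hx] at h2
    exact Filter.frequently_map.1 h2
  have hxc : ∀ᶠ z in 𝓝 x, (P (φ z)).toLinearMap.range =
      (fderiv ℂ (F ∘ φ.symm) (φ z)).toLinearMap.ker := (φ.continuousAt hsrc).eventually hPk
  obtain ⟨z, hzT, hzD, hzs, hzP, hzβ⟩ := (h1.and_eventually ((hD.eventually_mem hxD).and
    ((φ.open_source.eventually_mem hsrc).and (hxc.and (hβ.eventually_ne hne))))).exists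
  obtain ⟨a, ha, ea⟩ := hPz z hzs hzD hzP v'
  obtain ⟨b, hb, eb⟩ := hPz z hzs hzD hzP w'
  refine hzβ ?_
  change pullback Ω φ.symm (φ z) (P (φ z) v') (P (φ z) w') = 0
  rw [hβx z hzs v' w' a b ea eb]
  exact (Ω.bilin_apply z a b).trans ((hT z hzD.1 hzT a).1 ha b hb)

lemma isIsotropicSubmersionOn (hΩ : IsSymplecticForm Ω) (b : B) :
    IsIsotropicSubmersionOn Ω (chartMap E' f b) (chartDom E' O f b) where
  isOpen := h.isOpen_chartDom hO b
  holomorphic := h.contMDiffOn_chartMap hO b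
  surjective x hx := h.surjective_tderiv_chartMap hO hx
  isotropic x hx v w hv hw := by
    rw [h.tderiv_chartMap hO hx, LinearEquiv.map_eq_zero_iff] at hv hw
    exact h.bilin_eq_zero hO hΩ hx.1 hv hw

omit hO [FiniteDimensional ℂ E'] [IsManifold 𝓘(ℂ, E) ω N] [IsManifold 𝓘(ℂ, E') ω B] in
/-- The base of a Lagrangian fibration has half the dimension of the total space. -/
lemma finrank_eq (hΩ : IsSymplecticForm Ω) [Nonempty B] :
    2 * Module.finrank ℂ E' = Module.finrank ℂ E := by
  obtain ⟨T, -, hTd, hT⟩ := h.lagrangian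
  obtain ⟨b, hb⟩ := hTd.nonempty
  obtain ⟨x, hx, rfl⟩ : b ∈ f '' O := by rw [h.surjective]; trivial
  have hL := hT x hx hb
  let β : LinearMap.BilinForm ℂ E := LinearMap.mk₂ ℂ (fun v w ↦ Ω.bilin x v w)
    (fun _ _ _ ↦ by simp) (fun _ _ _ ↦ by simp) (fun _ _ _ ↦ by simp) (fun _ _ _ ↦ by simp)
  have hβ : β.Nondegenerate := by
    rw [LinearMap.BilinForm.nondegenerate_iff_ker_eq_bot, LinearMap.ker_eq_bot']
    intro v hv
    exact hΩ.eq_zero_of_bilin x v fun w ↦ LinearMap.congr_fun hv w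
  let K : Submodule ℂ E := (tderiv E E' f x).toLinearMap.ker
  have horth : β.orthogonal K = K := by
    ext v
    rw [LinearMap.BilinForm.mem_orthogonal_iff]
    refine Iff.trans ?_ (hL v).symm
    refine forall₂_congr fun w _ ↦ ?_
    have h1 : β w v = - Ω x ![v, w] := by
      change Ω.bilin x w v = _
      rw [Ω.bilin_swap]
      exact congrArg _ (Ω.bilin_apply x v w)
    rw [h1]
    exact neg_eq_zero
  have h1 := LinearMap.BilinForm.finrank_orthogonal hβ K
  have h2 := (tderiv E E' f x).toLinearMap.finrank_range_add_finrank_ker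
  have hs : Function.Surjective (tderiv E E' f x).toLinearMap := h.submersion x hx
  rw [LinearMap.range_eq_top.2 hs, finrank_top] at h2
  change _ + Module.finrank ℂ K = _ at h2
  rw [horth] at h1
  have h3 := Submodule.finrank_le K
  omega

end IsSmoothLagrangianFibrationOn

end Fibration

/-! ### Generic rank of the sum of the tangent spaces -/

section Subbundle

variable {E : Type*} [NormedAddCommGroup E] [NormedSpace ℂ E] [FiniteDimensional ℂ E]
  {N : Type*} [TopologicalSpace N] [ChartedSpace E N] [IsManifold 𝓘(ℂ, E) ω N]

/-- A vector field that is holomorphic in a chart is a holomorphic section of the tangent bundle. -/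
lemma contMDiffOn_tangent_of_chart (x₀ : N) {X : (y : N) → TangentSpace 𝓘(ℂ, E) y} {ξ : E → E}
    {A : Set N} (hA : IsOpen A) (hsub : A ⊆ (chartAt E x₀).source)
    (hξ : ∀ y ∈ A, AnalyticAt ℂ ξ (chartAt E x₀ y))
    (hX : ∀ y ∈ A, tderiv E E (chartAt E x₀) y (X y) = ξ (chartAt E x₀ y)) :
    ContMDiffOn 𝓘(ℂ, E) 𝓘(ℂ, E).tangent ω
      (fun y ↦ (⟨y, X y⟩ : TangentBundle 𝓘(ℂ, E) N)) A := by
  have : CompleteSpace E := FiniteDimensional.complete ℂ E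
  have hφ := isHolChart_chartAt (E := E) x₀
  refine ((trivializationAt E (TangentSpace 𝓘(ℂ, E)) x₀).contMDiffOn_section_iff hA hsub).2 ?_
  have h1 : ContMDiffOn 𝓘(ℂ, E) 𝓘(ℂ, E) ω (fun y ↦ ξ (chartAt E x₀ y)) A := fun y hy ↦
    ((hξ y hy).contDiffAt.contMDiffAt.comp y (hφ.contMDiffAt (hsub hy))).contMDiffWithinAt
  refine h1.congr fun y hy ↦ ?_
  rw [← hX y hy]
  have h2 := TangentBundle.continuousLinearMapAt_trivializationAt (I := 𝓘(ℂ, E)) (hsub hy)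
  have h3 : (trivializationAt E (TangentSpace 𝓘(ℂ, E)) x₀).continuousLinearMapAt ℂ y (X y) =
      (trivializationAt E (TangentSpace 𝓘(ℂ, E)) x₀ ⟨y, X y⟩).2 := by
    rw [Bundle.Trivialization.continuousLinearMapAt_apply,
      Bundle.Trivialization.coe_linearMapAt_of_mem _ (hsub hy)]
  rw [← h3, h2]
  have h4 : (extChartAt 𝓘(ℂ, E) x₀ : N → E) = chartAt E x₀ := by ext; simp
  have h5 : ∀ g : N → E, g = chartAt E x₀ → mfderiv 𝓘(ℂ, E) 𝓘(ℂ, E) g y (X y) =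
      tderiv E E (chartAt E x₀) y (X y) := by
    rintro _ rfl; rfl
  exact h5 _ h4

variable {V : Type*} [NormedAddCommGroup V] [NormedSpace ℂ V] [FiniteDimensional ℂ V]
  {V' : Type*} [NormedAddCommGroup V'] [NormedSpace ℂ V'] [FiniteDimensional ℂ V']
  {F : N → V} {G : N → V'}

/-- At a point where its rank is locally maximal, the sum of the tangent spaces to the fibers of two
submersions has a holomorphic frame. -/
lemma exists_frame_of_finrank_le {x₀ : N}
    (hF : ∀ᶠ x in 𝓝 x₀, ContMDiffAt 𝓘(ℂ, E) 𝓘(ℂ, V) ω F x)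
    (hFs : Function.Surjective (tderiv E V F x₀))
    (hG : ∀ᶠ x in 𝓝 x₀, ContMDiffAt 𝓘(ℂ, E) 𝓘(ℂ, V') ω G x)
    (hGs : Function.Surjective (tderiv E V' G x₀))
    (hmax : ∀ᶠ x in 𝓝 x₀, Module.finrank ℂ (tker E V F x ⊔ tker E V' G x : Submodule ℂ E) ≤
      Module.finrank ℂ (tker E V F x₀ ⊔ tker E V' G x₀ : Submodule ℂ E)) :
    ∃ (k : ℕ) (ξ : Fin k → E → E), ∀ᶠ x in 𝓝 x₀, x ∈ (chartAt E x₀).source ∧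
      (∀ l, AnalyticAt ℂ (ξ l) (chartAt E x₀ x)) ∧
      LinearIndependent ℂ (fun l ↦ ξ l (chartAt E x₀ x)) ∧
      Submodule.span ℂ (range fun l ↦ ξ l (chartAt E x₀ x)) =
        (tker E V F x ⊔ tker E V' G x).map (tderiv E E (chartAt E x₀) x).toLinearMap := by
  have : CompleteSpace E := FiniteDimensional.complete ℂ E
  have : CompleteSpace V := FiniteDimensional.complete ℂ V
  have : CompleteSpace V' := FiniteDimensional.complete ℂ V'
  have hφ := isHolChart_chartAt (E := E) x₀
  set φ := chartAt E x₀
  have hsrc : x₀ ∈ φ.source := mem_chart_source E x₀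
  have hsF : Function.Surjective (fderiv ℂ (F ∘ φ.symm) (φ x₀)) := fun w ↦ by
    obtain ⟨a, rfl⟩ := hFs w
    exact ⟨_, hφ.fderiv_comp_symm (hF.self_of_nhds.mdifferentiableAt (by simp)) hsrc a⟩
  have hsG : Function.Surjective (fderiv ℂ (G ∘ φ.symm) (φ x₀)) := fun w ↦ by
    obtain ⟨a, rfl⟩ := hGs w
    exact ⟨_, hφ.fderiv_comp_symm (hG.self_of_nhds.mdifferentiableAt (by simp)) hsrc a⟩
  obtain ⟨P, hP, hPk⟩ := exists_analyticAt_range_eq_ker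
    (hφ.analyticAt_comp_symm hF.self_of_nhds hsrc).fderiv hsF
  obtain ⟨Q, hQ, hQk⟩ := exists_analyticAt_range_eq_ker
    (hφ.analyticAt_comp_symm hG.self_of_nhds hsrc).fderiv hsG
  let b := Module.finBasis ℂ E
  let s : Fin (Module.finrank ℂ E) ⊕ Fin (Module.finrank ℂ E) → E → E :=
    Sum.elim (fun i e ↦ P e (b i)) (fun i e ↦ Q e (b i))
  have hs : ∀ᶠ e in 𝓝 (φ x₀), ∀ i, AnalyticAt ℂ (s i) e := by
    filter_upwards [hP.eventually_analyticAt, hQ.eventually_analyticAt] with e h1 h2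
    rintro (i | i)
    · exact analyticAt_clm_apply h1 analyticAt_const
    · exact analyticAt_clm_apply h2 analyticAt_const
  have hrange : ∀ A : E →L[ℂ] E, Submodule.span ℂ (range fun i ↦ A (b i)) = A.toLinearMap.range :=
    fun A ↦ by
    rw [LinearMap.range_eq_map, ← b.span_eq, Submodule.map_span, ← range_comp]; rfl
  have hspan : ∀ e, Submodule.span ℂ (range fun i ↦ s i e) =
      (P e).toLinearMap.range ⊔ (Q e).toLinearMap.range := fun e ↦ by
    have h1 : (range fun i ↦ s i e) = range (fun i ↦ P e (b i)) ∪ range fun i ↦ Q e (b i) := by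
      ext v; simp [s]
    rw [h1, Submodule.span_union, hrange, hrange]
  have hD : ∀ᶠ x in 𝓝 x₀, x ∈ φ.source ∧ ∃ hx : x ∈ φ.source,
      Submodule.span ℂ (range fun i ↦ s i (φ x)) =
        (tker E V F x ⊔ tker E V' G x).map (hφ.tderivEquiv hx).toLinearMap := by
    filter_upwards [φ.open_source.mem_nhds hsrc, hF, hG, (φ.continuousAt hsrc).eventually hPk,
      (φ.continuousAt hsrc).eventually hQk] with x hx h1 h2 h3 h4
    refine ⟨hx, hx, ?_⟩
    rw [hspan, h3, h4, hφ.ker_fderiv_comp_symm (h1.mdifferentiableAt (by simp)) hx,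
      hφ.ker_fderiv_comp_symm (h2.mdifferentiableAt (by simp)) hx, Submodule.map_sup]
  obtain ⟨ξ, hξmem, -, hξind⟩ :=
    Submodule.exists_fun_fin_finrank_span_eq ℂ (range fun i ↦ s i (φ x₀))
  have hk : Module.finrank ℂ (Submodule.span ℂ (range fun i ↦ s i (φ x₀))) =
      Module.finrank ℂ (tker E V F x₀ ⊔ tker E V' G x₀ : Submodule ℂ E) := by
    obtain ⟨-, hx, h1⟩ := hD.self_of_nhds
    rw [h1]
    exact LinearEquiv.finrank_map_eq (hφ.tderivEquiv hx) _
  generalize Module.finrank ℂ (Submodule.span ℂ (range fun i ↦ s i (φ x₀))) = k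
    at ξ hξmem hξind hk
  choose c hc using hξmem
  refine ⟨k, fun l ↦ s (c l), ?_⟩
  have hind : ∀ᶠ e in 𝓝 (φ x₀), LinearIndependent ℂ fun l ↦ s (c l) e := by
    have hcont : ContinuousAt (fun e l ↦ s (c l) e) (φ x₀) :=
      continuousAt_pi.2 fun l ↦ (hs.self_of_nhds (c l)).continuousAt
    refine hcont.eventually (isOpen_setOfPred_linearIndependent.mem_nhds ?_)
    have : (fun l ↦ s (c l) (φ x₀)) = ξ := funext hc
    change LinearIndependent ℂ fun l ↦ s (c l) (φ x₀)
    rw [this]; exact hξind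
  filter_upwards [hD, hmax, (φ.continuousAt hsrc).eventually hs,
    (φ.continuousAt hsrc).eventually hind] with x ⟨hx, _, h1⟩ h2 h3 h4
  refine ⟨hx, fun l ↦ h3 (c l), h4, ?_⟩
  change _ = (tker E V F x ⊔ tker E V' G x).map (hφ.tderivEquiv hx).toLinearMap
  rw [← h1]
  refine Submodule.eq_of_le_of_finrank_le (Submodule.span_mono ?_) ?_
  · rintro _ ⟨l, rfl⟩
    exact ⟨c l, rfl⟩
  · rw [finrank_span_eq_card h4, Fintype.card_fin, h1, hk]
    exact (LinearEquiv.finrank_map_eq (hφ.tderivEquiv hx) _).trans_le h2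

end Subbundle

section Conclusion

variable {E : Type*} [NormedAddCommGroup E] [NormedSpace ℂ E] [FiniteDimensional ℂ E]
  {N : Type*} [TopologicalSpace N] [ChartedSpace E N] [IsManifold 𝓘(ℂ, E) ω N]
  {E₁ : Type*} [NormedAddCommGroup E₁] [NormedSpace ℂ E₁] [FiniteDimensional ℂ E₁]
  {B : Type*} [TopologicalSpace B] [ChartedSpace E₁ B] [IsManifold 𝓘(ℂ, E₁) ω B]
  {E₂ : Type*} [NormedAddCommGroup E₂] [NormedSpace ℂ E₂] [FiniteDimensional ℂ E₂]
  {Q : Type*} [TopologicalSpace Q] [ChartedSpace E₂ Q] [IsManifold 𝓘(ℂ, E₂) ω Q]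
  {Ω : TwoForm E N} {f : N → B} {O₁ : Set N} {O : Set N} {ψ : N → Q}

omit [FiniteDimensional ℂ E] [FiniteDimensional ℂ E₁] [FiniteDimensional ℂ E₂]
  [IsManifold 𝓘(ℂ, E) ω N] in
lemma sumDistribution_eq (hf : IsSmoothLagrangianFibrationOn (E' := E₁) Ω O₁ f) (hO₁ : IsOpen O₁)
    (hψ : IsSmoothLagrangianFibrationOn (E' := E₂) Ω O ψ) (hO : IsOpen O) {b : B} {q : Q} {x : N}
    (hx : x ∈ chartDom E₁ O₁ f b) (hx' : x ∈ chartDom E₂ O ψ q) :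
    sumDistribution E E₁ E₂ f ψ x =
      tker E E₁ (chartMap E₁ f b) x ⊔ tker E E₂ (chartMap E₂ ψ q) x := by
  rw [hf.tker_chartMap hO₁ hx, hψ.tker_chartMap hO hx']
  rfl

/-- Near a point where its rank is maximal, the sum of the tangent spaces is a subbundle. -/
lemma exists_isHolomorphicSubbundleOn
    (hf : IsSmoothLagrangianFibrationOn (E' := E₁) Ω univ f)
    (hψ : IsSmoothLagrangianFibrationOn (E' := E₂) Ω O ψ) (hO : IsOpen O) {U : Set N}
    (hU : IsOpen U) (hne : U.Nonempty) (hUO : U ⊆ O) :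
    ∃ O' : Set N, IsOpen O' ∧ IsConnected O' ∧ O' ⊆ U ∧
      IsHolomorphicSubbundleOn (sumDistribution E E₁ E₂ f ψ) O' := by
  let D : N → Submodule ℂ E := fun x ↦ sumDistribution E E₁ E₂ f ψ x
  -- the corank, whose minimum exists
  let r : N → ℕ := fun x ↦ Module.finrank ℂ E - Module.finrank ℂ (D x)
  set x₀ := Function.argminOn r U hne
  have hx₀ : x₀ ∈ U := Function.argminOn_mem r U hne
  have hmax : ∀ x ∈ U, Module.finrank ℂ (D x) ≤ Module.finrank ℂ (D x₀) := fun x hx ↦ by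
    have h1 : r x₀ ≤ r x := Function.argminOn_le r U hx
    have h2 := Submodule.finrank_le (D x)
    have h3 := Submodule.finrank_le (D x₀)
    simp only [r] at h1
    omega
  have hx1 : x₀ ∈ chartDom E₁ univ f (f x₀) := ⟨trivial, mem_chart_source E₁ (f x₀)⟩
  have hx2 : x₀ ∈ chartDom E₂ O ψ (ψ x₀) := ⟨hUO hx₀, mem_chart_source E₂ (ψ x₀)⟩
  have ho1 := hf.isOpen_chartDom isOpen_univ (f x₀)
  have ho2 := hψ.isOpen_chartDom hO (ψ x₀)
  have hev : ∀ᶠ x in 𝓝 x₀, x ∈ U ∧ x ∈ chartDom E₁ univ f (f x₀) ∧ x ∈ chartDom E₂ O ψ (ψ x₀) :=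
    (hU.eventually_mem hx₀).and ((ho1.eventually_mem hx1).and (ho2.eventually_mem hx2))
  have hD : ∀ x, x ∈ chartDom E₁ univ f (f x₀) → x ∈ chartDom E₂ O ψ (ψ x₀) →
      D x = tker E E₁ (chartMap E₁ f (f x₀)) x ⊔
        tker E E₂ (chartMap E₂ ψ (ψ x₀)) x := fun x h1 h2 ↦
    sumDistribution_eq hf isOpen_univ hψ hO h1 h2
  obtain ⟨k, ξ, hξ⟩ := exists_frame_of_finrank_le (x₀ := x₀)
    (hev.mono fun x hx ↦ (hf.contMDiffOn_chartMap isOpen_univ (f x₀)).contMDiffAt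
      (ho1.mem_nhds hx.2.1))
    (hf.surjective_tderiv_chartMap isOpen_univ hx1)
    (hev.mono fun x hx ↦ (hψ.contMDiffOn_chartMap hO (ψ x₀)).contMDiffAt (ho2.mem_nhds hx.2.2))
    (hψ.surjective_tderiv_chartMap hO hx2)
    (hev.mono fun x hx ↦ by
      rw [← hD x hx.2.1 hx.2.2, ← hD x₀ hx1 hx2]; exact hmax x hx.1)
  have hφ := isHolChart_chartAt (E := E) x₀
  set φ := chartAt E x₀ with hφd
  have hsrc : x₀ ∈ φ.source := mem_chart_source E x₀
  obtain ⟨A, hA, hAo, hxA⟩ := mem_nhds_iff.1 (hξ.and hev)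
  have h1 : ∀ᶠ e in 𝓝 (φ x₀), e ∈ φ.target ∧ φ.symm e ∈ A :=
    (φ.open_target.eventually_mem (φ.map_source hsrc)).and
      ((φ.continuousAt_symm (φ.map_source hsrc)).eventually
        (hAo.mem_nhds (by rwa [φ.left_inv hsrc])))
  obtain ⟨ε, hε, hball⟩ := Metric.eventually_nhds_iff_ball.1 h1
  have hsubt : Metric.ball (φ x₀) ε ⊆ φ.target := fun e he ↦ (hball e he).1
  have hopen : IsOpen (φ.symm '' Metric.ball (φ x₀) ε) :=
    φ.isOpen_image_symm_of_subset_target Metric.isOpen_ball hsubt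
  have hmem := fun x (hx : x ∈ φ.symm '' Metric.ball (φ x₀) ε) ↦
    hA (image_subset_iff.2 (fun e he ↦ (hball e he).2) hx)
  refine ⟨φ.symm '' Metric.ball (φ x₀) ε, hopen, ?_, fun x hx ↦ (hmem x hx).2.1, fun x hx ↦ ?_⟩
  · exact ((convex_ball _ _).isConnected ⟨_, Metric.mem_ball_self hε⟩).image _
      (φ.continuousOn_symm.mono hsubt)
  refine ⟨_, hopen, hx, subset_rfl, k, fun l y ↦ tderiv E E φ.symm (φ y) (ξ l (φ y)),
    fun l ↦ ?_, fun y hy ↦ ?_⟩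
  · refine contMDiffOn_tangent_of_chart x₀ (ξ := ξ l) hopen (fun y hy ↦ (hmem y hy).1.1)
      (fun y hy ↦ (hmem y hy).1.2.1 l) fun y hy ↦ ?_
    exact hφ.tderiv_tderiv_symm (hmem y hy).1.1 _
  · obtain ⟨⟨hys, -, hyi, hysp⟩, -, hy1, hy2⟩ := hmem y hy
    constructor
    · exact hyi.map' (hφ.tderivEquiv hys).symm.toLinearMap (LinearEquiv.ker _)
    · have h2 : range (fun l ↦ tderiv E E φ.symm (φ y) (ξ l (φ y))) =
          (hφ.tderivEquiv hys).symm.toLinearMap '' range fun l ↦ ξ l (φ y) := by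
        rw [← range_comp]; rfl
      have h3 : Submodule.span ℂ (range fun l ↦ tderiv E E φ.symm (φ y) (ξ l (φ y))) =
          tker E E₁ (chartMap E₁ f (f x₀)) y ⊔ tker E E₂ (chartMap E₂ ψ (ψ x₀)) y := by
        rw [h2, ← Submodule.map_span, hysp]
        change Submodule.map _ (Submodule.map (hφ.tderivEquiv hys).toLinearMap _) = _
        rw [← Submodule.map_comp, LinearEquiv.symm_comp, Submodule.map_id]
      exact h3.trans (hD y hy1 hy2).symm

/-- Where the sum of the tangent spaces is a subbundle and the intersections of the fibers are open
in subtori, it is integrable. -/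
lemma isIntegrableOn_sumDistribution [T2Space N] [Nonempty B] [Nonempty Q]
    (hΩ : IsSymplecticForm Ω)
    (hf : IsSmoothLagrangianFibrationOn (E' := E₁) Ω univ f)
    (hψ : IsSmoothLagrangianFibrationOn (E' := E₂) Ω O ψ) (hO : IsOpen O) {O' : Set N}
    (hO' : IsOpen O') (hO'O : O' ⊆ O)
    (hsub : IsHolomorphicSubbundleOn (sumDistribution E E₁ E₂ f ψ) O')
    (htor : ∀ x ∈ O', IsOpenInSubtorus E (O' ∩ (f ⁻¹' {f x} ∩ ψ ⁻¹' {ψ x})) (f ⁻¹' {f x})) :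
    IsIntegrableOn (sumDistribution E E₁ E₂ f ψ) O' := by
  intro x₀ hx₀
  have hx1 : x₀ ∈ chartDom E₁ univ f (f x₀) := ⟨trivial, mem_chart_source E₁ (f x₀)⟩
  have hx2 : x₀ ∈ chartDom E₂ O ψ (ψ x₀) := ⟨hO'O hx₀, mem_chart_source E₂ (ψ x₀)⟩
  have h1 := hf.isIsotropicSubmersionOn isOpen_univ hΩ (f x₀)
  have h2 := hψ.isIsotropicSubmersionOn hO hΩ (ψ x₀)
  have hev : ∀ᶠ x in 𝓝 x₀, x ∈ O' ∧ x ∈ chartDom E₁ univ f (f x₀) ∧ x ∈ chartDom E₂ O ψ (ψ x₀) :=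
    (hO'.eventually_mem hx₀).and ((h1.isOpen.eventually_mem hx1).and (h2.isOpen.eventually_mem hx2))
  have hD : ∀ x, x ∈ chartDom E₁ univ f (f x₀) → x ∈ chartDom E₂ O ψ (ψ x₀) →
      sumDistribution E E₁ E₂ f ψ x = tker E E₁ (chartMap E₁ f (f x₀)) x ⊔
        tker E E₂ (chartMap E₂ ψ (ψ x₀)) x := fun x h1 h2 ↦
    sumDistribution_eq hf isOpen_univ hψ hO h1 h2
  have hdim : Module.finrank ℂ E₁ + Module.finrank ℂ E₂ = Module.finrank ℂ E := by
    have e1 := hf.finrank_eq hΩ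
    have e2 := hψ.finrank_eq hΩ
    omega
  obtain ⟨A, hA, hxA, -, k, X, -, hX⟩ := hsub x₀ hx₀
  have hrank : ∀ y ∈ A, Module.finrank ℂ (sumDistribution E E₁ E₂ f ψ y : Submodule ℂ E) = k :=
    fun y hy ↦ by
    have e1 := finrank_span_eq_card (hX y hy).1
    rw [(hX y hy).2, Fintype.card_fin] at e1
    exact e1
  obtain ⟨k, g, hg⟩ := exists_submersion_tker_eq h1 h2 hΩ hdim hx1 hx2
    (by
      filter_upwards [hev, hA.mem_nhds hxA] with x hx hxA'
      rw [← hD x hx.2.1 hx.2.2, ← hD x₀ hx1 hx2]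
      exact (hrank x hxA').trans (hrank x₀ hxA).symm)
    (by
      filter_upwards [hev] with x hx
      obtain ⟨T, ⟨m, Λ, u, hu, W, v₀, hW, rfl⟩, H, hH, hTH⟩ := htor x hx.1
      have hinj : ∀ z, z ∈ chartDom E₁ univ f (f x₀) →
          (chartMap E₁ f (f x₀) z = chartMap E₁ f (f x₀) x ↔ f z = f x) := fun z hz ↦
        (chartAt E₁ (f x₀)).injOn.eq_iff hz.2 hx.2.1.2
      have hinj' : ∀ z, z ∈ chartDom E₂ O ψ (ψ x₀) →
          (chartMap E₂ ψ (ψ x₀) z = chartMap E₂ ψ (ψ x₀) x ↔ ψ z = ψ x) := fun z hz ↦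
        (chartAt E₂ (ψ x₀)).injOn.eq_iff hz.2 hx.2.2.2
      have hfib : chartDom E₁ univ f (f x₀) ∩
          chartMap E₁ f (f x₀) ⁻¹' {chartMap E₁ f (f x₀) x} = f ⁻¹' {f x} := by
        ext z
        constructor
        · rintro ⟨hz, hz'⟩
          exact (hinj z hz).1 hz'
        · intro hz
          have hz' : f z = f x := hz
          have hzD : z ∈ chartDom E₁ univ f (f x₀) := ⟨trivial, by
            rw [mem_preimage, hz']; exact hx.2.1.2⟩
          exact ⟨hzD, (hinj z hzD).2 hz'⟩
      have hxT : x ∈ u '' {v | v - v₀ ∈ W} ∩ H := by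
        rw [← hTH]; exact ⟨hx.1, rfl, rfl⟩
      obtain ⟨⟨v, hv, rfl⟩, hxH⟩ := hxT
      refine ⟨m, Λ, u, W, v, by rw [hfib]; exact hu, hW, rfl, ?_⟩
      filter_upwards [hH.mem_nhds hxH, hO'.mem_nhds hx.1, h1.isOpen.mem_nhds hx.2.1,
        h2.isOpen.mem_nhds hx.2.2] with z hzH hzO' hz1 hz2
      rw [hinj z hz1, hinj' z hz2]
      have hz : (f z = f (u v) ∧ ψ z = ψ (u v)) ↔ z ∈ u '' {v | v - v₀ ∈ W} ∩ H := by
        rw [← hTH]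
        exact ⟨fun h ↦ ⟨hzO', h.1, h.2⟩, fun h ↦ ⟨h.2.1, h.2.2⟩⟩
      rw [hz]
      constructor
      · rintro ⟨⟨v', hv', rfl⟩, -⟩
        refine ⟨v' - v, ?_, by rw [add_sub_cancel]⟩
        have := W.sub_mem hv' hv
        rwa [sub_sub_sub_cancel_right] at this
      · rintro ⟨w, hw, rfl⟩
        refine ⟨⟨v + w, ?_, rfl⟩, hzH⟩
        have := W.add_mem hv hw
        rwa [← add_sub_right_comm] at this)
  obtain ⟨A', hA', hA'o, hxA'⟩ := mem_nhds_iff.1 (hg.and hev)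
  refine ⟨A', hA'o, hxA', fun x hx ↦ (hA' hx).2.1, k, g,
    fun x hx ↦ (hA' hx).1.1.contMDiffWithinAt, fun x hx ↦ ?_⟩
  obtain ⟨⟨-, hs, hk⟩, -, hxd1, hxd2⟩ := hA' hx
  exact ⟨hs, (hD x hxd1 hxd2).trans hk.symm⟩

end Conclusion

end LagrangianTori

end

theorem mainTheorem4
    {E : Type*} [NormedAddCommGroup E] [NormedSpace ℂ E] [FiniteDimensional ℂ E]
    {N : Type*} [TopologicalSpace N] [T2Space N] [SecondCountableTopology N] [ConnectedSpace N]
    [ChartedSpace E N] [IsManifold 𝓘(ℂ, E) ω N]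
    {E₁ : Type*} [NormedAddCommGroup E₁] [NormedSpace ℂ E₁] [FiniteDimensional ℂ E₁]
    {B : Type*} [TopologicalSpace B] [T2Space B] [SecondCountableTopology B] [ConnectedSpace B]
    [ChartedSpace E₁ B] [IsManifold 𝓘(ℂ, E₁) ω B]
    {E₂ : Type*} [NormedAddCommGroup E₂] [NormedSpace ℂ E₂] [FiniteDimensional ℂ E₂]
    {Q : Type*} [TopologicalSpace Q] [T2Space Q] [SecondCountableTopology Q] [ConnectedSpace Q]
    [ChartedSpace E₂ Q] [IsManifold 𝓘(ℂ, E₂) ω Q]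
    -- the symplectic manifold and the proper Lagrangian fibration by tori with Lagrangian section
    (Ω : LagrangianTori.TwoForm E N) (hΩ : LagrangianTori.IsSymplecticForm Ω)
    (f : N → B) (hf : LagrangianTori.IsSmoothLagrangianFibrationOn (E' := E₁) Ω univ f)
    (hproper : IsProperMap f)
    (htorus : ∀ b : B, LagrangianTori.IsComplexTorus E (f ⁻¹' {b}))
    (σ : B → N) (hσ : LagrangianTori.IsLagrangianSection (E' := E₁) Ω f σ)
    -- the second Lagrangian fibration, defined on `O`
    (O : Set N) (hO : IsOpen O) (hOc : IsConnected O)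
    (ψ : N → Q) (hψ : LagrangianTori.IsSmoothLagrangianFibrationOn (E' := E₂) Ω O ψ) :
    -- after shrinking, the sum distribution is a subbundle
    (∀ U : Set N, IsOpen U → U.Nonempty → U ⊆ O →
      ∃ O' : Set N, IsOpen O' ∧ IsConnected O' ∧ O' ⊆ U ∧
        LagrangianTori.IsHolomorphicSubbundleOn
          (LagrangianTori.sumDistribution E E₁ E₂ f ψ) O') ∧
    -- wherever it is a subbundle and the intersections are open in subtori, it is integrable
    (∀ O' : Set N, IsOpen O' → O' ⊆ O →
      LagrangianTori.IsHolomorphicSubbundleOn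
        (LagrangianTori.sumDistribution E E₁ E₂ f ψ) O' →
      (∀ x ∈ O', LagrangianTori.IsOpenInSubtorus E
        (O' ∩ (f ⁻¹' {f x} ∩ ψ ⁻¹' {ψ x})) (f ⁻¹' {f x})) →
      LagrangianTori.IsIntegrableOn (LagrangianTori.sumDistribution E E₁ E₂ f ψ) O') := by
  exact ⟨fun U hU hne hUO ↦
      LagrangianTori.exists_isHolomorphicSubbundleOn hf hψ hO hU hne hUO,
    fun O' hO' hO'O hsub htor ↦
      LagrangianTori.isIntegrableOn_sumDistribution hΩ hf hψ hO hO' hO'O hsub htor⟩
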